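/- Relations are subsets $R\subseteq\{0,1\}^n$ with $n\ge 1$. A set $\Gamma$ of relations is a *co-clone* if it contains the equality relation $EQ=\{(0,0),(1,1)\}$ and is closed under manipulation with variables (passing from $R(x_1,\dots,x_n)$ to $R(x_{\pi(1)},\dots,x_{\pi(n)})$ as a relation in $x_1,\dots,x_m$, for any $\pi:\{1,\dots,n\}\to\{1,\dots,m\}$), conjunction and existential quantification. It is a *max-co-clone* if it contains $EQ$ and is closed under manipulation with variables, conjunction and max-implementation, which sends $R(x_1,\dots,x_n,y_1,\dots,y_m)$, $n\ge1$, to the set of all $a\in\{0,1\}^n$ for which the number of $b\in\{0,1\}^m$ with $(a,b)\in R$ is maximal among all $a\in\{0,1\}^n$. Every set of relations generates a smallest co-clone and a smallest max-co-clone. A relation is *affine* if it is the solution set of a system of linear equations over $GF(2)$. Let $\delta_c=\{(c)\}$, $NEQ=\{(0,1),(1,0)\}$, $IMP=\{(0,0),(0,1),(1,1)\}$, $OR^k=\{0,1\}^k\setminus\{(0,\dots,0)\}$, $NAND^k=\{0,1\}^k\setminus\{(1,\dots,1)\}$, and $Compl_{k,\ell}=\{0,1\}^{k+\ell}\setminus\{(0^k,1^\ell),(1^k,0^\ell)\}$;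 all arities are at least 1. Consider the ordinary co-clones generated by the following bases, where $k\ge2$: - $IBF$: $\{EQ\}$; $IR_0$: $\{EQ,\delta_0\}$; $IR_1$: $\{EQ,\delta_1\}$; $IR_2$: $\{EQ,\delta_0,\delta_1\}$; $IM_2$: $\{IMP,\delta_0,\delta_1\}$; - $IS_0^k$: $\{EQ\}\cup\{OR^\ell:\ell\le k\}$; $IS_0$: $\{EQ\}\cup\{OR^\ell:\ell\ge1\}$; $IS_{02}^k$, $IS_{02}$: the same together with $\delta_0$; - $IS_1^k$: $\{EQ\}\cup\{NAND^\ell:\ell\le k\}$; $IS_1$: $\{EQ\}\cup\{NAND^\ell:\ell\ge1\}$; $IS_{12}^k$, $IS_{12}$: the same together with $\delta_1$; - $ID$: $\{EQ,NEQ\}$; $ID_1$: $\{EQ,NEQ,\delta_0,\delta_1\}$; - the co-clones generated by equations $x_1\oplus\dots\oplus x_j=c$, $j\ge1$: $IL$ ($j$ even, $c=0$), $IL_0$ ($c=0$), $IL_1$ ($c\equiv j \bmod 2$), $IL_3$ ($j$ even), $IL_2$ (all $j,c$); - $IN_2$: $\{Compl_{k,\ell}: k+\ell\ge1\}$; $II_2$: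 $\{x_1\vee\dots\vee x_k\vee\neg y_1\vee\dots\vee\neg y_\ell: k,\ell\ge1\}\cup\{\delta_0,\delta_1\}$. **Theorem.** 1. A set $\Gamma$ of relations is a max-co-clone if and only if $\Gamma=C$ or $\Gamma=C\cup\{\emptyset\}$ for some $C$ on this list, where $C\cup\{\emptyset\}$ is $C$ together with the empty relations of all arities. A co-clone $C$ on the list contains an empty relation if and only if it is not one of $IBF,IR_0,IR_1,IS_0^k,IS_0,IS_1^k,IS_1,IL,IL_0,IL_1$. 2. The listed co-clones are pairwise distinct, and the inclusion order on them, as well as on the sets $C\cup\{\emptyset\}$, is the reflexive transitive closure of the following relations ($k\ge2$ arbitrary): $IBF<IR_0,IR_1,ID,IL$; $IR_0<IR_2,IL_0,IS_1^2$; $IR_1<IR_2,IL_1,IS_0^2$; $IR_2<ID_1,IM_2,IS_{02}^2,IS_{12}^2$; $ID<ID_1,IL_3$; $IL<IL_0,IL_1,IL_3$; $ID_1,IL_0,IL_1,IL_3<IL_2$; $IL_3<IN_2$; $IS_0^k<IS_0^{k+1},IS_0,IS_{02}^k$; $IS_0<IS_{02}$; $IS_{02}^k<IS_{02}^{k+1},IS_{02}$;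 $IS_1^k<IS_1^{k+1},IS_1,IS_{12}^k$; $IS_1<IS_{12}$; $IS_{12}^k<IS_{12}^{k+1},IS_{12}$; $IM_2,IS_{02},IS_{12},IL_2,IN_2<II_2$. 3. As a max-co-clone, $IM_2$ is generated by $\{IMP\}$, $IS_0^k$ by $\{EQ,OR^k\}$, $IS_1^k$ by $\{EQ,NAND^k\}$, $IS_{02}^k$ by $\{EQ,\delta_0,OR^k\}$, $IN_2$ by $\{Compl_{3,0}\}$, $II_2$ by $\{IMP,OR^2\}$, and each other co-clone on the list by its basis above. 4. A set of affine relations is a max-co-clone if and only if it is a co-clone. Every max-co-clone other than the set of all relations either consists of affine relations, or is $IN_2$ or $IM_2$, or is $C$ or $C\cup\{\emptyset\}$ for some $C$ among $IS_0^k,IS_0,IS_{02}^k,IS_{02},IS_1^k,IS_1,IS_{12}^k,IS_{12}$ with $k\ge2$. 5. Every max-co-clone is a co-clone. -/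

import Mathlib

/-- A relation on `{0,1}` (`false` is `0`, `true` is `1`) of positive arity. -/
structure BoolRel where
  arity : ℕ
  pos : 0 < arity
  tuples : Set (Fin arity → Bool)

namespace BoolRel

/-- Manipulation with variables: the relation `R(π(x₁), …, π(xₙ))` in the variables `x₁, …, xₘ`. -/
def manip {n m : ℕ} (R : Set (Fin n → Bool)) (π : Fin n → Fin m) : Set (Fin m → Bool) :=
  {a | (fun i => a (π i)) ∈ R}

/-- The number of extensions of `a` to a tuple of `R`. -/
noncomputable def numExt {n m : ℕ} (R : Set (Fin (n + m) → Bool)) (a : Fin n → Bool) : ℕ :=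
  {b : Fin m → Bool | Fin.append a b ∈ R}.ncard

/-- Max-implementation: the tuples whose number of extensions to a tuple of `R` is the maximal
one among all tuples. -/
def maxImpl {n m : ℕ} (R : Set (Fin (n + m) → Bool)) : Set (Fin n → Bool) :=
  {a | ∀ c : Fin n → Bool, numExt R c ≤ numExt R a}

/-- Existential quantification over the last `m` variables. -/
def exist {n m : ℕ} (R : Set (Fin (n + m) → Bool)) : Set (Fin n → Bool) :=
  {a | ∃ b : Fin m → Bool, Fin.append a b ∈ R}

/-! ### Some relations -/

/-- The unary constant relation `{(c)}`. -/
def const (c : Bool) : BoolRel := ⟨1, by norm_num, {a | a 0 = c}⟩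

/-- Equality. -/
def EQ : BoolRel := ⟨2, by norm_num, {a | a 0 = a 1}⟩

/-- Disequality. -/
def NEQ : BoolRel := ⟨2, by norm_num, {a | a 0 ≠ a 1}⟩

/-- The implication `¬ x ∨ y`. -/
def IMP : BoolRel := ⟨2, by norm_num, {a | a 0 = false ∨ a 1 = true}⟩

/-- `OR^k = {0,1}^k - {(0,…,0)}`. -/
def OR (k : ℕ) (hk : 0 < k) : BoolRel := ⟨k, hk, {a | a ≠ fun _ => false}⟩

/-- `NAND^k = {0,1}^k - {(1,…,1)}`. -/
def NAND (k : ℕ) (hk : 0 < k) : BoolRel := ⟨k, hk, {a | a ≠ fun _ => true}⟩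

/-- `Compl_{k,l} = {0,1}^{k+l} - {(0,…,0,1,…,1), (1,…,1,0,…,0)}` (`k` entries, then `l`). -/
def Compl (k l : ℕ) (h : 0 < k + l) : BoolRel :=
  ⟨k + l, h,
    {a | a ≠ Fin.append (fun _ : Fin k => false) (fun _ : Fin l => true) ∧
         a ≠ Fin.append (fun _ : Fin k => true) (fun _ : Fin l => false)}⟩

/-- The clause `x₁ ∨ … ∨ xₖ ∨ ¬ y₁ ∨ … ∨ ¬ yₗ`. -/
def Clause (k l : ℕ) (h : 0 < k + l) : BoolRel :=
  ⟨k + l, h,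
    {a | (∃ i : Fin k, a (Fin.castAdd l i) = true) ∨ (∃ j : Fin l, a (Fin.natAdd k j) = false)}⟩

/-- `0, 1` as elements of the two-element field. -/
def toGF (b : Bool) : ZMod 2 := if b then 1 else 0

/-- The linear equation `x₁ ⊕ … ⊕ xₖ = c`. -/
def XOR (k : ℕ) (hk : 0 < k) (c : ZMod 2) : BoolRel := ⟨k, hk, {a | ∑ i, toGF (a i) = c}⟩

/-- A relation is affine if it is the set of solutions of a system of linear equations over the
two-element field. -/
def IsAffine (R : BoolRel) : Prop :=
  ∃ (l : ℕ) (A : Matrix (Fin l) (Fin R.arity) (ZMod 2)) (c : Fin l → ZMod 2),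
    R.tuples = {a | A.mulVec (fun i => toGF (a i)) = c}

end BoolRel

open BoolRel

/-! ### Co-clones and max-co-clones -/

/-- A co-clone: contains equality, and is closed under manipulation with variables, conjunction
and existential quantification. -/
structure IsCoclone (Γ : Set BoolRel) : Prop where
  eq : EQ ∈ Γ
  manip : ∀ (n m : ℕ) (hn : 0 < n) (hm : 0 < m) (R : Set (Fin n → Bool)) (π : Fin n → Fin m),
    (⟨n, hn, R⟩ : BoolRel) ∈ Γ → (⟨m, hm, BoolRel.manip R π⟩ : BoolRel) ∈ Γ
  conj : ∀ (n : ℕ) (hn : 0 < n) (R S : Set (Fin n → Bool)),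
    (⟨n, hn, R⟩ : BoolRel) ∈ Γ → (⟨n, hn, S⟩ : BoolRel) ∈ Γ → (⟨n, hn, R ∩ S⟩ : BoolRel) ∈ Γ
  exist : ∀ (n m : ℕ) (hn : 0 < n) (hnm : 0 < n + m) (R : Set (Fin (n + m) → Bool)),
    (⟨n + m, hnm, R⟩ : BoolRel) ∈ Γ → (⟨n, hn, BoolRel.exist R⟩ : BoolRel) ∈ Γ

/-- A max-co-clone: contains equality, and is closed under manipulation with variables,
conjunction and max-implementation. -/
structure IsMaxCoclone (Γ : Set BoolRel) : Prop where
  eq : EQ ∈ Γ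
  manip : ∀ (n m : ℕ) (hn : 0 < n) (hm : 0 < m) (R : Set (Fin n → Bool)) (π : Fin n → Fin m),
    (⟨n, hn, R⟩ : BoolRel) ∈ Γ → (⟨m, hm, BoolRel.manip R π⟩ : BoolRel) ∈ Γ
  conj : ∀ (n : ℕ) (hn : 0 < n) (R S : Set (Fin n → Bool)),
    (⟨n, hn, R⟩ : BoolRel) ∈ Γ → (⟨n, hn, S⟩ : BoolRel) ∈ Γ → (⟨n, hn, R ∩ S⟩ : BoolRel) ∈ Γ
  maxImpl : ∀ (n m : ℕ) (hn : 0 < n) (hnm : 0 < n + m) (R : Set (Fin (n + m) → Bool)),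
    (⟨n + m, hnm, R⟩ : BoolRel) ∈ Γ → (⟨n, hn, BoolRel.maxImpl R⟩ : BoolRel) ∈ Γ

/-- The smallest co-clone containing `B`. -/
def cocloneGen (B : Set BoolRel) : Set BoolRel := ⋂₀ {Γ | IsCoclone Γ ∧ B ⊆ Γ}

/-- The smallest max-co-clone containing `B`. -/
def maxCocloneGen (B : Set BoolRel) : Set BoolRel := ⋂₀ {Γ | IsMaxCoclone Γ ∧ B ⊆ Γ}

/-- `Γ` together with the empty relation of every positive arity. -/
def withEmpty (Γ : Set BoolRel) : Set BoolRel := Γ ∪ {R | R.tuples = ∅}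

/-! ### The list of Boolean max-co-clones -/

/-- The nodes of the lattice. In the four chains the parameter `r` stands for the superscript
`r + 2`; for example `IS0k r` is `IS_0^{r+2}`. -/
inductive PostNode where
  | IBF | IR0 | IR1 | IR2 | IM2
  | IS0k (r : ℕ) | IS0 | IS1k (r : ℕ) | IS1
  | IS02k (r : ℕ) | IS02 | IS12k (r : ℕ) | IS12
  | ID | ID1 | IL | IL0 | IL1 | IL2 | IL3 | IN2 | II2

namespace PostNode

/-- The relations `OR^l`, `1 ≤ l ≤ k`. -/
def orUpTo (k : ℕ) : Set BoolRel := {R | ∃ (l : ℕ) (hl : 0 < l), l ≤ k ∧ R = OR l hl}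

/-- The relations `OR^l`, `1 ≤ l`. -/
def orAll : Set BoolRel := {R | ∃ (l : ℕ) (hl : 0 < l), R = OR l hl}

/-- The relations `NAND^l`, `1 ≤ l ≤ k`. -/
def nandUpTo (k : ℕ) : Set BoolRel := {R | ∃ (l : ℕ) (hl : 0 < l), l ≤ k ∧ R = NAND l hl}

/-- The relations `NAND^l`, `1 ≤ l`. -/
def nandAll : Set BoolRel := {R | ∃ (l : ℕ) (hl : 0 < l), R = NAND l hl}

/-- The equations `x₁ ⊕ … ⊕ xₖ = c` with `k ≥ 1` and `P k c`. -/
def xors (P : ℕ → ZMod 2 → Prop) : Set BoolRel :=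
  {R | ∃ (k : ℕ) (hk : 0 < k) (c : ZMod 2), P k c ∧ R = XOR k hk c}

/-- The usual bases of the ordinary Boolean co-clones that are on the list. -/
def basis : PostNode → Set BoolRel
  | IBF => {EQ}
  | IR0 => {EQ, const false}
  | IR1 => {EQ, const true}
  | IR2 => {EQ, const false, const true}
  | IM2 => {IMP, const false, const true}
  | IS0k r => {EQ} ∪ orUpTo (r + 2)
  | IS0 => {EQ} ∪ orAll
  | IS1k r => {EQ} ∪ nandUpTo (r + 2)
  | IS1 => {EQ} ∪ nandAll
  | IS02k r => {EQ, const false} ∪ orUpTo (r + 2)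
  | IS02 => {EQ, const false} ∪ orAll
  | IS12k r => {EQ, const true} ∪ nandUpTo (r + 2)
  | IS12 => {EQ, const true} ∪ nandAll
  | ID => {EQ, NEQ}
  | ID1 => {EQ, NEQ, const false, const true}
  | IL => xors (fun k c => Even k ∧ c = 0)
  | IL0 => xors (fun _ c => c = 0)
  | IL1 => xors (fun k c => (k : ZMod 2) = c)
  | IL2 => xors (fun _ _ => True)
  | IL3 => xors (fun k _ => Even k)
  | IN2 => {R | ∃ (k l : ℕ) (h : 0 < k + l), R = Compl k l h}
  | II2 => {R | ∃ (k l : ℕ) (h : 0 < k + l), 1 ≤ k ∧ 1 ≤ l ∧ R = Clause k l h} ∪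
      {const false, const true}

/-- The ordinary Boolean co-clone with the given name. -/
def coclone (ν : PostNode) : Set BoolRel := cocloneGen ν.basis

/-- The generating sets with respect to max-implementation. -/
def maxBasis : PostNode → Set BoolRel
  | IBF => {EQ}
  | IR0 => {EQ, const false}
  | IR1 => {EQ, const true}
  | IR2 => {EQ, const false, const true}
  | IM2 => {IMP}
  | IS0k r => {EQ, OR (r + 2) (Nat.succ_pos _)}
  | IS0 => {EQ} ∪ orAll
  | IS1k r => {EQ, NAND (r + 2) (Nat.succ_pos _)}
  | IS1 => {EQ} ∪ nandAll
  | IS02k r => {EQ, const false, OR (r + 2) (Nat.succ_pos _)}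
  | IS02 => {EQ, const false} ∪ orAll
  | IS12k r => {EQ, const true} ∪ nandUpTo (r + 2)
  | IS12 => {EQ, const true} ∪ nandAll
  | ID => {EQ, NEQ}
  | ID1 => {EQ, NEQ, const false, const true}
  | IL => xors (fun k c => Even k ∧ c = 0)
  | IL0 => xors (fun _ c => c = 0)
  | IL1 => xors (fun k c => (k : ZMod 2) = c)
  | IL2 => xors (fun _ _ => True)
  | IL3 => xors (fun k _ => Even k)
  | IN2 => {Compl 3 0 (by norm_num)}
  | II2 => {IMP, OR 2 (by norm_num)}

/-- The edges of the diagram of the lattice, directed upwards (together with the edges that put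
the limit of each of the four infinite chains above the members of the chain). -/
inductive Edge : PostNode → PostNode → Prop
  | IBF_IR0 : Edge IBF IR0
  | IBF_IR1 : Edge IBF IR1
  | IBF_ID : Edge IBF ID
  | IBF_IL : Edge IBF IL
  | IR0_IR2 : Edge IR0 IR2
  | IR1_IR2 : Edge IR1 IR2
  | IR0_IL0 : Edge IR0 IL0
  | IR1_IL1 : Edge IR1 IL1
  | IR2_ID1 : Edge IR2 ID1
  | ID_ID1 : Edge ID ID1
  | ID_IL3 : Edge ID IL3
  | IL_IL0 : Edge IL IL0
  | IL_IL1 : Edge IL IL1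
  | IL_IL3 : Edge IL IL3
  | ID1_IL2 : Edge ID1 IL2
  | IL0_IL2 : Edge IL0 IL2
  | IL1_IL2 : Edge IL1 IL2
  | IL3_IL2 : Edge IL3 IL2
  | IL3_IN2 : Edge IL3 IN2
  | IR2_IM2 : Edge IR2 IM2
  | IR1_IS0k : Edge IR1 (IS0k 0)
  | IS0k_succ (r : ℕ) : Edge (IS0k r) (IS0k (r + 1))
  | IS0k_IS0 (r : ℕ) : Edge (IS0k r) IS0
  | IR0_IS1k : Edge IR0 (IS1k 0)
  | IS1k_succ (r : ℕ) : Edge (IS1k r) (IS1k (r + 1))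
  | IS1k_IS1 (r : ℕ) : Edge (IS1k r) IS1
  | IR2_IS02k : Edge IR2 (IS02k 0)
  | IS02k_succ (r : ℕ) : Edge (IS02k r) (IS02k (r + 1))
  | IS02k_IS02 (r : ℕ) : Edge (IS02k r) IS02
  | IR2_IS12k : Edge IR2 (IS12k 0)
  | IS12k_succ (r : ℕ) : Edge (IS12k r) (IS12k (r + 1))
  | IS12k_IS12 (r : ℕ) : Edge (IS12k r) IS12
  | IS0k_IS02k (r : ℕ) : Edge (IS0k r) (IS02k r)
  | IS0_IS02 : Edge IS0 IS02
  | IS1k_IS12k (r : ℕ) : Edge (IS1k r) (IS12k r)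
  | IS1_IS12 : Edge IS1 IS12
  | IM2_II2 : Edge IM2 II2
  | IS02_II2 : Edge IS02 II2
  | IS12_II2 : Edge IS12 II2
  | IL2_II2 : Edge IL2 II2
  | IN2_II2 : Edge IN2 II2

/-- The order of the lattice. -/
def Below (ν μ : PostNode) : Prop := Relation.ReflTransGen Edge ν μ

/-- The members of the four infinite chains and their limits. -/
def InChain : PostNode → Prop
  | IS0k _ | IS0 | IS1k _ | IS1 | IS02k _ | IS02 | IS12k _ | IS12 => True
  | _ => False

/-- The nodes whose relations all contain one and the same constant tuple, so that the empty
relation is not generated. -/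
def ConstValid : PostNode → Prop
  | IBF | IR0 | IR1 | IS0k _ | IS0 | IS1k _ | IS1 | IL | IL0 | IL1 => True
  | _ => False

end PostNode

/-!
Every listed class is the class `PostNode.sem ν` of all relations preserved by a few operations
(`PostNode.ops`), which makes it a co-clone. That it is also closed under max-implementation has a
different reason in each part of the list.

* For affine relations all nonempty fibres of a projection have the same size, so that
  max-implementation of a nonempty relation is existential quantification
  (`maxImpl_eq_exist_of_pres_xor3`), and a set of affine relations is a max-co-clone if and only if
  it is a co-clone (`isMaxCoclone_iff_isCoclone_of_affine`).
* For relations preserved by `x ∨ (y ∧ ¬ z)`, which are the relations of the chains over `OR`, the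
  tuples with the maximal number of extensions all have the same extensions, up to the variables
  tied to one of the free variables (`exists_top_maxImpl`). The chains over `NAND` are dual.
* For relations closed under conjunction and disjunction it is the inequality of Daykin
  (`pres_maxImpl_of_lattice`).
* The class `IN2` consists of the relations closed under complementation, and `II2` of all
  relations.

To compare classes, a few relations serve as probes: the constants, `NEQ`, `IMP`, the equation
`x₁ ⊕ x₂ ⊕ x₃ ⊕ x₄ = 0`, `Compl_{3,0}` and the relations `OR` and `NAND`. A listed class contains
exactly the probes of the table `PostNode.probes`, and a max-co-clone which contains these probes
contains the class (`PostNode.sem_subset_of_probes`). This rests on normal forms: affine relations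
are conjunctions of equations obtained by projection (`mem_of_affine`), relations preserved by
`x ∨ (y ∧ ¬ z)` are conjunctions of equalities, constants and positive clauses (`mem_of_pres_orDiff`),
and lattices of tuples are defined by implications (`has_of_lattice`). The generating sets and the
order of the list can then be read off from the probes.

That the list is complete (`PostNode.exists_node`) follows from an analysis of the binary and
ternary relations which arise from a relation by identifying variables and by substituting those
constants which are available (`IsMaxCoclone.has_section`). If `IMP`, binary `OR` or binary `NAND`
is present together with `NEQ`, or two of these three are, the class consists of all relations
(`eq_univ_of_IMP_of_NAND` and its consequences): each tuple of a relation can be given one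
extension more than the other tuples. If none of the three is present, but both constants are, all
relations are affine (`pres_xor3_of_const`); if just one of them is, the relations are preserved by
`x ∨ y` and `x ∧ y`, by `x ∨ (y ∧ ¬ z)`, or by the dual of the latter. If only the constant one is
available (the case of the constant zero is dual), every nonempty relation contains the tuple of
ones, and comparing the number of extensions with that of the tuple of ones leads to the same two
cases, affine relations (`pres_xor3_of_const_true`) and relations preserved by `x ∨ (y ∧ ¬ z)`
(`pres_orDiff_of_const_true`). If no constant is available, setting a coordinate to one still
yields a max-co-clone (`IsMaxCoclone.topSlice`), which has the constant one, and the previous cases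
apply to it: either all relations are affine, which without `NEQ` is the only possibility
(`pres_xor3_of_no_const`), or the class is `IN2` (`mem_of_pres_neg`).
-/

namespace BoolRel

/-! ### Membership and closure under manipulation and conjunction -/

/-- The set of tuples `R`, regarded as a relation of positive arity, belongs to `Γ`. -/
def Has (Γ : Set BoolRel) {n : ℕ} (R : Set (Fin n → Bool)) : Prop :=
  ∃ h : 0 < n, (⟨n, h, R⟩ : BoolRel) ∈ Γ

/-- The closure properties shared by co-clones and max-co-clones. -/
structure IsConjClosed (Γ : Set BoolRel) : Prop where
  eq : EQ ∈ Γ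
  manip : ∀ (n m : ℕ) (hn : 0 < n) (hm : 0 < m) (R : Set (Fin n → Bool)) (π : Fin n → Fin m),
    (⟨n, hn, R⟩ : BoolRel) ∈ Γ → (⟨m, hm, BoolRel.manip R π⟩ : BoolRel) ∈ Γ
  conj : ∀ (n : ℕ) (hn : 0 < n) (R S : Set (Fin n → Bool)),
    (⟨n, hn, R⟩ : BoolRel) ∈ Γ → (⟨n, hn, S⟩ : BoolRel) ∈ Γ → (⟨n, hn, R ∩ S⟩ : BoolRel) ∈ Γ

theorem _root_.IsCoclone.isConjClosed {Γ : Set BoolRel} (h : IsCoclone Γ) : IsConjClosed Γ :=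
  ⟨h.eq, h.manip, h.conj⟩

theorem _root_.IsMaxCoclone.isConjClosed {Γ : Set BoolRel} (h : IsMaxCoclone Γ) :
    IsConjClosed Γ :=
  ⟨h.eq, h.manip, h.conj⟩

theorem has_iff {Γ : Set BoolRel} {n : ℕ} (hn : 0 < n) {R : Set (Fin n → Bool)} :
    Has Γ R ↔ (⟨n, hn, R⟩ : BoolRel) ∈ Γ :=
  ⟨fun ⟨_, h⟩ => h, fun h => ⟨hn, h⟩⟩

theorem has_tuples {Γ : Set BoolRel} {R : BoolRel} : Has Γ R.tuples ↔ R ∈ Γ :=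
  has_iff R.pos

theorem Has.mono {Γ Δ : Set BoolRel} (h : Γ ⊆ Δ) {n : ℕ} {R : Set (Fin n → Bool)}
    (hR : Has Γ R) : Has Δ R := ⟨hR.1, h hR.2⟩

namespace IsConjClosed

theorem has_manip {Γ : Set BoolRel} (hΓ : IsConjClosed Γ) {n m : ℕ} {R : Set (Fin n → Bool)}
    (hR : Has Γ R) (π : Fin n → Fin m) : Has Γ {a : Fin m → Bool | (fun i => a (π i)) ∈ R} := by
  obtain ⟨hn, hR⟩ := hR
  have hm : 0 < m := Nat.zero_lt_of_lt (π ⟨0, hn⟩).2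
  exact ⟨hm, hΓ.manip n m hn hm R π hR⟩

theorem has_inter {Γ : Set BoolRel} (hΓ : IsConjClosed Γ) {n : ℕ} {R S : Set (Fin n → Bool)}
    (hR : Has Γ R) (hS : Has Γ S) : Has Γ (R ∩ S) :=
  ⟨hR.1, hΓ.conj n hR.1 R S hR.2 hS.2⟩

theorem has_eq {Γ : Set BoolRel} (hΓ : IsConjClosed Γ) {n : ℕ} (i j : Fin n) :
    Has Γ {a : Fin n → Bool | a i = a j} := by
  have h : Has Γ {a : Fin 2 → Bool | a 0 = a 1} := ⟨_, hΓ.eq⟩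
  simpa using hΓ.has_manip h ![i, j]

theorem has_univ {Γ : Set BoolRel} (hΓ : IsConjClosed Γ) {n : ℕ} (hn : 0 < n) :
    Has Γ (Set.univ : Set (Fin n → Bool)) := by
  simpa using hΓ.has_eq (⟨0, hn⟩ : Fin n) ⟨0, hn⟩

theorem has_coord {Γ : Set BoolRel} (hΓ : IsConjClosed Γ) {c : Bool} (hc : const c ∈ Γ) {n : ℕ}
    (i : Fin n) : Has Γ {a : Fin n → Bool | a i = c} := by
  have h : Has Γ {a : Fin 1 → Bool | a 0 = c} := ⟨_, hc⟩
  simpa using hΓ.has_manip h ![i]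

theorem has_forall {Γ : Set BoolRel} (hΓ : IsConjClosed Γ) {n : ℕ} (hn : 0 < n) {ι : Type*}
    [Finite ι] {T : ι → Set (Fin n → Bool)} (hT : ∀ i, Has Γ (T i)) :
    Has Γ {a : Fin n → Bool | ∀ i, a ∈ T i} := by
  classical
  have := Fintype.ofFinite ι
  have key : ∀ s : Finset ι, Has Γ {a : Fin n → Bool | ∀ i ∈ s, a ∈ T i} := by
    intro s
    induction s using Finset.induction_on with
    | empty => simpa using hΓ.has_univ hn
    | insert i s _ ih =>
      convert hΓ.has_inter (hT i) ih using 1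
      ext a
      simp
  simpa using key Finset.univ

theorem has_and {Γ : Set BoolRel} (hΓ : IsConjClosed Γ) {n : ℕ} {p q : (Fin n → Bool) → Prop}
    (hp : Has Γ {a | p a}) (hq : Has Γ {a | q a}) : Has Γ {a | p a ∧ q a} :=
  hΓ.has_inter hp hq

/-- A relation belongs to a conjunction-closed class as soon as each tuple outside of it is
excluded by some constraint of the class which is valid on the relation. -/
theorem has_of_separated {Γ : Set BoolRel} (hΓ : IsConjClosed Γ) {n : ℕ} (hn : 0 < n)
    {R : Set (Fin n → Bool)} (h : ∀ d ∉ R, ∃ T, Has Γ T ∧ R ⊆ T ∧ d ∉ T) : Has Γ R := by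
  choose T hT hRT hdT using fun d : {d // d ∉ R} => h d.1 d.2
  convert hΓ.has_forall hn hT using 1
  ext a
  constructor
  · exact fun ha d => hRT d ha
  · intro ha
    by_contra hc
    exact hdT ⟨a, hc⟩ (ha ⟨a, hc⟩)

theorem has_empty {Γ : Set BoolRel} (hΓ : IsConjClosed Γ) {n m : ℕ}
    (h : Has Γ (∅ : Set (Fin n → Bool))) (hm : 0 < m) : Has Γ (∅ : Set (Fin m → Bool)) := by
  simpa using hΓ.has_manip h (fun _ => (⟨0, hm⟩ : Fin m))

theorem has_empty_of_const {Γ : Set BoolRel} (hΓ : IsConjClosed Γ) (h0 : const false ∈ Γ)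
    (h1 : const true ∈ Γ) {m : ℕ} (hm : 0 < m) : Has Γ (∅ : Set (Fin m → Bool)) := by
  convert hΓ.has_inter (hΓ.has_coord h0 (⟨0, hm⟩ : Fin m)) (hΓ.has_coord h1 ⟨0, hm⟩) using 1
  ext a
  simp only [Set.mem_empty_iff_false, Set.mem_inter_iff, Set.mem_ofPred_eq, false_iff]
  rintro ⟨h, h'⟩
  simp [h] at h'

theorem has_empty_of_neq {Γ : Set BoolRel} (hΓ : IsConjClosed Γ) (h0 : NEQ ∈ Γ)
    {m : ℕ} (hm : 0 < m) : Has Γ (∅ : Set (Fin m → Bool)) := by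
  have h : Has Γ {a : Fin 2 → Bool | a 0 ≠ a 1} := ⟨_, h0⟩
  simpa using hΓ.has_manip h ![(⟨0, hm⟩ : Fin m), ⟨0, hm⟩]

end IsConjClosed

/-! ### Max-implementation and projection -/

theorem maxImpl_eq_of_numExt {n m : ℕ} {T : Set (Fin (n + m) → Bool)} {S : Set (Fin n → Bool)}
    {N : ℕ} (hS : S.Nonempty) (h : ∀ x ∈ S, numExt T x = N) (h' : ∀ x ∉ S, numExt T x < N) :
    maxImpl T = S := by
  ext x
  constructor
  · intro hx
    by_contra hc
    obtain ⟨s, hs⟩ := hS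
    have := hx s
    rw [h s hs] at this
    exact absurd (h' x hc) (by omega)
  · intro hx c
    rw [h x hx]
    by_cases hc : c ∈ S
    · exact (h c hc).le
    · exact (h' c hc).le

theorem maxImpl_nonempty {n m : ℕ} (T : Set (Fin (n + m) → Bool)) : (maxImpl T).Nonempty := by
  obtain ⟨a, ha⟩ := Finite.exists_max (numExt T)
  exact ⟨a, ha⟩

theorem maxImpl_empty {n m : ℕ} : maxImpl (∅ : Set (Fin (n + m) → Bool)) = Set.univ := by
  ext x
  simp [maxImpl, numExt]

theorem exists_numExt_pos {n m : ℕ} {T : Set (Fin (n + m) → Bool)} (hT : T.Nonempty)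
    {a : Fin n → Bool} (ha : a ∈ maxImpl T) : ∃ b, Fin.append a b ∈ T := by
  obtain ⟨t, ht⟩ := hT
  have h1 : 0 < numExt T (fun i => t (Fin.castAdd m i)) := by
    refine (Set.ncard_pos (Set.toFinite _)).2 ⟨fun j => t (Fin.natAdd n j), ?_⟩
    rw [Set.mem_ofPred_eq, Fin.append_castAdd_natAdd]
    exact ht
  have h2 := h1.trans_le (ha _)
  obtain ⟨b, hb⟩ := (Set.ncard_pos (Set.toFinite _)).1 h2
  exact ⟨b, hb⟩

theorem _root_.IsMaxCoclone.has_maxImpl {Γ : Set BoolRel} (hΓ : IsMaxCoclone Γ) {n m : ℕ}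
    (hn : 0 < n) {R : Set (Fin (n + m) → Bool)} (hR : Has Γ R) : Has Γ (BoolRel.maxImpl R) :=
  ⟨hn, hΓ.maxImpl n m hn hR.1 R hR.2⟩

theorem _root_.IsCoclone.has_exist {Γ : Set BoolRel} (hΓ : IsCoclone Γ) {n m : ℕ}
    (hn : 0 < n) {R : Set (Fin (n + m) → Bool)} (hR : Has Γ R) : Has Γ (BoolRel.exist R) :=
  ⟨hn, hΓ.exist n m hn hR.1 R hR.2⟩

/-- Substituting variables and available constants into a relation of a max-co-clone gives a
relation of the max-co-clone, unless the result is empty. -/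
theorem _root_.IsMaxCoclone.has_section {Γ : Set BoolRel} (hΓ : IsMaxCoclone Γ) {n m : ℕ}
    (hm : 0 < m) {R : Set (Fin n → Bool)} (hR : Has Γ R) (σ : Fin n → Fin m ⊕ Bool)
    (hσ : ∀ i c, σ i = Sum.inr c → const c ∈ Γ)
    (hS : {x : Fin m → Bool | (fun i => Sum.elim x id (σ i)) ∈ R}.Nonempty) :
    Has Γ {x : Fin m → Bool | (fun i => Sum.elim x id (σ i)) ∈ R} := by
  classical
  have hC := hΓ.isConjClosed
  set S := {x : Fin m → Bool | (fun i => Sum.elim x id (σ i)) ∈ R} with hSdef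
  -- one auxiliary variable for each constant
  let π : Fin n → Fin (m + 2) := fun i =>
    Sum.elim (Fin.castAdd 2) (fun c : Bool => Fin.natAdd m (if c then 1 else 0)) (σ i)
  let A : Set (Fin 2 → Bool) :=
    {b | (const false ∈ Γ → b 0 = false) ∧ (const true ∈ Γ → b 1 = true)}
  have hcoord : ∀ (c : Bool) (i : Fin (m + 2)),
      Has Γ {a : Fin (m + 2) → Bool | const c ∈ Γ → a i = c} := by
    intro c i
    by_cases h : const c ∈ Γ
    · simpa [h] using hC.has_coord h i
    · simpa [h] using hC.has_univ (n := m + 2) (by omega)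
  have hT := hC.has_inter (hC.has_manip hR π)
    (hC.has_inter (hcoord false (Fin.natAdd m 0)) (hcoord true (Fin.natAdd m 1)))
  have hA : A.Nonempty := ⟨![false, true], by simp [A]⟩
  convert hΓ.has_maxImpl hm hT using 1
  symm
  refine maxImpl_eq_of_numExt (N := A.ncard) hS ?_ ?_
  · intro x hx
    unfold numExt
    congr 1
    ext b
    simp only [Set.mem_inter_iff, Set.mem_ofPred_eq, Fin.append_right, A]
    constructor
    · exact fun h => h.2
    · refine fun h => ⟨?_, h⟩
      convert (show (fun i => Sum.elim x id (σ i)) ∈ R from hx) using 2 with i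
      rcases hi : σ i with j | c
      · simp [π, hi]
      · have := hσ i c hi
        cases c
        · simpa [π, hi] using h.1 this
        · simpa [π, hi] using h.2 this
  · intro x hx
    refine lt_of_eq_of_lt (b := 0) ?_ ((Set.ncard_pos (Set.toFinite _)).2 hA)
    unfold numExt
    · rw [Set.ncard_eq_zero (Set.toFinite _), Set.eq_empty_iff_forall_notMem]
      rintro b ⟨hb, hb'⟩
      refine hx ?_
      change (fun i => Sum.elim x id (σ i)) ∈ R
      replace hb : (fun i => Fin.append x b (π i)) ∈ R := hb
      convert hb using 2 with i
      rcases hi : σ i with j | c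
      · simp [π, hi]
      · have := hσ i c hi
        simp only [Set.mem_inter_iff, Set.mem_ofPred_eq, Fin.append_right] at hb'
        cases c
        · simpa [π, hi] using (hb'.1 this).symm
        · simpa [π, hi] using (hb'.2 this).symm

/-- A co-clone is closed under projections along arbitrary maps of coordinates. -/
theorem _root_.IsCoclone.has_proj {Γ : Set BoolRel} (hΓ : IsCoclone Γ) {n m : ℕ} (hm : 0 < m)
    {R : Set (Fin n → Bool)} (hR : Has Γ R) (ρ : Fin m → Fin n) :
    Has Γ {b : Fin m → Bool | ∃ a ∈ R, ∀ i, b i = a (ρ i)} := by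
  have hC := hΓ.isConjClosed
  have hT := hC.has_inter (hC.has_manip hR (Fin.natAdd m))
    (hC.has_forall (n := m + n) (by omega)
      (fun i : Fin m => hC.has_eq (Fin.castAdd n i) (Fin.natAdd m (ρ i))))
  convert hΓ.has_exist hm hT using 1
  ext b
  simp [exist]

/-! ### Adjoining the empty relations -/

theorem IsConjClosed.withEmpty {Γ : Set BoolRel} (hΓ : IsConjClosed Γ) :
    IsConjClosed (withEmpty Γ) where
  eq := Or.inl hΓ.eq
  manip n m hn hm R π h := by
    rcases h with h | h
    · exact Or.inl (hΓ.manip n m hn hm R π h)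
    · right
      replace h : R = ∅ := h
      simp [BoolRel.manip, h]
  conj n hn R S h h' := by
    rcases h with h | h
    · rcases h' with h' | h'
      · exact Or.inl (hΓ.conj n hn R S h h')
      · right
        replace h' : S = ∅ := h'
        simp [h']
    · right
      replace h : R = ∅ := h
      simp [h]

theorem _root_.IsMaxCoclone.withEmpty {Γ : Set BoolRel} (hΓ : IsMaxCoclone Γ) :
    IsMaxCoclone (withEmpty Γ) where
  eq := hΓ.isConjClosed.withEmpty.eq
  manip := hΓ.isConjClosed.withEmpty.manip
  conj := hΓ.isConjClosed.withEmpty.conj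
  maxImpl n m hn hnm R h := by
    rcases h with h | h
    · exact Or.inl (hΓ.maxImpl n m hn hnm R h)
    · left
      replace h : R = ∅ := h
      subst h
      rw [maxImpl_empty]
      exact (hΓ.isConjClosed.has_univ hn).2

theorem _root_.IsCoclone.withEmpty {Γ : Set BoolRel} (hΓ : IsCoclone Γ) :
    IsCoclone (withEmpty Γ) where
  eq := hΓ.isConjClosed.withEmpty.eq
  manip := hΓ.isConjClosed.withEmpty.manip
  conj := hΓ.isConjClosed.withEmpty.conj
  exist n m hn hnm R h := by
    rcases h with h | h
    · exact Or.inl (hΓ.exist n m hn hnm R h)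
    · right
      replace h : R = ∅ := h
      subst h
      simp [BoolRel.exist]

theorem withEmpty_eq_self {Γ : Set BoolRel} (hΓ : IsConjClosed Γ) {n : ℕ}
    (h : Has Γ (∅ : Set (Fin n → Bool))) : withEmpty Γ = Γ := by
  refine Set.union_eq_self_of_subset_right fun R hR => ?_
  have := hΓ.has_empty h R.pos
  rw [← show R.tuples = ∅ from hR] at this
  exact has_tuples.1 this

/-- Two conjunction-closed classes with the same nonempty relations differ at most in the empty
relations. -/
theorem eq_or_eq_withEmpty {Γ Δ : Set BoolRel} (hΓ : IsConjClosed Γ)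
    (h : ∀ R ∈ Γ, R.tuples.Nonempty → R ∈ Δ) (h' : Δ ⊆ Γ) : Γ = Δ ∨ Γ = withEmpty Δ := by
  by_cases he : ∃ R ∈ Γ, R.tuples = ∅
  · right
    obtain ⟨E, hE, hE'⟩ := he
    apply Set.Subset.antisymm
    · intro R hR
      rcases R.tuples.eq_empty_or_nonempty with h0 | h0
      · exact Or.inr h0
      · exact Or.inl (h R hR h0)
    · rintro R (hR | hR)
      · exact h' hR
      · have h1 : Has Γ E.tuples := has_tuples.2 hE
        rw [hE'] at h1
        have := hΓ.has_empty h1 R.pos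
        rw [← show R.tuples = ∅ from hR] at this
        exact has_tuples.1 this
  · left
    push Not at he
    exact Set.Subset.antisymm (fun R hR => h R hR (he R hR)) h'

/-! ### Generated classes -/

theorem isCoclone_cocloneGen (B : Set BoolRel) : IsCoclone (cocloneGen B) where
  eq := fun _ hΓ => hΓ.1.eq
  manip n m hn hm R π h := fun Γ hΓ => hΓ.1.manip n m hn hm R π (h Γ hΓ)
  conj n hn R S h h' := fun Γ hΓ => hΓ.1.conj n hn R S (h Γ hΓ) (h' Γ hΓ)
  exist n m hn hnm R h := fun Γ hΓ => hΓ.1.exist n m hn hnm R (h Γ hΓ)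

theorem isMaxCoclone_maxCocloneGen (B : Set BoolRel) : IsMaxCoclone (maxCocloneGen B) where
  eq := fun _ hΓ => hΓ.1.eq
  manip n m hn hm R π h := fun Γ hΓ => hΓ.1.manip n m hn hm R π (h Γ hΓ)
  conj n hn R S h h' := fun Γ hΓ => hΓ.1.conj n hn R S (h Γ hΓ) (h' Γ hΓ)
  maxImpl n m hn hnm R h := fun Γ hΓ => hΓ.1.maxImpl n m hn hnm R (h Γ hΓ)

theorem subset_cocloneGen (B : Set BoolRel) : B ⊆ cocloneGen B :=
  fun _ hR _ hΓ => hΓ.2 hR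

theorem subset_maxCocloneGen (B : Set BoolRel) : B ⊆ maxCocloneGen B :=
  fun _ hR _ hΓ => hΓ.2 hR

theorem cocloneGen_subset {B Γ : Set BoolRel} (hΓ : IsCoclone Γ) (h : B ⊆ Γ) :
    cocloneGen B ⊆ Γ := fun _ hR => hR Γ ⟨hΓ, h⟩

theorem maxCocloneGen_subset {B Γ : Set BoolRel} (hΓ : IsMaxCoclone Γ) (h : B ⊆ Γ) :
    maxCocloneGen B ⊆ Γ := fun _ hR => hR Γ ⟨hΓ, h⟩

/-! ### Duality -/

/-- The complement of every tuple. -/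
def dualSet {n : ℕ} (R : Set (Fin n → Bool)) : Set (Fin n → Bool) := {a | (fun i => !a i) ∈ R}

/-- The dual relation, obtained by exchanging the two constants. -/
def dual (R : BoolRel) : BoolRel := ⟨R.arity, R.pos, dualSet R.tuples⟩

/-- The class of all relations whose dual belongs to `Γ`. -/
def dualClass (Γ : Set BoolRel) : Set BoolRel := {R | dual R ∈ Γ}

@[simp] theorem dualSet_dualSet {n : ℕ} (R : Set (Fin n → Bool)) : dualSet (dualSet R) = R := by
  ext a
  simp [dualSet]

@[simp] theorem dual_dual (R : BoolRel) : dual (dual R) = R := by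
  cases R
  simp [dual]

@[simp] theorem dualClass_dualClass (Γ : Set BoolRel) : dualClass (dualClass Γ) = Γ := by
  ext R
  simp [dualClass]

theorem has_dualClass {Γ : Set BoolRel} {n : ℕ} {R : Set (Fin n → Bool)} :
    Has (dualClass Γ) R ↔ Has Γ (dualSet R) := Iff.rfl

theorem dualSet_maxImpl {n m : ℕ} (R : Set (Fin (n + m) → Bool)) :
    dualSet (maxImpl R) = maxImpl (dualSet R) := by
  have key : ∀ a : Fin n → Bool, numExt (dualSet R) a = numExt R (fun i => !a i) := by
    intro a
    unfold numExt
    have hinj : Function.Injective (fun (b : Fin m → Bool) => fun i => !b i) := by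
      intro b c h
      funext i
      simpa using congrFun h i
    rw [← Set.ncard_image_of_injective _ hinj]
    congr 1
    ext b
    simp only [Set.mem_image, Set.mem_ofPred_eq, dualSet]
    have h1 : ∀ c : Fin m → Bool, (fun i => !(Fin.append a c) i) =
        Fin.append (fun i => !a i) (fun i => !c i) := by
      intro c
      funext i
      refine Fin.addCases (fun j => ?_) (fun j => ?_) i <;> simp
    constructor
    · rintro ⟨c, hc, rfl⟩
      rwa [h1] at hc
    · intro hb
      refine ⟨fun i => !b i, ?_, by simp⟩
      rw [h1]
      simpa using hb
  ext a
  simp only [dualSet, maxImpl, Set.mem_ofPred_eq] at key ⊢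
  constructor
  · intro h c
    rw [key, key]
    exact h _
  · intro h c
    have := h (fun i => !c i)
    rw [key, key] at this
    simpa using this

theorem IsConjClosed.dualClass {Γ : Set BoolRel} (hΓ : IsConjClosed Γ) :
    IsConjClosed (dualClass Γ) where
  eq := by
    have : Has Γ (dualSet {a : Fin 2 → Bool | a 0 = a 1}) := by
      simpa [dualSet] using hΓ.has_eq (0 : Fin 2) 1
    exact this.2
  manip n m hn hm R π h := hΓ.manip n m hn hm (dualSet R) π h
  conj n hn R S h h' := hΓ.conj n hn (dualSet R) (dualSet S) h h'

theorem _root_.IsMaxCoclone.dualClass {Γ : Set BoolRel} (hΓ : IsMaxCoclone Γ) :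
    IsMaxCoclone (dualClass Γ) where
  eq := hΓ.isConjClosed.dualClass.eq
  manip := hΓ.isConjClosed.dualClass.manip
  conj := hΓ.isConjClosed.dualClass.conj
  maxImpl n m hn hnm R h := by
    have := hΓ.maxImpl n m hn hnm (dualSet R) h
    rw [← dualSet_maxImpl] at this
    exact this

theorem const_mem_dualClass {Γ : Set BoolRel} {c : Bool} :
    const c ∈ dualClass Γ ↔ const (!c) ∈ Γ := by
  have : dualSet {a : Fin 1 → Bool | a 0 = c} = {a | a 0 = !c} := by
    ext a
    cases c <;> simp [dualSet]
  change (⟨1, _, dualSet {a : Fin 1 → Bool | a 0 = c}⟩ : BoolRel) ∈ Γ ↔ _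
  rw [this]
  rfl

theorem NEQ_mem_dualClass {Γ : Set BoolRel} : NEQ ∈ dualClass Γ ↔ NEQ ∈ Γ := by
  have : dualSet {a : Fin 2 → Bool | a 0 ≠ a 1} = {a | a 0 ≠ a 1} := by
    ext a
    simp [dualSet]
  change (⟨2, _, dualSet {a : Fin 2 → Bool | a 0 ≠ a 1}⟩ : BoolRel) ∈ Γ ↔ _
  rw [this]
  rfl

theorem dual_OR (k : ℕ) (hk : 0 < k) : dual (OR k hk) = NAND k hk := by
  have : dualSet {a : Fin k → Bool | a ≠ fun _ => false} = {a | a ≠ fun _ => true} := by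
    ext a
    simp [dualSet, funext_iff]
  change (⟨k, _, dualSet {a : Fin k → Bool | a ≠ fun _ => false}⟩ : BoolRel) = _
  rw [this]
  rfl

theorem dual_NAND (k : ℕ) (hk : 0 < k) : dual (NAND k hk) = OR k hk := by
  rw [← dual_OR, dual_dual]

theorem dualClass_withEmpty (Γ : Set BoolRel) :
    dualClass (withEmpty Γ) = withEmpty (dualClass Γ) := by
  ext R
  have : dualSet R.tuples = ∅ ↔ R.tuples = ∅ := by
    constructor
    · intro h
      rw [← dualSet_dualSet R.tuples, h]
      simp [dualSet]
    · intro h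
      simp [h, dualSet]
  simp [dualClass, withEmpty, dual, this]

end BoolRel

namespace BoolRel

/-! ### Invariant relations of Boolean operations -/

/-- An operation on `{0,1}` of arbitrary finite arity; the constants are nullary operations. -/
structure Op where
  ar : ℕ
  fn : (Fin ar → Bool) → Bool

/-- The set of tuples `R` is preserved by the operation `f`, applied coordinatewise. -/
def Pres (f : Op) {n : ℕ} (R : Set (Fin n → Bool)) : Prop :=
  ∀ t : Fin f.ar → Fin n → Bool, (∀ i, t i ∈ R) → (fun j => f.fn fun i => t i j) ∈ R

/-- The relations preserved by all operations of `F`. -/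
def Inv (F : Set Op) : Set BoolRel := {R | ∀ f ∈ F, Pres f R.tuples}

theorem has_Inv {F : Set Op} {n : ℕ} (hn : 0 < n) {R : Set (Fin n → Bool)} :
    Has (Inv F) R ↔ ∀ f ∈ F, Pres f R := has_iff hn

theorem Pres.manip {f : Op} {n m : ℕ} {R : Set (Fin n → Bool)} (h : Pres f R) (π : Fin n → Fin m) :
    Pres f (BoolRel.manip R π) := fun t ht => h (fun i j => t i (π j)) ht

theorem Pres.inter {f : Op} {n : ℕ} {R S : Set (Fin n → Bool)} (h : Pres f R) (h' : Pres f S) :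
    Pres f (R ∩ S) := fun t ht => ⟨h t fun i => (ht i).1, h' t fun i => (ht i).2⟩

theorem Pres.exist {f : Op} {n m : ℕ} {R : Set (Fin (n + m) → Bool)} (h : Pres f R) :
    Pres f (BoolRel.exist R) := by
  intro t ht
  choose b hb using ht
  refine ⟨fun j => f.fn fun i => b i j, ?_⟩
  convert h _ hb using 1
  funext j
  refine Fin.addCases (fun j => ?_) (fun j => ?_) j <;> simp

theorem isCoclone_Inv (F : Set Op) : IsCoclone (Inv F) where
  eq f _ _ ht := congrArg f.fn (funext fun i => ht i)
  manip _ _ _ _ _ π h f hf := (h f hf).manip π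
  conj _ _ _ _ h h' f hf := (h f hf).inter (h' f hf)
  exist _ _ _ _ _ h f hf := (h f hf).exist

/-- The dual operation. -/
def Op.dual (f : Op) : Op := ⟨f.ar, fun x => !f.fn fun i => !x i⟩

theorem pres_dual {f : Op} {n : ℕ} {R : Set (Fin n → Bool)} :
    Pres f.dual R ↔ Pres f (dualSet R) := by
  constructor
  · intro h t ht
    have := h (fun i j => !t i j) ht
    simpa [Op.dual, dualSet] using this
  · intro h t ht
    have := h (fun i j => !t i j) (fun i => by simpa [dualSet] using ht i)
    simpa [Op.dual, dualSet] using this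

theorem Inv_image_dual (F : Set Op) : Inv (Op.dual '' F) = dualClass (Inv F) := by
  ext R
  simp only [Inv, Set.mem_ofPred_eq, Set.forall_mem_image, dualClass, pres_dual, dual]

/-! ### The operations describing the co-clones of the list -/

/-- `x ⊕ y ⊕ z`. -/
def xor3 : Op := ⟨3, fun x => x 0 ^^ (x 1 ^^ x 2)⟩

/-- The majority operation. -/
def maj : Op := ⟨3, fun x => x 0 && x 1 || x 0 && x 2 || x 1 && x 2⟩

/-- Conjunction. -/
def and2 : Op := ⟨2, fun x => x 0 && x 1⟩

/-- Disjunction. -/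
def or2 : Op := ⟨2, fun x => x 0 || x 1⟩

/-- Negation. -/
def neg : Op := ⟨1, fun x => !x 0⟩

/-- The constants. -/
def cst (c : Bool) : Op := ⟨0, fun _ => c⟩

/-- `x ∨ (y ∧ ¬ z)`. -/
def orDiff : Op := ⟨3, fun x => x 0 || (x 1 && !x 2)⟩

/-- The threshold operation "at least two ones" in `k + 1` arguments. -/
def twoOf (k : ℕ) : Op := ⟨k + 1, fun x => decide (∃ i j, i ≠ j ∧ x i = true ∧ x j = true)⟩

theorem pres_three {f : Bool → Bool → Bool → Bool} {n : ℕ} {R : Set (Fin n → Bool)} :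
    Pres ⟨3, fun x => f (x 0) (x 1) (x 2)⟩ R ↔
      ∀ a ∈ R, ∀ b ∈ R, ∀ c ∈ R, (fun j => f (a j) (b j) (c j)) ∈ R := by
  constructor
  · intro h a ha b hb c hc
    exact h ![a, b, c] (by intro i; fin_cases i <;> assumption)
  · intro h t ht
    exact h _ (ht 0) _ (ht 1) _ (ht 2)

theorem pres_two {f : Bool → Bool → Bool} {n : ℕ} {R : Set (Fin n → Bool)} :
    Pres ⟨2, fun x => f (x 0) (x 1)⟩ R ↔
      ∀ a ∈ R, ∀ b ∈ R, (fun j => f (a j) (b j)) ∈ R := by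
  constructor
  · intro h a ha b hb
    exact h ![a, b] (by intro i; fin_cases i <;> assumption)
  · intro h t ht
    exact h _ (ht 0) _ (ht 1)

theorem pres_xor3 {n : ℕ} {R : Set (Fin n → Bool)} :
    Pres xor3 R ↔ ∀ a ∈ R, ∀ b ∈ R, ∀ c ∈ R, (fun j => a j ^^ (b j ^^ c j)) ∈ R :=
  pres_three (f := fun x y z => x ^^ (y ^^ z))

theorem pres_maj {n : ℕ} {R : Set (Fin n → Bool)} :
    Pres maj R ↔ ∀ a ∈ R, ∀ b ∈ R, ∀ c ∈ R,
      (fun j => a j && b j || a j && c j || b j && c j) ∈ R :=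
  pres_three (f := fun x y z => x && y || x && z || y && z)

theorem pres_orDiff {n : ℕ} {R : Set (Fin n → Bool)} :
    Pres orDiff R ↔ ∀ a ∈ R, ∀ b ∈ R, ∀ c ∈ R, (fun j => a j || (b j && !c j)) ∈ R :=
  pres_three (f := fun x y z => x || (y && !z))

theorem pres_and2 {n : ℕ} {R : Set (Fin n → Bool)} :
    Pres and2 R ↔ ∀ a ∈ R, ∀ b ∈ R, (fun j => a j && b j) ∈ R :=
  pres_two (f := fun x y => x && y)

theorem pres_or2 {n : ℕ} {R : Set (Fin n → Bool)} :
    Pres or2 R ↔ ∀ a ∈ R, ∀ b ∈ R, (fun j => a j || b j) ∈ R :=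
  pres_two (f := fun x y => x || y)

theorem pres_neg {n : ℕ} {R : Set (Fin n → Bool)} :
    Pres neg R ↔ ∀ a ∈ R, (fun j => !a j) ∈ R := by
  constructor
  · intro h a ha
    exact h (fun _ => a) (fun _ => ha)
  · intro h t ht
    exact h _ (ht (0 : Fin 1))

theorem pres_cst {c : Bool} {n : ℕ} {R : Set (Fin n → Bool)} :
    Pres (cst c) R ↔ (fun _ => c) ∈ R := by
  constructor
  · intro h
    exact h Fin.elim0 (fun i => i.elim0)
  · intro h t _
    exact h

/-! ### Operations preserving particular relations -/

theorem pres_const_iff {f : Op} {c : Bool} : Pres f (const c).tuples ↔ f.fn (fun _ => c) = c := by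
  change Pres f {a : Fin 1 → Bool | a 0 = c} ↔ _
  constructor
  · intro h
    exact h (fun _ _ => c) (fun _ => rfl)
  · intro h t ht
    change f.fn (fun i => t i 0) = c
    rw [show (fun i => t i 0) = fun _ => c from funext ht, h]

theorem pres_NEQ_iff {f : Op} : Pres f NEQ.tuples ↔ ∀ x, f.fn (fun i => !x i) = !f.fn x := by
  change Pres f {a : Fin 2 → Bool | a 0 ≠ a 1} ↔ _
  constructor
  · intro h x
    have : f.fn (fun i => !x i) ≠ f.fn x :=
      h (fun i => ![!x i, x i]) (fun i => by change (!x i) ≠ x i; simp)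
    simpa [Bool.eq_not] using this
  · intro h t ht
    change f.fn (fun i => t i 0) ≠ f.fn (fun i => t i 1)
    have : (fun i => t i 0) = fun i => !t i 1 := funext fun i => Bool.eq_not.2 (ht i)
    rw [this, h]
    simp

theorem toGF_xor (a b : Bool) : toGF (a ^^ b) = toGF a + toGF b := by
  revert a b
  decide

theorem toGF_not (a : Bool) : toGF (!a) = toGF a + 1 := by
  revert a
  decide

theorem toGF_injective : Function.Injective toGF := by decide

theorem GF_add_self (x : ZMod 2) : x + x = 0 := by
  revert x
  decide

theorem pres_xor3_XOR {k : ℕ} {hk : 0 < k} {c : ZMod 2} : Pres xor3 (XOR k hk c).tuples := by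
  rw [pres_xor3]
  intro a ha b hb d hd
  replace ha : ∑ i, toGF (a i) = c := ha
  replace hb : ∑ i, toGF (b i) = c := hb
  replace hd : ∑ i, toGF (d i) = c := hd
  change ∑ i, toGF (a i ^^ (b i ^^ d i)) = c
  simp only [toGF_xor, Finset.sum_add_distrib, ha, hb, hd, GF_add_self, add_zero]

theorem pres_neg_XOR_iff {k : ℕ} {hk : 0 < k} {c : ZMod 2} :
    Pres neg (XOR k hk c).tuples ↔ Even k := by
  have key : ∀ a : Fin k → Bool, ∑ i, toGF (!a i) = ∑ i, toGF (a i) + k := by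
    intro a
    simp [toGF_not, Finset.sum_add_distrib]
  rw [pres_neg, ← ZMod.natCast_eq_zero_iff_even]
  constructor
  · intro h
    have hex : (fun j : Fin k => if (j : ℕ) = 0 then decide (c = 1) else false) ∈
        (XOR k hk c).tuples := by
      change ∑ j : Fin k, toGF (if (j : ℕ) = 0 then decide (c = 1) else false) = c
      rw [Finset.sum_eq_single (⟨0, hk⟩ : Fin k)]
      · rw [if_pos rfl]
        clear h
        revert c
        decide
      · intro j _ hj
        have : (j : ℕ) ≠ 0 := fun h => hj (Fin.ext h)
        simp [this, toGF]
      · simp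
    have h2 : ∑ j : Fin k, toGF (!_) = c := h _ hex
    rw [key] at h2
    have h3 : ∑ j : Fin k, toGF _ = c := hex
    rw [h3] at h2
    simpa using h2
  · intro h (a : Fin k → Bool) ha
    replace ha : ∑ i : Fin k, toGF (a i) = c := ha
    change ∑ i : Fin k, toGF (!a i) = c
    rw [key, ha, h, add_zero]

theorem pres_zero_XOR_iff {k : ℕ} {hk : 0 < k} {c : ZMod 2} :
    Pres (cst false) (XOR k hk c).tuples ↔ c = 0 := by
  rw [pres_cst]
  change ∑ i : Fin k, toGF false = c ↔ _
  simp [toGF, eq_comm]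

theorem pres_one_XOR_iff {k : ℕ} {hk : 0 < k} {c : ZMod 2} :
    Pres (cst true) (XOR k hk c).tuples ↔ (k : ZMod 2) = c := by
  rw [pres_cst]
  change ∑ i : Fin k, toGF true = c ↔ _
  simp [toGF]

theorem pres_orDiff_OR {k : ℕ} {hk : 0 < k} : Pres orDiff (OR k hk).tuples := by
  rw [pres_orDiff]
  intro a ha b _ c _ h
  refine ha (funext fun i => ?_)
  have := congrFun h i
  simp only [Bool.or_eq_false_iff] at this
  exact this.1

theorem pres_one_OR {k : ℕ} {hk : 0 < k} : Pres (cst true) (OR k hk).tuples := by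
  rw [pres_cst]
  intro h
  simpa using congrFun h ⟨0, hk⟩

/-- Among `k + 1` nonzero tuples of length at most `k`, two have a one in the same place. -/
theorem pres_twoOf_OR {k l : ℕ} {hl : 0 < l} (h : l ≤ k) : Pres (twoOf k) (OR l hl).tuples := by
  intro t ht h0
  have : ∀ i, ∃ j, t i j = true := by
    intro i
    by_contra hc
    push Not at hc
    exact ht i (funext fun j => by simpa using hc j)
  choose p hp using this
  change Fin (k + 1) → Fin l at p
  obtain ⟨x, y, hxy, he⟩ := Fintype.exists_ne_map_eq_of_card_lt p (by simpa using by omega)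
  have := congrFun h0 (p x)
  simp only [twoOf, decide_eq_false_iff_not] at this
  exact this ⟨x, y, hxy, hp x, by rw [he]; exact hp y⟩

theorem not_pres_twoOf_OR {k l : ℕ} {hl : 0 < l} (h : k < l) :
    ¬ Pres (twoOf k) (OR l hl).tuples := by
  intro hc
  -- the tuples are the indicators of a partition of the coordinates into `k + 1` blocks
  let t : Fin (k + 1) → Fin l → Bool := fun i j => decide (min (j : ℕ) k = (i : ℕ))
  refine hc t (fun i h0 => ?_) (funext fun j => ?_)
  · have := congrFun h0 (⟨i, by have : (i : ℕ) < k + 1 := i.2; omega⟩ : Fin l)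
    have hi : (i : ℕ) < k + 1 := i.2
    simp only [t, decide_eq_false_iff_not] at this
    omega
  · simp only [twoOf, decide_eq_false_iff_not, t, decide_eq_true_eq]
    rintro ⟨x, y, hxy, h1, h2⟩
    exact hxy (Fin.ext (h1.symm.trans h2))

theorem IsConjClosed.has_OR_of_le {Γ : Set BoolRel} (hΓ : IsConjClosed Γ) {k l : ℕ} {hk : 0 < k}
    {hl : 0 < l} (h : OR k hk ∈ Γ) (hlk : l ≤ k) : OR l hl ∈ Γ := by
  have h' : Has Γ {a : Fin k → Bool | a ≠ fun _ => false} := ⟨hk, h⟩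
  let π : Fin k → Fin l := fun i => ⟨min i (l - 1), by omega⟩
  have := hΓ.has_manip h' π
  refine (?_ : Has Γ {a : Fin l → Bool | a ≠ fun _ => false}).2
  convert this using 1
  refine Set.ext fun (a : Fin l → Bool) => ?_
  change (a ≠ fun _ => false) ↔ (fun i => a (π i)) ≠ fun _ => false
  refine not_congr ⟨fun h => by subst h; rfl, fun h => funext fun j => ?_⟩
  have h2 := congrFun h ⟨j, by omega⟩
  have h3 : π ⟨j, by omega⟩ = j := Fin.ext (by simp [π]; omega)
  simpa only [h3] using h2

end BoolRel

namespace BoolRel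

/-! ### Affine relations -/

/-- A tuple outside of an affine relation violates a linear equation valid on the relation. -/
theorem exists_equation {n : ℕ} {R : Set (Fin n → Bool)} (hR : Pres xor3 R) (hne : R.Nonempty)
    {d : Fin n → Bool} (hd : d ∉ R) : ∃ (J : Finset (Fin n)) (c : ZMod 2),
      (∀ a ∈ R, ∑ j ∈ J, toGF (a j) = c) ∧ ∑ j ∈ J, toGF (d j) ≠ c := by
  obtain ⟨o, ho⟩ := hne
  rw [pres_xor3] at hR
  let V : Submodule (ZMod 2) (Fin n → ZMod 2) :=
    { carrier := {v | ∃ a ∈ R, v = fun i => toGF (a i ^^ o i)}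
      add_mem' := by
        rintro _ _ ⟨a, ha, rfl⟩ ⟨b, hb, rfl⟩
        refine ⟨_, hR a ha b hb o ho, ?_⟩
        funext i
        simp only [Pi.add_apply, ← toGF_xor]
        congr 1
        cases a i <;> cases b i <;> cases o i <;> rfl
      zero_mem' := ⟨o, ho, by funext i; simp [toGF]⟩
      smul_mem' := by
        rintro c _ ⟨a, ha, rfl⟩
        have hc : c = 0 ∨ c = 1 := by
          revert c
          decide
        rcases hc with rfl | rfl
        · exact ⟨o, ho, by funext i; simp [toGF]⟩
        · exact ⟨a, ha, by funext i; simp⟩ }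
  have hV : (fun i => toGF (d i ^^ o i)) ∉ V := by
    rintro ⟨a, ha, h⟩
    apply hd
    convert ha
    funext i
    have := toGF_injective (congrFun h i)
    revert this
    cases a i <;> cases d i <;> cases o i <;> simp
  obtain ⟨f, hf, hker⟩ := Submodule.exists_le_ker_of_notMem hV
  have hf_apply : ∀ v, f v = ∑ j with f (Pi.single j 1) = 1, v j := by
    intro v
    rw [Finset.sum_filter, LinearMap.pi_apply_eq_sum_univ]
    refine Finset.sum_congr rfl fun i _ => ?_
    have : ∀ x y : ZMod 2, x • y = if y = 1 then x else 0 := by decide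
    rw [this]
    congr 3
    funext j
    simp [Pi.single_apply, eq_comm]
  refine ⟨Finset.univ.filter fun j => f (Pi.single j 1) = 1, f fun i => toGF (o i), ?_, ?_⟩
  · intro a ha
    have := hker (show (fun i => toGF (a i ^^ o i)) ∈ V from ⟨a, ha, rfl⟩)
    rw [LinearMap.mem_ker] at this
    rw [← hf_apply (fun i => toGF (a i))]
    have h2 : (fun i => toGF (a i ^^ o i)) = (fun i => toGF (a i)) + fun i => toGF (o i) := by
      funext i
      simp [toGF_xor]
    rw [h2, map_add] at this
    exact CharTwo.add_eq_zero.1 this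
  · intro h
    apply hf
    rw [← hf_apply (fun i => toGF (d i))] at h
    have h2 : (fun i => toGF (d i ^^ o i)) = (fun i => toGF (d i)) + fun i => toGF (o i) := by
      funext i
      simp [toGF_xor]
    rw [h2, map_add]
    exact CharTwo.add_eq_zero.2 h

theorem isAffine_iff {R : BoolRel} : R.IsAffine ↔ Pres xor3 R.tuples := by
  constructor
  · rintro ⟨l, A, c, h⟩
    rw [h, pres_xor3]
    intro a ha b hb d hd
    simp only [Set.mem_ofPred_eq, toGF_xor] at *
    have h2 : (fun i => toGF (a i) + (toGF (b i) + toGF (d i))) =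
      (fun i => toGF (a i)) + ((fun i => toGF (b i)) + fun i => toGF (d i)) := rfl
    rw [h2, Matrix.mulVec_add, Matrix.mulVec_add, ha, hb, hd]
    funext i
    simp [GF_add_self]
  · intro h
    rcases R.tuples.eq_empty_or_nonempty with h0 | h0
    · refine ⟨1, 0, fun _ => 1, ?_⟩
      rw [h0]
      ext a
      simp only [Set.mem_empty_iff_false, Matrix.zero_mulVec, Set.mem_ofPred_eq, false_iff]
      intro h
      simpa using congrFun h 0
    · choose J c hJ hd using fun d : {d // d ∉ R.tuples} => exists_equation h h0 d.2
      let e := Finite.equivFin {d // d ∉ R.tuples}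
      refine ⟨_, fun i j => if j ∈ J (e.symm i) then 1 else 0, fun i => c (e.symm i), ?_⟩
      have key : ∀ a : Fin R.arity → Bool, (Matrix.mulVec
          (fun i j => if j ∈ J (e.symm i) then (1 : ZMod 2) else 0) fun i => toGF (a i)) =
          fun i => ∑ j ∈ J (e.symm i), toGF (a j) := by
        intro a
        funext i
        simp [Matrix.mulVec, dotProduct]
      ext a
      rw [Set.mem_ofPred_eq, key]
      constructor
      · intro ha
        funext i
        exact hJ _ a ha
      · intro ha
        by_contra hc
        have := congrFun ha (e ⟨a, hc⟩)
        simp only [Equiv.symm_apply_apply] at this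
        exact hd ⟨a, hc⟩ this

theorem numExt_le_of_injOn {n m : ℕ} {R : Set (Fin (n + m) → Bool)} {a a' : Fin n → Bool}
    (f : (Fin m → Bool) → Fin m → Bool)
    (hf : ∀ b, Fin.append a b ∈ R → Fin.append a' (f b) ∈ R)
    (hinj : ∀ b, Fin.append a b ∈ R → ∀ b', Fin.append a b' ∈ R → f b = f b' → b = b') :
    numExt R a ≤ numExt R a' :=
  Set.ncard_le_ncard_of_injOn f hf (fun b hb b' hb' h => hinj b hb b' hb' h) (Set.toFinite _)

/-- All fibres of a projection of an affine relation have the same size. -/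
theorem maxImpl_eq_exist_of_pres_xor3 {n m : ℕ} {R : Set (Fin (n + m) → Bool)}
    (hR : Pres xor3 R) (hne : R.Nonempty) : maxImpl R = exist R := by
  rw [pres_xor3] at hR
  ext a
  constructor
  · exact fun ha => exists_numExt_pos hne ha
  · rintro ⟨b, hb⟩ c
    rcases Set.eq_empty_or_nonempty {y : Fin m → Bool | Fin.append c y ∈ R} with h | ⟨y, hy⟩
    · simp [numExt, h]
    · refine numExt_le_of_injOn (fun z j => z j ^^ (y j ^^ b j)) ?_ ?_
      · intro z hz
        convert hR _ hz _ hy _ hb using 1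
        funext j
        refine Fin.addCases (fun j => ?_) (fun j => ?_) j <;> simp
      · intro z _ z' _ h
        funext j
        simpa using congrFun h j

theorem isMaxCoclone_iff_isCoclone_of_affine {Γ : Set BoolRel}
    (hΓ : ∀ R ∈ Γ, Pres xor3 R.tuples) : IsMaxCoclone Γ ↔ IsCoclone Γ := by
  constructor
  · intro h
    refine ⟨h.eq, h.manip, h.conj, fun n m hn hnm R hR => ?_⟩
    rcases R.eq_empty_or_nonempty with rfl | hne
    · have : exist (∅ : Set (Fin (n + m) → Bool)) = ∅ := by simp [exist]
      rw [this]
      exact (h.isConjClosed.has_empty ⟨hnm, hR⟩ hn).2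
    · rw [← maxImpl_eq_exist_of_pres_xor3 (hΓ _ hR) hne]
      exact h.maxImpl n m hn hnm R hR
  · intro h
    refine ⟨h.eq, h.manip, h.conj, fun n m hn hnm R hR => ?_⟩
    rcases R.eq_empty_or_nonempty with rfl | hne
    · rw [maxImpl_empty]
      exact (h.isConjClosed.has_univ hn).2
    · rw [maxImpl_eq_exist_of_pres_xor3 (hΓ _ hR) hne]
      exact h.exist n m hn hnm R hR

/-! ### Linear equations in a co-clone -/

/-- The solutions of `x₁ ⊕ … ⊕ xₖ = c`. -/
def lin (k : ℕ) (c : ZMod 2) : Set (Fin k → Bool) := {a | ∑ i, toGF (a i) = c}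

theorem exists_toGF (x : ZMod 2) : ∃ b, toGF b = x := by
  revert x
  decide

/-- Eliminating a common variable of two equations. -/
theorem _root_.IsCoclone.has_lin_add {Γ : Set BoolRel} (hΓ : IsCoclone Γ) {j l : ℕ} {c d : ZMod 2}
    (hc : Has Γ (lin (j + 1) c)) (hd : Has Γ (lin (l + 1) d)) (h : 0 < j + l) :
    Has Γ (lin (j + l) (c + d)) := by
  have hC := hΓ.isConjClosed
  have hT := hC.has_inter
    (hC.has_manip hc (Fin.snoc (α := fun _ => Fin (j + l + 1))
      (fun i => Fin.castAdd 1 (Fin.castAdd l i)) (Fin.natAdd (j + l) 0)))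
    (hC.has_manip hd (Fin.snoc (α := fun _ => Fin (j + l + 1))
      (fun i => Fin.castAdd 1 (Fin.natAdd j i)) (Fin.natAdd (j + l) 0)))
  convert hΓ.has_exist h hT using 1
  ext a
  simp only [lin, Set.mem_ofPred_eq, exist, Set.mem_inter_iff, Fin.sum_univ_castSucc,
    Fin.snoc_castSucc, Fin.snoc_last, Fin.append_left, Fin.append_right, Fin.sum_univ_add]
  constructor
  · intro h
    obtain ⟨b, hb⟩ := exists_toGF (c + ∑ i, toGF (a (Fin.castAdd l i)))
    refine ⟨fun _ => b, ?_, ?_⟩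
    · rw [hb]
      grind
    · rw [hb]
      grind
  · rintro ⟨b, h1, h2⟩
    grind

/-- Identifying two variables of an equation removes both of them. -/
theorem _root_.IsCoclone.has_lin_of_add_two {Γ : Set BoolRel} (hΓ : IsCoclone Γ) {k : ℕ}
    {c : ZMod 2} (hk : 0 < k) (hc : Has Γ (lin (k + 2) c)) : Has Γ (lin k c) := by
  have hC := hΓ.isConjClosed
  have hT := hC.has_manip hc (Fin.snoc (α := fun _ => Fin (k + 1)) (Fin.snoc
    (α := fun _ => Fin (k + 1)) (fun i => Fin.castAdd 1 i) (Fin.natAdd k 0)) (Fin.natAdd k 0))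
  convert hΓ.has_exist hk hT using 1
  ext a
  simp only [lin, Set.mem_ofPred_eq, exist, Fin.sum_univ_castSucc,
    Fin.snoc_castSucc, Fin.snoc_last, Fin.append_left, add_assoc, GF_add_self,
    add_zero, exists_const]

theorem _root_.IsCoclone.has_lin_four {Γ : Set BoolRel} (hΓ : IsCoclone Γ) {k : ℕ}
    {c : ZMod 2} (hc : Has Γ (lin (k + 3) c)) : Has Γ (lin 4 0) := by
  induction k using Nat.strong_induction_on with
  | _ k ih =>
    match k with
    | 0 =>
      have := hΓ.has_lin_add (j := 2) (l := 2) hc hc (by norm_num)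
      rwa [GF_add_self] at this
    | 1 =>
      have := hΓ.has_lin_add (j := 3) (l := 3) hc hc (by norm_num)
      rw [GF_add_self] at this
      exact hΓ.has_lin_of_add_two (by norm_num) this
    | k + 2 => exact ih k (by omega) (hΓ.has_lin_of_add_two (by omega) hc)

/-- The linear equations in a co-clone are determined by the constants, disequality and the
equation `x₁ ⊕ x₂ ⊕ x₃ ⊕ x₄ = 0`. -/
theorem has_lin_of_has_lin {Γ Δ : Set BoolRel} (hΓ : IsCoclone Γ) (hΔ : IsCoclone Δ)
    (h0 : const false ∈ Γ → const false ∈ Δ) (h1 : const true ∈ Γ → const true ∈ Δ)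
    (hN : NEQ ∈ Γ → NEQ ∈ Δ) (h4 : Has Γ (lin 4 0) → Has Δ (lin 4 0)) {k : ℕ} {c : ZMod 2}
    (h : Has Γ (lin k c)) : Has Δ (lin k c) := by
  induction k using Nat.strong_induction_on with
  | _ k ih =>
    match k with
    | 0 => exact absurd h.1 (by norm_num)
    | 1 =>
      have key : ∀ b : Bool, lin 1 (toGF b) = {a | a 0 = b} := by
        intro b
        ext a
        simp [lin, toGF_injective.eq_iff]
      obtain ⟨b, rfl⟩ := exists_toGF c
      rw [key] at h ⊢
      refine ⟨Nat.one_pos, ?_⟩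
      cases b
      · exact h0 h.2
      · exact h1 h.2
    | 2 =>
      have key : ∀ b : Bool, lin 2 (toGF b) = {a | (a 0 ≠ a 1) = (b = true)} := by
        intro b
        ext a
        simp only [lin, Set.mem_ofPred_eq, Fin.sum_univ_two, ← toGF_xor, toGF_injective.eq_iff]
        cases a 0 <;> cases a 1 <;> cases b <;> simp
      obtain ⟨b, rfl⟩ := exists_toGF c
      rw [key] at h ⊢
      cases b
      · simp [hΔ.isConjClosed.has_eq (0 : Fin 2) 1]
      · simp only [eq_iff_iff, iff_true] at h ⊢
        exact ⟨Nat.two_pos, hN h.2⟩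
    | k + 3 =>
      have h' := ih (k + 1) (by omega) (hΓ.has_lin_of_add_two (by omega) h)
      have := hΔ.has_lin_add (j := k) (l := 3) h' (h4 (hΓ.has_lin_four h)) (by omega)
      rwa [add_zero] at this

/-- A nonempty relation of an affine co-clone is a conjunction of linear equations `lin k c` which
belong to the co-clone: a violated equation with the smallest possible support is up to the order
of the variables a projection of the relation. -/
theorem mem_of_affine {Γ Δ : Set BoolRel} (hΓ : IsCoclone Γ) (hΔ : IsConjClosed Δ)
    (haff : ∀ R ∈ Γ, Pres xor3 R.tuples)
    (hlin : ∀ k c, Has Γ (lin k c) → Has Δ (lin k c)) {R : BoolRel} (hR : R ∈ Γ)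
    (hne : R.tuples.Nonempty) : R ∈ Δ := by
  classical
  refine has_tuples.1 (hΔ.has_of_separated R.pos fun d hd => ?_)
  let P : Finset (Fin R.arity) → Prop := fun J =>
    ∃ c : ZMod 2, (∀ a ∈ R.tuples, ∑ j ∈ J, toGF (a j) = c) ∧ ∑ j ∈ J, toGF (d j) ≠ c
  obtain ⟨J, hJ, hmin⟩ : ∃ J, P J ∧ ∀ J', P J' → J.card ≤ J'.card := by
    obtain ⟨J, c, h⟩ := exists_equation (haff R hR) hne hd
    obtain ⟨J, hJ, h⟩ := Set.exists_min_image {J | P J} Finset.card (Set.toFinite _) ⟨J, c, h⟩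
    exact ⟨J, hJ, h⟩
  obtain ⟨c, hJR, hJd⟩ := hJ
  -- no equation with a smaller nonempty support is valid
  have hcirc : ∀ J' ⊆ J, J'.Nonempty → ∀ c', (∀ a ∈ R.tuples, ∑ j ∈ J', toGF (a j) = c') →
      J' = J := by
    intro J' hJ' hne' c' hc'
    by_contra hneq
    have hlt : J'.card < J.card := Finset.card_lt_card (hJ'.ssubset_of_ne hneq)
    have hlt' : (J \ J').card < J.card := by
      rw [Finset.card_sdiff_of_subset hJ']
      have := hne'.card_pos
      omega
    by_cases hd' : ∑ j ∈ J', toGF (d j) = c'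
    · refine absurd (hmin (J \ J') ⟨c + c', fun a ha => ?_, fun h => hJd ?_⟩) (by omega)
      · have h1 := hJR a ha
        rw [← Finset.sum_sdiff hJ', hc' a ha] at h1
        rw [← h1, add_assoc, GF_add_self, add_zero]
      · rw [← Finset.sum_sdiff hJ', h, hd', add_assoc, GF_add_self, add_zero]
    · exact absurd (hmin J' ⟨c', hc', hd'⟩) (by omega)
  obtain ⟨o, ho⟩ := hne
  have hJpos : 0 < J.card := by
    rw [Finset.card_pos, Finset.nonempty_iff_ne_empty]
    rintro rfl
    have := hJR o ho
    simp only [Finset.sum_empty] at this hJd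
    exact hJd this
  let e : Fin J.card ↪o Fin R.arity := J.orderEmbOfFin rfl
  have heJ : Finset.univ.map e.toEmbedding = J := by
    ext j
    simp [e]
  have hsum : ∀ a : Fin R.arity → Bool, ∑ i, toGF (a (e i)) = ∑ j ∈ J, toGF (a j) := by
    intro a
    conv_rhs => rw [← heJ]
    rw [Finset.sum_map]
    rfl
  have hproj := hΓ.has_proj hJpos (has_tuples.2 hR) e
  have hprojeq : {b : Fin J.card → Bool | ∃ a ∈ R.tuples, ∀ i, b i = a (e i)} =
      lin J.card c := by
    ext b
    constructor
    · rintro ⟨a, ha, hb⟩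
      simp only [lin, Set.mem_ofPred_eq, hb, hsum]
      exact hJR a ha
    · intro hb
      by_contra hcon
      have haff' := haff _ hproj.2
      obtain ⟨K, c', hK, hbK⟩ := exists_equation haff' ⟨fun i => o (e i), o, ho, fun i => rfl⟩ hcon
      have hKval : ∀ a ∈ R.tuples, ∑ j ∈ K.map e.toEmbedding, toGF (a j) = c' := by
        intro a ha
        rw [Finset.sum_map]
        exact hK (fun i => a (e i)) ⟨a, ha, fun i => rfl⟩
      rcases K.eq_empty_or_nonempty with rfl | hKne
      · have := hKval o ho
        simp only [Finset.map_empty, Finset.sum_empty] at this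
        simp [this] at hbK
      · have h1 := hcirc (K.map e.toEmbedding)
          (by conv_rhs => rw [← heJ]
              exact Finset.map_subset_map.2 (Finset.subset_univ K)) (by simpa using hKne) c' hKval
        have h2 : K = Finset.univ := Finset.map_injective e.toEmbedding (h1.trans heJ.symm)
        subst h2
        apply hbK
        rw [← hKval o ho, h1, hJR o ho]
        exact hb
  rw [hprojeq] at hproj
  refine ⟨_, hΔ.has_manip (hlin _ _ hproj) e, ?_, ?_⟩
  · intro a ha
    change ∑ i, toGF (a (e i)) = c
    rw [hsum]
    exact hJR a ha
  · intro h
    apply hJd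
    rw [← hsum]
    exact h

end BoolRel

namespace BoolRel

/-! ### Relations preserved by `x ∨ (y ∧ ¬ z)` -/

/-- The tuples which satisfy all equalities of two coordinates, and all equalities of a coordinate
to zero, that are valid on `R`. -/
def hull {n : ℕ} (R : Set (Fin n → Bool)) : Set (Fin n → Bool) :=
  {d | (∀ i j, (∀ a ∈ R, a i = a j) → d i = d j) ∧ ∀ i, (∀ a ∈ R, a i = false) → d i = false}

theorem subset_hull {n : ℕ} (R : Set (Fin n → Bool)) : R ⊆ hull R :=
  fun _ ha => ⟨fun _ _ h => h _ ha, fun _ h => h _ ha⟩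

/-- Within its hull, a relation preserved by `x ∨ (y ∧ ¬ z)` is upward closed. -/
theorem mem_of_le_of_mem_hull {n : ℕ} {R : Set (Fin n → Bool)} (hR : Pres orDiff R)
    {a d : Fin n → Bool} (ha : a ∈ R) (hd : d ∈ hull R) (had : a ≤ d) : d ∈ R := by
  classical
  rw [pres_orDiff] at hR
  -- a maximal tuple of `R` between `a` and `d`
  obtain ⟨m, ⟨hmR, hmd⟩, hmax⟩ := Set.Finite.exists_maximal (Set.toFinite {m | m ∈ R ∧ m ≤ d})
    ⟨a, ha, had⟩
  by_contra hdR
  have hne : ∃ i, m i = false ∧ d i = true := by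
    by_contra hc
    push Not at hc
    have : m = d := le_antisymm hmd fun i => by
      have := hc i
      cases hm : m i <;> cases hdi : d i <;> simp_all
    exact hdR (this ▸ hmR)
  obtain ⟨k, hmk, hdk⟩ := hne
  -- a minimal tuple of `R` above `m` with a one in the place `k`
  obtain ⟨c0, hc0, hc0k⟩ : ∃ c ∈ R, c k = true := by
    by_contra hc
    push Not at hc
    have := hd.2 k fun a ha => by simpa using hc a ha
    simp [this] at hdk
  obtain ⟨c, ⟨hcR, hmc, hck⟩, hmin⟩ := Set.Finite.exists_minimal
    (Set.toFinite {c | c ∈ R ∧ m ≤ c ∧ c k = true})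
    ⟨_, hR m hmR c0 hc0 m hmR, fun i => by
      cases hm : m i <;> simp [hm], by simp [hmk, hc0k]⟩
  -- a coordinate where `c` is too large is separated from `k` by a tuple of `R`
  have key : ∀ j, c j = true → m j = false → ∀ b ∈ R, b k = true → b j = true := by
    intro j hcj hmj b hb hbk
    by_contra hbj
    rw [Bool.not_eq_true] at hbj
    have h1 := hR m hmR c hcR b hb
    have h2 := hR m hmR c hcR _ h1
    have := hmin (y := fun i => m i || (c i && !(m i || (c i && !b i)))) ⟨h2, fun i => by
      cases hm : m i <;> simp [hm], by simp [hmk, hck, hbk]⟩ (fun i => by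
        have := hmc i
        cases hm : m i <;> cases hci : c i <;> simp_all) j
    simp [hcj, hmj, hbj] at this
    exact (Bool.false_ne_true (this rfl)).elim
  have key' : ∀ j, c j = true → m j = false → ∀ b ∈ R, b j = true → b k = true := by
    intro j hcj hmj b hb hbj
    by_contra hbk
    rw [Bool.not_eq_true] at hbk
    have h2 := hR m hmR c hcR b hb
    have := hmin (y := fun i => m i || (c i && !b i)) ⟨h2, fun i => by
      cases hm : m i <;> simp [hm], by simp [hck, hbk]⟩ (fun i => by
        have := hmc i
        cases hm : m i <;> cases hci : c i <;> simp_all) j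
    simp [hcj, hmj, hbj] at this
    exact (Bool.false_ne_true (this rfl)).elim
  have hcd : c ≤ d := by
    intro j
    by_cases hcj : c j = true
    · by_cases hmj : m j = true
      · have := hmd j
        rw [hmj] at this
        exact le_trans (by simp) this
      · have : d j = d k := hd.1 j k fun b hb => by
          have h1 := key j hcj (by simpa using hmj) b hb
          have h2 := key' j hcj (by simpa using hmj) b hb
          cases hj : b j <;> cases hk : b k <;> simp_all
        rw [this, hdk]
        simp
    · simp [hcj]
  have := hmax ⟨hcR, hcd⟩ hmc k
  simp [hmk, hck] at this
  exact (Bool.false_ne_true (this rfl)).elim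

/-- The largest tuple of the hull. -/
theorem exists_top_hull {n : ℕ} (R : Set (Fin n → Bool)) :
    ∃ t ∈ hull R, ∀ d ∈ hull R, d ≤ t := by
  classical
  refine ⟨fun i => decide (∃ a ∈ R, a i = true), ⟨fun i j h => ?_, fun i h => ?_⟩,
    fun d hd i => ?_⟩
  · refine decide_eq_decide.2 ⟨?_, ?_⟩
    · rintro ⟨a, ha, hai⟩
      exact ⟨a, ha, by rw [← h a ha, hai]⟩
    · rintro ⟨a, ha, hai⟩
      exact ⟨a, ha, by rw [h a ha, hai]⟩
  · simp only [decide_eq_false_iff_not]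
    rintro ⟨a, ha, hai⟩
    simp [h a ha] at hai
  · by_cases h : ∃ a ∈ R, a i = true
    · simp [h]
    · push Not at h
      have := hd.2 i fun a ha => by simpa using h a ha
      simp [this]

section MaxImpl

variable {n m : ℕ} {R : Set (Fin (n + m) → Bool)}

open Classical in
/-- The variables after the first `n` ones that are forced to equal one of the first `n`
variables are reset to the value which `a` forces. -/
noncomputable def retie (R : Set (Fin (n + m) → Bool)) (a : Fin n → Bool) (y : Fin m → Bool) :
    Fin m → Bool :=
  fun j => if h : ∃ i, ∀ r ∈ R, r (Fin.natAdd n j) = r (Fin.castAdd m i) then a h.choose else y j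

theorem retie_of_mem {a : Fin n → Bool} {y : Fin m → Bool} (h : Fin.append a y ∈ R) :
    retie R a y = y := by
  funext j
  unfold retie
  split_ifs with hj
  · simpa using (hj.choose_spec _ h).symm
  · rfl

theorem retie_retie (a a' : Fin n → Bool) (y : Fin m → Bool) :
    retie R a (retie R a' y) = retie R a y := by
  funext j
  unfold retie
  split_ifs <;> rfl

theorem retie_op {f : Op} (hf : ∀ c, f.fn (fun _ => c) = c) (t : Fin f.ar → Fin n → Bool)
    (y : Fin m → Bool) :
    (fun j => f.fn fun i => retie R (t i) y j) = retie R (fun j => f.fn fun i => t i j) y := by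
  funext j
  unfold retie
  split_ifs
  · rfl
  · exact hf _

theorem numExt_le_numExt_of_retie {a a' : Fin n → Bool}
    (h : ∀ y, Fin.append a y ∈ R → Fin.append a' (retie R a' y) ∈ R) :
    numExt R a ≤ numExt R a' := by
  refine numExt_le_of_injOn (retie R a') h fun b hb b' hb' he => ?_
  rw [← retie_of_mem hb, ← retie_of_mem hb', ← retie_retie a a', he, retie_retie]

theorem append_retie_mem (hR : Pres orDiff R) {a a' : Fin n → Bool} {y : Fin m → Bool}
    (h : Fin.append a y ∈ R) (haa : a ≤ a') (ha' : ∃ y', Fin.append a' y' ∈ hull R) :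
    Fin.append a' (retie R a' y) ∈ R := by
  obtain ⟨y', hy'⟩ := ha'
  have htied : ∀ j, (∃ i, ∀ r ∈ R, r (Fin.natAdd n j) = r (Fin.castAdd m i)) →
      retie R a' y j = y' j := by
    intro j hj
    unfold retie
    rw [dif_pos hj]
    have := hy'.1 _ _ hj.choose_spec
    simp only [Fin.append_left, Fin.append_right] at this
    exact this.symm
  have hfree : ∀ j, (¬ ∃ i, ∀ r ∈ R, r (Fin.natAdd n j) = r (Fin.castAdd m i)) →
      retie R a' y j = y j := fun j hj => by
    unfold retie
    rw [dif_neg hj]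
  refine mem_of_le_of_mem_hull hR h ⟨?_, ?_⟩ ?_
  · intro i j
    refine Fin.addCases (fun i => ?_) (fun i => ?_) i <;>
      refine Fin.addCases (fun j => ?_) (fun j => ?_) j <;> intro he <;>
      have h1 := hy'.1 _ _ he <;>
      simp only [Fin.append_left, Fin.append_right] at h1 ⊢
    · exact h1
    · rw [htied j ⟨i, fun r hr => (he r hr).symm⟩, h1]
    · rw [htied i ⟨j, he⟩, h1]
    · by_cases hi : ∃ k, ∀ r ∈ R, r (Fin.natAdd n i) = r (Fin.castAdd m k)
      · obtain ⟨k, hk⟩ := hi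
        rw [htied i ⟨k, hk⟩, htied j ⟨k, fun r hr => by rw [← he r hr, hk r hr]⟩, h1]
      · have h2 := he _ h
        simp only [Fin.append_right] at h2
        rw [hfree i hi, hfree j, h2]
        rintro ⟨k, hk⟩
        exact hi ⟨k, fun r hr => by rw [he r hr, hk r hr]⟩
  · intro i
    refine Fin.addCases (fun i => ?_) (fun i => ?_) i <;> intro he
    · simpa using hy'.2 _ he
    · have h1 := hy'.2 _ he
      have h2 := he _ h
      simp only [Fin.append_right] at h1 h2 ⊢
      by_cases hi : ∃ k, ∀ r ∈ R, r (Fin.natAdd n i) = r (Fin.castAdd m k)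
      · rw [htied i hi, h1]
      · rw [hfree i hi, h2]
  · intro i
    refine Fin.addCases (fun i => ?_) (fun i => ?_) i
    · simpa using haa i
    · simp only [Fin.append_right]
      by_cases hi : ∃ k, ∀ r ∈ R, r (Fin.natAdd n i) = r (Fin.castAdd m k)
      · unfold retie
        rw [dif_pos hi]
        have := hi.choose_spec _ h
        simp only [Fin.append_left, Fin.append_right] at this
        rw [this]
        exact haa _
      · unfold retie
        rw [dif_neg hi]

/-- The tuples of `maxImpl R` lie below the projection `u` of the largest tuple of the hull, and
all their fibres are copies of the fibre of `u`. -/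
theorem exists_top_maxImpl (hR : Pres orDiff R) :
    ∃ u ∈ maxImpl R,
      (∃ y, Fin.append u y ∈ hull R ∧ ∀ d ∈ hull R, d ≤ Fin.append u y) ∧
      ∀ a ∈ maxImpl R, ∀ y, Fin.append u y ∈ R → Fin.append a (retie R a y) ∈ R := by
  obtain ⟨t, ht, htop⟩ := exists_top_hull R
  obtain ⟨u, v, rfl⟩ : ∃ (u : Fin n → Bool) (v : Fin m → Bool), t = Fin.append u v :=
    ⟨_, _, (Fin.append_castAdd_natAdd).symm⟩
  have hmem : ∀ a ∈ maxImpl R, ∀ y, Fin.append a y ∈ R → Fin.append u (retie R u y) ∈ R := by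
    intro a _ y hy
    refine append_retie_mem hR hy (fun i => ?_) ⟨v, ht⟩
    simpa using htop _ (subset_hull R hy) (Fin.castAdd m i)
  have hle : ∀ a ∈ maxImpl R, numExt R a ≤ numExt R u :=
    fun a ha => numExt_le_numExt_of_retie (hmem a ha)
  obtain ⟨a₀, ha₀⟩ := maxImpl_nonempty R
  refine ⟨u, fun c => (ha₀ c).trans (hle a₀ ha₀), ⟨v, ht, htop⟩, ?_⟩
  · intro a ha y hy
    -- the injection of the fibre of `a` into that of `u` is onto, as neither is the smaller one
    have himg : retie R u '' {y | Fin.append a y ∈ R} = {y | Fin.append u y ∈ R} := by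
      refine Set.eq_of_subset_of_ncard_le ?_ ?_ (Set.toFinite _)
      · rintro _ ⟨z, hz, rfl⟩
        exact hmem a ha z hz
      · rw [Set.InjOn.ncard_image]
        · exact ha u
        · intro b hb b' hb' he
          rw [← retie_of_mem (show Fin.append a b ∈ R from hb),
            ← retie_of_mem (show Fin.append a b' ∈ R from hb'), ← retie_retie a u, he, retie_retie]
    obtain ⟨z, hz, rfl⟩ : y ∈ retie R u '' {y | Fin.append a y ∈ R} := by
      rw [himg]
      exact hy
    rw [retie_retie, retie_of_mem (show Fin.append a z ∈ R from hz)]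
    exact hz

/-- All fibres over `maxImpl R` are copies of the largest one, and an idempotent operation acts on
them in a compatible way. -/
theorem Pres.maxImpl_of_orDiff (hR : Pres orDiff R) {f : Op}
    (hf : ∀ c, f.fn (fun _ => c) = c) (hfR : Pres f R) : Pres f (maxImpl R) := by
  obtain ⟨u, hu, -, h⟩ := exists_top_maxImpl hR
  intro t ht c
  refine (hu c).trans (numExt_le_numExt_of_retie fun y hy => ?_)
  rw [← retie_op hf]
  convert hfR _ fun i => h (t i) (ht i) y hy using 1
  funext j
  refine Fin.addCases (fun j => ?_) (fun j => ?_) j <;> simp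

/-- If `R` contains the tuple of ones, this is the largest tuple of the hull. -/
theorem Pres.maxImpl_one_of_orDiff (hR : Pres orDiff R) (h1 : Pres (cst true) R) :
    Pres (cst true) (maxImpl R) := by
  rw [pres_cst] at h1 ⊢
  obtain ⟨u, hu, ⟨y, _, htop⟩, -⟩ := exists_top_maxImpl hR
  convert hu using 1
  funext i
  have := htop _ (subset_hull R h1) (Fin.castAdd m i)
  simp only [Fin.append_left] at this
  cases h : u i
  · rw [h] at this
    exact (Bool.false_ne_true (this rfl)).elim
  · rfl

end MaxImpl

theorem isMaxCoclone_Inv_of_orDiff {F : Set Op} (hF : orDiff ∈ F)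
    (h : ∀ f ∈ F, f = cst true ∨ ∀ c, f.fn (fun _ => c) = c) : IsMaxCoclone (Inv F) := by
  have hC := isCoclone_Inv F
  refine ⟨hC.eq, hC.manip, hC.conj, fun n m hn hnm R hR => ?_⟩
  intro f hf
  rcases h f hf with rfl | hf'
  · exact (hR _ hF).maxImpl_one_of_orDiff (hR _ hf)
  · exact (hR _ hF).maxImpl_of_orDiff hf' (hR f hf)

/-- Nonempty relations of a class all of whose relations are preserved by `x ∨ (y ∧ ¬ z)` are
conjunctions of equalities, equalities to zero and positive clauses `OR w` of the class: a maximal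
tuple of the hull outside of the relation is excluded by a clause with one variable for each class
of equivalent coordinates. -/
theorem mem_of_pres_orDiff {Γ Δ : Set BoolRel} (hΓ : IsMaxCoclone Γ) (h1 : const true ∈ Γ)
    (hp : ∀ R ∈ Γ, Pres orDiff R.tuples) (hΔ : IsConjClosed Δ)
    (h0 : const false ∈ Γ → const false ∈ Δ)
    (hOR : ∀ w hw, OR w hw ∈ Γ → OR w hw ∈ Δ) {R : BoolRel} (hR : R ∈ Γ)
    (hne : R.tuples.Nonempty) : R ∈ Δ := by
  classical
  obtain ⟨n, hn, R⟩ := R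
  change R.Nonempty at hne
  have hRΓ : Has Γ R := ⟨hn, hR⟩
  have hpR : Pres orDiff R := hp _ hR
  obtain ⟨o, ho⟩ := hne
  have hzero : ∀ i, (∀ a ∈ R, a i = false) → const false ∈ Γ := by
    intro i hi
    let σ : Fin n → Fin 1 ⊕ Bool := fun j => if o j = true then Sum.inr true else Sum.inl 0
    have hσ : ∀ j c, σ j = Sum.inr c → const c ∈ Γ := by
      intro j c
      simp only [σ]
      split_ifs
      · rintro ⟨⟩
        exact h1
      · rintro ⟨⟩
    have hfo : (fun j => Sum.elim (fun _ => false) id (σ j)) = o := by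
      funext j
      simp only [σ]
      split_ifs with hj <;> simp [hj]
    have hsec := hΓ.has_section Nat.one_pos hRΓ σ hσ ⟨fun _ => false, by
      change (fun j => Sum.elim (fun _ => false) id (σ j)) ∈ R
      rwa [hfo]⟩
    refine (?_ : Has Γ {a : Fin 1 → Bool | a 0 = false}).2
    convert hsec using 1
    ext x
    constructor
    · intro (hx : x 0 = false)
      have : x = fun _ => false := funext fun k => by rw [Subsingleton.elim k 0, hx]
      change (fun j => Sum.elim x id (σ j)) ∈ R
      rwa [this, hfo]
    · intro hx
      have h2 := hi _ hx
      simpa [σ, hi o ho] using h2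
  refine (hΔ.has_of_separated hn fun d hd => ?_ : Has Δ R).2
  by_cases hdh : d ∈ hull R
  · obtain ⟨e, ⟨heh, heR, hde⟩, hmax⟩ := Set.Finite.exists_maximal
      (Set.toFinite {e | e ∈ hull R ∧ e ∉ R ∧ d ≤ e}) ⟨d, hdh, hd, le_rfl⟩
    let K := {i : Fin n // e i = false ∧ ∃ a ∈ R, a i = true}
    let col : Fin n → R → Bool := fun i a => a.1 i
    let Q := Set.range fun i : K => col i.1
    let q : Q ≃ Fin (Nat.card Q) := Finite.equivFin Q
    choose rep hrep using fun x : Q => x.2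
    -- the tuple obtained by changing `e` on the classes of coordinates
    let σ : Fin n → Fin (Nat.card Q) ⊕ Bool := fun i =>
      if h : e i = false ∧ ∃ a ∈ R, a i = true then Sum.inl (q ⟨col i, ⟨i, h⟩, rfl⟩)
      else Sum.inr (e i)
    have hle : ∀ a ∈ R, (∀ k, a (rep (q.symm k)).1 = false) → a ≤ e := by
      intro a ha hk i
      by_cases h : e i = false ∧ ∃ a ∈ R, a i = true
      · have h2 : col (rep ⟨col i, ⟨i, h⟩, rfl⟩).1 = col i := hrep ⟨col i, ⟨i, h⟩, rfl⟩
        have h3 := congrFun h2 ⟨a, ha⟩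
        have h4 := hk (q ⟨col i, ⟨i, h⟩, rfl⟩)
        rw [Equiv.symm_apply_apply] at h4
        have : a i = false := by rw [← h4]; exact h3.symm
        simp [this]
      · cases he : e i
        · push Not at h
          have := h he a ha
          simp [this]
        · simp
    have hT : ∀ a ∈ R, (fun k => a (rep (q.symm k)).1) ≠ fun _ => false := fun a ha hc =>
      heR (mem_of_le_of_mem_hull hpR ha heh (hle a ha (congrFun hc)))
    have hw : 0 < Nat.card Q := by
      by_contra hw
      apply hT o ho
      funext k
      exact absurd k.2 (by omega)
    have hσ : ∀ i c, σ i = Sum.inr c → const c ∈ Γ := by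
      intro i c
      simp only [σ]
      split_ifs with h
      · rintro ⟨⟩
      · rintro ⟨⟩
        cases he : e i
        · refine hzero i fun a ha => ?_
          push Not at h
          simpa using h he a ha
        · exact h1
    have hsec : {x : Fin (Nat.card Q) → Bool | (fun i => Sum.elim x id (σ i)) ∈ R} =
        {x | x ≠ fun _ => false} := by
      ext x
      constructor
      · rintro hx rfl
        apply heR
        convert (show (fun i => Sum.elim (fun _ => false) id (σ i)) ∈ R from hx) using 1
        funext i
        simp only [σ]
        split_ifs with h <;> simp [h]
      · intro hx
        by_contra hxR
        have hge : e ≤ fun i => Sum.elim x id (σ i) := by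
          intro i
          simp only [σ]
          split_ifs with h
          · simp [h]
          · exact le_rfl
        have hhull : (fun i => Sum.elim x id (σ i)) ∈ hull R := by
          refine ⟨fun i j hij => ?_, fun i hi => ?_⟩
          · have hcol : col i = col j := funext fun a => hij a.1 a.2
            have heij := heh.1 i j hij
            by_cases h : e i = false ∧ ∃ a ∈ R, a i = true
            · have h' : e j = false ∧ ∃ a ∈ R, a j = true := by
                obtain ⟨h3, a, ha, hai⟩ := h
                exact ⟨by rw [← heij, h3], a, ha, by rw [← hij a ha, hai]⟩
              simp only [σ, dif_pos h, dif_pos h', Sum.elim_inl, hcol]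
            · have h' : ¬ (e j = false ∧ ∃ a ∈ R, a j = true) := by
                rintro ⟨h3, a, ha, hai⟩
                exact h ⟨by rw [heij, h3], a, ha, by rw [hij a ha, hai]⟩
              simp only [σ, dif_neg h, dif_neg h', Sum.elim_inr, heij]
          · have h' : ¬ (e i = false ∧ ∃ a ∈ R, a i = true) := by
              rintro ⟨-, a, ha, hai⟩
              simp [hi a ha] at hai
            simp only [σ, dif_neg h', Sum.elim_inr, id, heh.2 i hi]
        have hle' := hmax ⟨hhull, hxR, hde.trans hge⟩ hge
        apply hx
        funext k
        have h2 := hle' (rep (q.symm k)).1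
        have h3 := (rep (q.symm k)).2
        have h4 : (⟨col (rep (q.symm k)).1, ⟨(rep (q.symm k)).1, h3⟩, rfl⟩ : Q) = q.symm k :=
          Subtype.ext (hrep (q.symm k))
        simp only [σ, dif_pos h3, Sum.elim_inl, h4, Equiv.apply_symm_apply, h3.1] at h2
        cases hxk : x k
        · rfl
        · rw [hxk] at h2
          exact (Bool.false_ne_true (h2 rfl)).elim
    have hmem : OR (Nat.card Q) hw ∈ Γ := by
      refine (?_ : Has Γ {x : Fin (Nat.card Q) → Bool | x ≠ fun _ => false}).2
      rw [← hsec]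
      refine hΓ.has_section hw hRΓ σ hσ ?_
      rw [hsec]
      exact ⟨fun _ => true, fun h => by simpa using congrFun h ⟨0, hw⟩⟩
    have hOR' : Has Δ {x : Fin (Nat.card Q) → Bool | x ≠ fun _ => false} := ⟨hw, hOR _ hw hmem⟩
    refine ⟨_, hΔ.has_manip hOR' fun k => (rep (q.symm k)).1, hT, fun h => h ?_⟩
    funext k
    have h2 := hde (rep (q.symm k)).1
    rw [(rep (q.symm k)).2.1] at h2
    cases h3 : d (rep (q.symm k)).1
    · rfl
    · rw [h3] at h2
      exact (Bool.false_ne_true (h2 rfl)).elim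
  · have hcases : (∃ i j, (∀ a ∈ R, a i = a j) ∧ d i ≠ d j) ∨
        ∃ i, (∀ a ∈ R, a i = false) ∧ d i ≠ false := by
      by_contra hc
      push Not at hc
      exact hdh ⟨hc.1, hc.2⟩
    rcases hcases with ⟨i, j, h, h'⟩ | ⟨i, h, h'⟩
    · exact ⟨_, hΔ.has_eq i j, h, h'⟩
    · exact ⟨_, hΔ.has_coord (h0 (hzero i h)) i, h, h'⟩

end BoolRel

namespace BoolRel

/-! ### Binary and ternary relations given by Boolean functions -/

/-- The unary relation with characteristic function `r`. -/
def rel1 (r : Bool → Bool) : Set (Fin 1 → Bool) := {a | r (a 0) = true}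

/-- The binary relation with characteristic function `q`. -/
def rel2 (q : Bool → Bool → Bool) : Set (Fin 2 → Bool) := {a | q (a 0) (a 1) = true}

/-- The ternary relation with characteristic function `p`. -/
def rel3 (p : Bool → Bool → Bool → Bool) : Set (Fin 3 → Bool) :=
  {a | p (a 0) (a 1) (a 2) = true}

theorem const_mem_iff {Γ : Set BoolRel} {c : Bool} :
    const c ∈ Γ ↔ Has Γ (rel1 fun x => x == c) := by
  rw [show const c ∈ Γ ↔ Has Γ {a : Fin 1 → Bool | a 0 = c} from (has_iff Nat.one_pos).symm]
  simp [rel1]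

theorem IMP_mem_iff {Γ : Set BoolRel} : IMP ∈ Γ ↔ Has Γ (rel2 fun x y => !x || y) := by
  rw [show IMP ∈ Γ ↔ Has Γ {a : Fin 2 → Bool | a 0 = false ∨ a 1 = true} from
    (has_iff Nat.two_pos).symm]
  simp [rel2]

theorem NEQ_mem_iff {Γ : Set BoolRel} : NEQ ∈ Γ ↔ Has Γ (rel2 fun x y => x ^^ y) := by
  rw [show NEQ ∈ Γ ↔ Has Γ {a : Fin 2 → Bool | a 0 ≠ a 1} from (has_iff Nat.two_pos).symm]
  simp [rel2]

theorem OR_two_mem_iff {Γ : Set BoolRel} {h : 0 < 2} :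
    OR 2 h ∈ Γ ↔ Has Γ (rel2 fun x y => x || y) := by
  rw [show OR 2 h ∈ Γ ↔ Has Γ {a : Fin 2 → Bool | a ≠ fun _ => false} from
    (has_iff Nat.two_pos).symm]
  have : {a : Fin 2 → Bool | a ≠ fun _ => false} = rel2 fun x y => x || y := by
    ext a
    simp only [Set.mem_ofPred_eq, rel2]
    revert a
    decide
  rw [this]

theorem NAND_two_mem_iff {Γ : Set BoolRel} {h : 0 < 2} :
    NAND 2 h ∈ Γ ↔ Has Γ (rel2 fun x y => !x || !y) := by
  rw [show NAND 2 h ∈ Γ ↔ Has Γ {a : Fin 2 → Bool | a ≠ fun _ => true} from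
    (has_iff Nat.two_pos).symm]
  have : {a : Fin 2 → Bool | a ≠ fun _ => true} = rel2 fun x y => !x || !y := by
    ext a
    simp only [Set.mem_ofPred_eq, rel2]
    revert a
    decide
  rw [this]

theorem fun_eq_of_values {q q' : Bool → Bool → Bool} (h1 : q false false = q' false false)
    (h2 : q false true = q' false true) (h3 : q true false = q' true false)
    (h4 : q true true = q' true true) : q = q' := by
  funext x y
  cases x <;> cases y <;> assumption

namespace IsConjClosed

theorem has_rel2_comp {Γ : Set BoolRel} (hΓ : IsConjClosed Γ) {q : Bool → Bool → Bool}
    (h : Has Γ (rel2 q)) {n : ℕ} (i j : Fin n) :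
    Has Γ {a : Fin n → Bool | q (a i) (a j) = true} := by
  simpa [rel2] using hΓ.has_manip h ![i, j]

theorem has_rel3_comp {Γ : Set BoolRel} (hΓ : IsConjClosed Γ) {p : Bool → Bool → Bool → Bool}
    (h : Has Γ (rel3 p)) {n : ℕ} (i j k : Fin n) :
    Has Γ {a : Fin n → Bool | p (a i) (a j) (a k) = true} := by
  simpa [rel3] using hΓ.has_manip h ![i, j, k]

theorem has_rel2_swap {Γ : Set BoolRel} (hΓ : IsConjClosed Γ) {q : Bool → Bool → Bool}
    (h : Has Γ (rel2 q)) : Has Γ (rel2 fun x y => q y x) := hΓ.has_rel2_comp h 1 0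

theorem has_rel2_and {Γ : Set BoolRel} (hΓ : IsConjClosed Γ) {q q' : Bool → Bool → Bool}
    (h : Has Γ (rel2 q)) (h' : Has Γ (rel2 q')) : Has Γ (rel2 fun x y => q x y && q' x y) := by
  simpa [rel2] using hΓ.has_and h h'

end IsConjClosed

theorem ncard_setOf_fin_one (P : (Fin 1 → Bool) → Bool) :
    {b : Fin 1 → Bool | P b = true}.ncard =
      (P fun _ => false).toNat + (P fun _ => true).toNat := by
  classical
  rw [Set.ncard_eq_toFinset_card', Set.toFinset_ofPred]
  have : (Finset.univ : Finset (Fin 1 → Bool)) = {fun _ => false, fun _ => true} := by decide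
  rw [this, Finset.filter_insert, Finset.filter_singleton]
  cases h : P fun _ => false <;> cases h' : P fun _ => true <;>
    simp [funext_iff]

/-- The number of ones in a row of the characteristic function. -/
def cnt (r : Bool → Bool) : ℕ := (r false).toNat + (r true).toNat

theorem _root_.IsMaxCoclone.has_rel1_max {Γ : Set BoolRel} (hΓ : IsMaxCoclone Γ)
    {q : Bool → Bool → Bool} (h : Has Γ (rel2 q)) :
    Has Γ (rel1 fun x => decide (∀ x', cnt (q x') ≤ cnt (q x))) := by
  have key : ∀ a, numExt (n := 1) (m := 1) (rel2 q) a = cnt (q (a 0)) :=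
    fun a => ncard_setOf_fin_one fun b => q (a 0) (b 0)
  convert hΓ.has_maxImpl Nat.one_pos (n := 1) (m := 1) h using 1
  ext a
  simp only [rel1, maxImpl, Set.mem_ofPred_eq, decide_eq_true_eq, key]
  exact ⟨fun h c => h _, fun h x => h fun _ => x⟩

theorem _root_.IsMaxCoclone.has_rel2_max {Γ : Set BoolRel} (hΓ : IsMaxCoclone Γ)
    {p : Bool → Bool → Bool → Bool} (h : Has Γ (rel3 p)) :
    Has Γ (rel2 fun x y => decide (∀ x' y', cnt (p x' y') ≤ cnt (p x y))) := by
  have key : ∀ a, numExt (n := 2) (m := 1) (rel3 p) a = cnt (p (a 0) (a 1)) :=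
    fun a => ncard_setOf_fin_one fun b => p (a 0) (a 1) (b 0)
  convert hΓ.has_maxImpl Nat.two_pos (n := 2) (m := 1) h using 1
  ext a
  simp only [rel2, maxImpl, Set.mem_ofPred_eq, decide_eq_true_eq, key]
  exact ⟨fun h c => h _ _, fun h x y => h ![x, y]⟩

theorem _root_.IsMaxCoclone.has_rel2_section {Γ : Set BoolRel} (hΓ : IsMaxCoclone Γ) {n : ℕ}
    {R : Set (Fin n → Bool)} (hR : Has Γ R) (σ : Fin n → Fin 2 ⊕ Bool)
    (hσ : ∀ i c, σ i = Sum.inr c → const c ∈ Γ) (x₀ y₀ : Bool)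
    (hne : (fun i => Sum.elim ![x₀, y₀] id (σ i)) ∈ R) :
    ∃ q, Has Γ (rel2 q) ∧ ∀ x y, q x y = true ↔ (fun i => Sum.elim ![x, y] id (σ i)) ∈ R := by
  classical
  refine ⟨fun x y => decide ((fun i => Sum.elim ![x, y] id (σ i)) ∈ R), ?_, by simp⟩
  convert hΓ.has_section Nat.two_pos hR σ hσ ⟨![x₀, y₀], hne⟩ using 1
  ext a
  have : ![a 0, a 1] = a := by
    funext i
    fin_cases i <;> rfl
  simp [rel2, this]

theorem _root_.IsMaxCoclone.has_rel3_section {Γ : Set BoolRel} (hΓ : IsMaxCoclone Γ) {n : ℕ}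
    {R : Set (Fin n → Bool)} (hR : Has Γ R) (σ : Fin n → Fin 3 ⊕ Bool)
    (hσ : ∀ i c, σ i = Sum.inr c → const c ∈ Γ) (x₀ y₀ z₀ : Bool)
    (hne : (fun i => Sum.elim ![x₀, y₀, z₀] id (σ i)) ∈ R) :
    ∃ p, Has Γ (rel3 p) ∧
      ∀ x y z, p x y z = true ↔ (fun i => Sum.elim ![x, y, z] id (σ i)) ∈ R := by
  classical
  refine ⟨fun x y z => decide ((fun i => Sum.elim ![x, y, z] id (σ i)) ∈ R), ?_, by simp⟩
  convert hΓ.has_section (by norm_num) hR σ hσ ⟨![x₀, y₀, z₀], hne⟩ using 1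
  ext a
  have : ![a 0, a 1, a 2] = a := by
    funext i
    fin_cases i <;> rfl
  simp [rel3, this]

/-! ### Implementations among binary relations -/

section Binary

variable {Γ : Set BoolRel}

theorem const_mem_of_rel2 (hΓ : IsMaxCoclone Γ) {q : Bool → Bool → Bool}
    (h : Has Γ (rel2 q)) {c : Bool} (hc : cnt (q (!c)) < cnt (q c)) : const c ∈ Γ := by
  rw [const_mem_iff]
  convert hΓ.has_rel1_max h using 2
  funext x
  cases x <;> cases c <;> simp_all [Bool.forall_bool] <;> omega

theorem const_mem_of_IMP (hΓ : IsMaxCoclone Γ) (h : IMP ∈ Γ) (c : Bool) : const c ∈ Γ := by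
  rw [IMP_mem_iff] at h
  cases c
  · exact const_mem_of_rel2 hΓ h (by decide)
  · exact const_mem_of_rel2 hΓ (hΓ.isConjClosed.has_rel2_swap h) (by decide)

theorem const_mem_of_NEQ (hΓ : IsMaxCoclone Γ) (h : NEQ ∈ Γ) {c : Bool} (hc : const c ∈ Γ)
    (c' : Bool) : const c' ∈ Γ := by
  rw [NEQ_mem_iff] at h
  have h2 : Has Γ (rel2 fun x y => (x ^^ y) && (y == c)) := by
    simpa [rel2] using hΓ.isConjClosed.has_and h (hΓ.isConjClosed.has_coord hc (1 : Fin 2))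
  by_cases hcc : c' = c
  · rwa [hcc]
  · exact const_mem_of_rel2 hΓ h2 (by
      clear h2 hc h
      revert hcc
      revert c c'
      decide)

theorem NEQ_mem_of_OR_of_NAND (hΓ : IsMaxCoclone Γ) (h : OR 2 Nat.two_pos ∈ Γ)
    (h' : NAND 2 Nat.two_pos ∈ Γ) : NEQ ∈ Γ := by
  rw [OR_two_mem_iff] at h
  rw [NAND_two_mem_iff] at h'
  rw [NEQ_mem_iff]
  convert hΓ.isConjClosed.has_rel2_and h h' using 2
  decide

/-- The auxiliary variables `z` and `w` double the weight of each zero among `x` and `y`, so that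
`(0,1)` and `(1,0)` are the heaviest tuples of `x ∨ y`. -/
theorem NEQ_mem_of_OR_of_IMP (hΓ : IsMaxCoclone Γ) (h : OR 2 Nat.two_pos ∈ Γ)
    (h' : IMP ∈ Γ) : NEQ ∈ Γ := by
  have hC := hΓ.isConjClosed
  rw [OR_two_mem_iff] at h
  rw [IMP_mem_iff] at h'
  rw [NEQ_mem_iff]
  have hT := hC.has_and (hC.has_rel2_comp h (0 : Fin (2 + 2)) 1)
    (hC.has_and (hC.has_rel2_comp h' (0 : Fin (2 + 2)) 2) (hC.has_rel2_comp h' 1 3))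
  convert hΓ.has_maxImpl Nat.two_pos hT using 1
  have key : ∀ a : Fin 2 → Bool, numExt {c : Fin (2 + 2) → Bool | (c 0 || c 1) = true ∧
      (!c 0 || c 2) = true ∧ (!c 1 || c 3) = true} a =
      (Finset.univ.filter fun b : Fin 2 → Bool => (a 0 || a 1) = true ∧
      (!a 0 || b 0) = true ∧ (!a 1 || b 1) = true).card := by
    intro a
    classical
    rw [numExt, Set.ncard_eq_toFinset_card', Set.toFinset_ofPred]
    congr 1
  ext a
  simp only [rel2, maxImpl, Set.mem_ofPred_eq, key]
  revert a
  decide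

/-- In the presence of `NEQ`, an argument of a nonempty binary relation may be negated. -/
theorem has_rel2_of_NEQ (hΓ : IsMaxCoclone Γ) (h : NEQ ∈ Γ) {q : Bool → Bool → Bool}
    (hq : Has Γ (rel2 q)) (hne : ∃ x y, q x y = true) : Has Γ (rel2 fun x y => q (!x) y) := by
  have hC := hΓ.isConjClosed
  rw [NEQ_mem_iff] at h
  have hT : Has Γ (rel3 fun x y z => (x ^^ z) && q z y) := by
    simpa [rel3] using hC.has_and (hC.has_rel2_comp h (0 : Fin 3) 2)
      (hC.has_rel2_comp hq (2 : Fin 3) 1)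
  convert hΓ.has_rel2_max hT using 2
  clear hT hq
  revert hne
  revert q
  decide

/-- Every relation `R` is implemented by implications and `NAND`: each tuple `t` of `R` gets a
variable which may be one only at `t`, so that the tuples of `R` have two extensions and all other
tuples one. -/
theorem eq_univ_of_IMP_of_NAND (hΓ : IsMaxCoclone Γ) (h : IMP ∈ Γ)
    (h' : NAND 2 Nat.two_pos ∈ Γ) : Γ = Set.univ := by
  classical
  have hC := hΓ.isConjClosed
  have h0 := const_mem_of_IMP hΓ h
  rw [IMP_mem_iff] at h
  rw [NAND_two_mem_iff] at h'
  refine Set.eq_univ_of_forall fun R => ?_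
  obtain ⟨n, hn, R⟩ := R
  refine (?_ : Has Γ R).2
  rcases R.eq_empty_or_nonempty with rfl | hne
  · exact hC.has_empty_of_const (h0 _) (h0 _) hn
  obtain ⟨N, ⟨e⟩⟩ : ∃ N, Nonempty (R ≃ Fin N) := ⟨_, ⟨Finite.equivFin R⟩⟩
  have hT : Has Γ {c : Fin (n + N) → Bool | ∀ (t : R) (i : Fin n),
      c (Fin.natAdd n (e t)) = true → c (Fin.castAdd _ i) = t.1 i} := by
    have hn' : 0 < n + N := by omega
    suffices hti : ∀ (t : R) (i : Fin n), Has Γ {c : Fin (n + N) → Bool |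
        c (Fin.natAdd n (e t)) = true → c (Fin.castAdd _ i) = t.1 i} by
      simpa only [Set.mem_ofPred_eq] using
        hC.has_forall hn' fun t => hC.has_forall hn' fun i => hti t i
    intro t i
    cases hti : t.1 i
    · convert hC.has_rel2_comp h' (Fin.natAdd n (e t)) (Fin.castAdd N i) using 1
      ext c
      simp only [Set.mem_ofPred_eq]
      cases c (Fin.natAdd n (e t)) <;> cases c (Fin.castAdd N i) <;> simp
    · convert hC.has_rel2_comp h (Fin.natAdd n (e t)) (Fin.castAdd N i) using 1
      ext c
      simp only [Set.mem_ofPred_eq]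
      cases c (Fin.natAdd n (e t)) <;> cases c (Fin.castAdd N i) <;> simp
  convert hΓ.has_maxImpl hn hT using 1
  symm
  have hext : ∀ x : Fin n → Bool, {b : Fin N → Bool | Fin.append x b ∈
      {c : Fin (n + N) → Bool | ∀ (t : R) (i : Fin n),
      c (Fin.natAdd n (e t)) = true → c (Fin.castAdd _ i) = t.1 i}} =
      {b | ∀ t : R, b (e t) = true → x = t.1} := by
    intro x
    ext b
    simp only [Set.mem_ofPred_eq, Fin.append_left, Fin.append_right]
    exact ⟨fun hb t ht => funext fun i => hb t i ht, fun hb t i ht => congrFun (hb t ht) i⟩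
  refine maxImpl_eq_of_numExt (N := 2) hne ?_ ?_
  · intro x hx
    rw [numExt, hext]
    have : {b : Fin N → Bool | ∀ t : R, b (e t) = true → x = t.1} =
        {fun _ => false, fun k => decide (k = e ⟨x, hx⟩)} := by
      ext b
      simp only [Set.mem_ofPred_eq, Set.mem_insert_iff, Set.mem_singleton_iff]
      constructor
      · intro hb
        have hb' : ∀ k, k ≠ e ⟨x, hx⟩ → b k = false := by
          intro k hk
          by_contra hc
          have := hb (e.symm k) (by simpa using hc)
          apply hk
          rw [← e.apply_symm_apply k]
          congr 1
          exact Subtype.ext this.symm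
        cases hbx : b (e ⟨x, hx⟩)
        · left
          funext k
          by_cases hk : k = e ⟨x, hx⟩
          · rw [hk, hbx]
          · exact hb' k hk
        · right
          funext k
          by_cases hk : k = e ⟨x, hx⟩
          · rw [hk, hbx]
            simp
          · rw [hb' k hk]
            simp [hk]
      · rintro (rfl | rfl) t ht
        · simp at ht
        · have := e.injective (by simpa using ht)
          rw [this]
    rw [this, Set.ncard_pair]
    intro hc
    simpa using congrFun hc (e ⟨x, hx⟩)
  · intro x hx
    rw [numExt, hext]
    have : {b : Fin N → Bool | ∀ t : R, b (e t) = true → x = t.1} =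
        {fun _ => false} := by
      ext b
      simp only [Set.mem_ofPred_eq, Set.mem_singleton_iff]
      constructor
      · intro hb
        funext k
        by_contra hc
        have := hb (e.symm k) (by simpa using hc)
        exact hx (this ▸ (e.symm k).2)
      · rintro rfl t ht
        simp at ht
    rw [this, Set.ncard_singleton]
    norm_num

/-- Negating arguments turns each of the three binary relations into implication and `NAND`. -/
theorem eq_univ_of_NEQ (hΓ : IsMaxCoclone Γ) (hN : NEQ ∈ Γ)
    (h : IMP ∈ Γ ∨ OR 2 Nat.two_pos ∈ Γ ∨ NAND 2 Nat.two_pos ∈ Γ) : Γ = Set.univ := by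
  have hC := hΓ.isConjClosed
  rw [IMP_mem_iff, OR_two_mem_iff, NAND_two_mem_iff] at h
  have key : Has Γ (rel2 fun x y => !x || y) → Γ = Set.univ := by
    intro h
    refine eq_univ_of_IMP_of_NAND hΓ (IMP_mem_iff.2 h) (NAND_two_mem_iff.2 ?_)
    have h2 := has_rel2_of_NEQ hΓ hN (hC.has_rel2_swap h) ⟨true, true, rfl⟩
    convert h2 using 2
    decide
  rcases h with h | h | h
  · exact key h
  · exact key (has_rel2_of_NEQ hΓ hN h ⟨true, true, rfl⟩)
  · apply key
    have h2 := hC.has_rel2_swap (has_rel2_of_NEQ hΓ hN h ⟨false, false, rfl⟩)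
    convert h2 using 2
    decide

theorem eq_univ_of_OR_of_IMP (hΓ : IsMaxCoclone Γ) (h : OR 2 Nat.two_pos ∈ Γ)
    (h' : IMP ∈ Γ) : Γ = Set.univ :=
  eq_univ_of_NEQ hΓ (NEQ_mem_of_OR_of_IMP hΓ h h') (Or.inl h')

theorem eq_univ_of_OR_of_NAND (hΓ : IsMaxCoclone Γ) (h : OR 2 Nat.two_pos ∈ Γ)
    (h' : NAND 2 Nat.two_pos ∈ Γ) : Γ = Set.univ :=
  eq_univ_of_NEQ hΓ (NEQ_mem_of_OR_of_NAND hΓ h h') (Or.inr (Or.inl h))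

end Binary

end BoolRel

namespace BoolRel

/-! ### Relations closed under conjunction and disjunction -/

open scoped FinsetFamily in
/-- By the inequality of Daykin, `|A| |B| ≤ |A ⊼ B| |A ⊻ B|` for the sets `A` and `B` of extensions
of two tuples. If both numbers are the maximal one, so are the numbers of extensions of the meet
and of the join, since these are bounded by the same maximum. -/
theorem pres_maxImpl_of_lattice {n m : ℕ} {R : Set (Fin (n + m) → Bool)} (hand : Pres and2 R)
    (hor : Pres or2 R) : Pres and2 (maxImpl R) ∧ Pres or2 (maxImpl R) := by
  classical
  rcases R.eq_empty_or_nonempty with rfl | hne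
  · rw [maxImpl_empty]
    exact ⟨fun _ _ => trivial, fun _ _ => trivial⟩
  rw [pres_and2] at hand ⊢
  rw [pres_or2] at hor ⊢
  let S : (Fin n → Bool) → Finset (Fin m → Bool) := fun a =>
    Finset.univ.filter fun b => Fin.append a b ∈ R
  have hS : ∀ a, numExt R a = (S a).card := by
    intro a
    rw [numExt, Set.ncard_eq_toFinset_card', Set.toFinset_ofPred]
  have key : ∀ a ∈ maxImpl R, ∀ b ∈ maxImpl R,
      (fun j => a j && b j) ∈ maxImpl R ∧ (fun j => a j || b j) ∈ maxImpl R := by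
    intro a ha b hb
    -- the inequality of Daykin for the fibres of `a` and `b`
    have h1 := Finset.le_card_infs_mul_card_sups (S a) (S b)
    have h2 : (S a ⊼ S b).card ≤ numExt R (fun j => a j && b j) := by
      rw [hS]
      refine Finset.card_le_card fun y hy => ?_
      obtain ⟨u, hu, v, hv, rfl⟩ := Finset.mem_infs.1 hy
      simp only [S, Finset.mem_filter, Finset.mem_univ, true_and] at hu hv ⊢
      convert hand _ hu _ hv using 1
      funext j
      refine Fin.addCases (fun j => ?_) (fun j => ?_) j <;> simp
    have h3 : (S a ⊻ S b).card ≤ numExt R (fun j => a j || b j) := by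
      rw [hS]
      refine Finset.card_le_card fun y hy => ?_
      obtain ⟨u, hu, v, hv, rfl⟩ := Finset.mem_sups.1 hy
      simp only [S, Finset.mem_filter, Finset.mem_univ, true_and] at hu hv ⊢
      convert hor _ hu _ hv using 1
      funext j
      refine Fin.addCases (fun j => ?_) (fun j => ?_) j <;> simp
    rw [← hS, ← hS] at h1
    have h4 := h1.trans (Nat.mul_le_mul h2 h3)
    have hab : numExt R a = numExt R b := le_antisymm (hb a) (ha b)
    have hpos : 0 < numExt R a := by
      obtain ⟨y, hy⟩ := exists_numExt_pos hne ha
      exact (Set.ncard_pos (Set.toFinite _)).2 ⟨y, hy⟩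
    have h5 := ha (fun j => a j && b j)
    have h6 := ha (fun j => a j || b j)
    rw [← hab] at h4
    constructor
    · intro c
      refine (ha c).trans ?_
      by_contra hc
      push Not at hc
      exact absurd h4 (not_le.2 (Nat.mul_lt_mul_of_lt_of_le hc h6 hpos))
    · intro c
      refine (ha c).trans ?_
      by_contra hc
      push Not at hc
      exact absurd h4 (not_le.2 (Nat.mul_lt_mul_of_le_of_lt h5 hc hpos))
  exact ⟨fun a ha b hb => (key a ha b hb).1, fun a ha b hb => (key a ha b hb).2⟩

/-- A relation closed under conjunction and disjunction is defined by implications and constants,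
as every tuple satisfying the valid ones is a disjunction of conjunctions of tuples of the
relation. -/
theorem has_of_lattice {Γ : Set BoolRel} (hΓ : IsConjClosed Γ) (hI : IMP ∈ Γ)
    (h0 : const false ∈ Γ) (h1 : const true ∈ Γ) {n : ℕ} (hn : 0 < n) {R : Set (Fin n → Bool)}
    (hand : Pres and2 R) (hor : Pres or2 R) : Has Γ R := by
  classical
  rw [pres_and2] at hand
  rw [pres_or2] at hor
  refine hΓ.has_of_separated hn fun d hd => ?_
  by_contra hcon
  push Not at hcon
  -- `none` stands for the constant one in the first, and for zero in the second argument
  have hsep : ∀ (i : Option (Fin n)) (j : Option (Fin n)), (∀ k, i = some k → d k = true) →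
      (∀ k, j = some k → d k = false) →
      ∃ a ∈ R, (∀ k, i = some k → a k = true) ∧ (∀ k, j = some k → a k = false) := by
    intro i j hi hj
    by_contra hc
    push Not at hc
    rcases i with - | i <;> rcases j with - | j
    · exact absurd (hcon ∅ (hΓ.has_empty_of_const h0 h1 hn) fun a ha => by simpa using hc a ha)
        (Set.notMem_empty d)
    · have := hcon _ (hΓ.has_coord h1 j) fun a ha => by simpa using hc a ha
      simp [hj j rfl] at this
    · have := hcon _ (hΓ.has_coord h0 i) fun a ha => by
        by_contra hai
        obtain ⟨k, hk, -⟩ := hc a ha (by rintro k ⟨⟩; simpa using hai)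
        simp at hk
      simp [hi i rfl] at this
    · have h2 : Has Γ {a : Fin n → Bool | (!a i || a j) = true} :=
        hΓ.has_rel2_comp (IMP_mem_iff.1 hI) i j
      have := hcon _ h2 fun a ha => by
        by_contra hai
        simp only [Set.mem_ofPred_eq, Bool.or_eq_true, Bool.not_eq_true', not_or,
          Bool.not_eq_false, Bool.not_eq_true] at hai
        obtain ⟨k, hk, hk'⟩ := hc a ha (by rintro k ⟨⟩; exact hai.1)
        cases hk
        exact hk' hai.2
      simp [hi i rfl, hj j rfl] at this
  choose w hwR hw1 hw0 using hsep
  let I : Finset (Option (Fin n)) := Finset.univ.filter fun i => ∀ k, i = some k → d k = true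
  let J : Finset (Option (Fin n)) := Finset.univ.filter fun i => ∀ k, i = some k → d k = false
  have hI : I.attach.Nonempty := ⟨⟨none, by simp [I]⟩, by simp⟩
  have hJ : J.attach.Nonempty := ⟨⟨none, by simp [J]⟩, by simp⟩
  let v : I → Fin n → Bool := fun i => J.attach.inf' hJ fun j =>
    w i.1 j.1 (Finset.mem_filter.1 i.2).2 (Finset.mem_filter.1 j.2).2
  have hvR : ∀ i, v i ∈ R := fun i =>
    Finset.inf'_mem R (fun a ha b hb => hand a ha b hb) _ _ _ fun j _ => hwR ..
  have huR : I.attach.sup' hI v ∈ R :=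
    Finset.sup'_mem R (fun a ha b hb => hor a ha b hb) _ _ _ fun i _ => hvR i
  apply hd
  convert huR
  apply le_antisymm
  · intro k
    cases hk : d k
    · exact Bool.false_le _
    · have hkI : some k ∈ I := by simp [I, hk]
      have h2 : v ⟨some k, hkI⟩ ≤ I.attach.sup' hI v := Finset.le_sup' v (Finset.mem_attach _ _)
      refine le_trans ?_ (h2 k)
      simp only [v, Finset.inf'_apply]
      refine Finset.le_inf' _ _ fun j _ => ?_
      rw [hw1 _ _ _ _ k rfl]
  · intro k
    cases hk : d k
    · have hkJ : some k ∈ J := by simp [J, hk]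
      simp only [Finset.sup'_apply]
      refine Finset.sup'_le _ _ fun i _ => ?_
      have h2 : v i ≤ w i.1 (some k) _ _ := Finset.inf'_le _ (Finset.mem_attach _ ⟨some k, hkJ⟩)
      refine (h2 k).trans ?_
      rw [hw0 _ _ _ _ k rfl]
    · exact Bool.le_true _

/-! ### Constants in a max-co-clone -/

section Constants

variable {Γ : Set BoolRel}

/-- A nonempty relation without the tuple of ones yields, by identifying variables according to one
of its tuples, a binary relation which contains `(0,1)`, but not `(1,1)`. -/
theorem const_false_or_NEQ (hΓ : IsMaxCoclone Γ) {n : ℕ} {R : Set (Fin n → Bool)} (hR : Has Γ R)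
    (hne : R.Nonempty) (h1 : (fun _ => true) ∉ R) : const false ∈ Γ ∨ NEQ ∈ Γ := by
  obtain ⟨a, ha⟩ := hne
  let σ : Fin n → Fin 2 ⊕ Bool := fun i => if a i = true then Sum.inl 1 else Sum.inl 0
  have hσa : (fun i => Sum.elim ![false, true] id (σ i)) = a := by
    funext i
    simp only [σ]
    cases a i <;> rfl
  have hσ1 : (fun i => Sum.elim ![true, true] id (σ i)) = fun _ => true := by
    funext i
    simp only [σ]
    cases a i <;> rfl
  obtain ⟨q, hq, hqR⟩ := hΓ.has_rel2_section hR σ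
    (fun i c => by simp only [σ]; split_ifs <;> rintro ⟨⟩) false true (by rwa [hσa])
  have h01 : q false true = true := by rw [hqR, hσa]; exact ha
  have h11 : q true true = false := by
    rw [← Bool.not_eq_true, hqR, hσ1]
    exact h1
  cases h00 : q false false
  · cases h10 : q true false
    · left
      exact const_mem_of_rel2 hΓ hq (by simp [cnt, h00, h01, h10, h11])
    · right
      rw [NEQ_mem_iff]
      convert hq using 2
      exact (fun_eq_of_values h00 h01 h10 h11).symm
  · left
    have h2 := hΓ.isConjClosed.has_rel2_comp hq (0 : Fin 1) 0
    rw [const_mem_iff]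
    convert h2 using 1
    ext x
    simp only [rel1, Set.mem_ofPred_eq]
    cases x 0 <;> simp [h00, h11]

theorem const_true_or_NEQ (hΓ : IsMaxCoclone Γ) {n : ℕ} {R : Set (Fin n → Bool)} (hR : Has Γ R)
    (hne : R.Nonempty) (h1 : (fun _ => false) ∉ R) : const true ∈ Γ ∨ NEQ ∈ Γ := by
  have h2 := const_false_or_NEQ hΓ.dualClass (R := dualSet R)
    (has_dualClass.2 (by simpa using hR)) (by
      obtain ⟨a, ha⟩ := hne
      exact ⟨fun i => !a i, by simpa [dualSet] using ha⟩) (by simpa [dualSet] using h1)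
  rwa [const_mem_dualClass, NEQ_mem_dualClass] at h2

/-- If `1` but not `0` is available as a constant, all nonempty relations contain the tuple of
ones. -/
theorem true_mem_of_const (hΓ : IsMaxCoclone Γ) (h1 : const true ∈ Γ) (h0 : const false ∉ Γ)
    {n : ℕ} {R : Set (Fin n → Bool)} (hR : Has Γ R) (hne : R.Nonempty) : (fun _ => true) ∈ R := by
  by_contra hc
  rcases const_false_or_NEQ hΓ hR hne hc with h | h
  · exact h0 h
  · exact h0 (const_mem_of_NEQ hΓ h h1 _)

/-- Otherwise a tuple whose complement is missing gives a binary relation which, intersected with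
`NEQ`, leaves the single tuple `(0,1)`. -/
theorem neg_mem_of_NEQ (hΓ : IsMaxCoclone Γ) (hN : NEQ ∈ Γ) (h0 : const false ∉ Γ)
    {n : ℕ} {R : Set (Fin n → Bool)} (hR : Has Γ R) : Pres neg R := by
  rw [pres_neg]
  intro a ha
  by_contra hc
  let σ : Fin n → Fin 2 ⊕ Bool := fun i => if a i = true then Sum.inl 1 else Sum.inl 0
  have hσa : (fun i => Sum.elim ![false, true] id (σ i)) = a := by
    funext i
    simp only [σ]
    cases a i <;> rfl
  have hσ1 : (fun i => Sum.elim ![true, false] id (σ i)) = fun i => !a i := by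
    funext i
    simp only [σ]
    cases a i <;> rfl
  obtain ⟨q, hq, hqR⟩ := hΓ.has_rel2_section hR σ
    (fun i c => by simp only [σ]; split_ifs <;> rintro ⟨⟩) false true (by rwa [hσa])
  have h01 : q false true = true := by rw [hqR, hσa]; exact ha
  have h10 : q true false = false := by
    rw [← Bool.not_eq_true, hqR, hσ1]
    exact hc
  exact h0 (const_mem_of_rel2 hΓ (hΓ.isConjClosed.has_rel2_and hq (NEQ_mem_iff.1 hN))
    (by simp [cnt, h01, h10]))

end Constants

/-! ### Max-co-clones of affine relations -/

section Slices

variable {n : ℕ} {R : Set (Fin (n + 1) → Bool)}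

/-- The tuples of `R` with last coordinate `t`, without that coordinate. -/
def slice (R : Set (Fin (n + 1) → Bool)) (t : Bool) : Set (Fin n → Bool) :=
  {a | Fin.append a (fun _ : Fin 1 => t) ∈ R}

theorem mem_iff_mem_slice {c : Fin (n + 1) → Bool} :
    c ∈ R ↔ (fun i => c (Fin.castAdd 1 i)) ∈ slice R (c (Fin.natAdd n 0)) := by
  have : Fin.append (fun i => c (Fin.castAdd 1 i)) (fun _ : Fin 1 => c (Fin.natAdd n 0)) = c := by
    funext i
    refine Fin.addCases (fun j => ?_) (fun j => ?_) i
    · simp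
    · simp [Subsingleton.elim j 0]
  simp only [slice, Set.mem_ofPred_eq, this]

theorem numExt_eq_slice (a : Fin n → Bool) [DecidablePred (· ∈ slice R false)]
    [DecidablePred (· ∈ slice R true)] : numExt R a =
    (if a ∈ slice R false then 1 else 0) + (if a ∈ slice R true then 1 else 0) := by
  classical
  have h := ncard_setOf_fin_one fun b => decide (Fin.append a b ∈ R)
  simp only [decide_eq_true_eq] at h
  rw [numExt, h]
  have : ∀ t, (decide (Fin.append a (fun _ => t) ∈ R)).toNat =
      if a ∈ slice R t then 1 else 0 := by
    intro t
    by_cases h : Fin.append a (fun _ => t) ∈ R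
    · simp [h, slice]
    · simp [h, slice]
  rw [this, this]
  congr

/-- Eliminating one coordinate: if the slices meet, the maximal number of extensions is two. -/
theorem maxImpl_eq_inter {a : Fin n → Bool} (h : a ∈ slice R false) (h' : a ∈ slice R true) :
    maxImpl R = slice R false ∩ slice R true := by
  classical
  refine maxImpl_eq_of_numExt (N := 2) ⟨a, h, h'⟩ (fun x hx => ?_) fun x hx => ?_
  · rw [numExt_eq_slice, if_pos hx.1, if_pos hx.2]
  · rw [numExt_eq_slice]
    split_ifs with h1 h2 <;> first | omega | exact absurd ⟨h1, h2⟩ hx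

/-- Eliminating one coordinate: if the slices are disjoint, the maximal number of extensions is
one. -/
theorem maxImpl_eq_union (hd : Disjoint (slice R false) (slice R true)) (hne : R.Nonempty) :
    maxImpl R = slice R false ∪ slice R true := by
  classical
  obtain ⟨c, hc⟩ := hne
  rw [mem_iff_mem_slice] at hc
  have hne : (slice R false ∪ slice R true).Nonempty := by
    cases h : c (Fin.natAdd n 0) <;> rw [h] at hc
    · exact ⟨_, Or.inl hc⟩
    · exact ⟨_, Or.inr hc⟩
  refine maxImpl_eq_of_numExt (N := 1) hne (fun x hx => ?_) fun x hx => ?_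
  · rw [numExt_eq_slice]
    rcases hx with h | h
    · rw [if_pos h, if_neg (Set.disjoint_left.1 hd h)]
    · rw [if_neg (Set.disjoint_right.1 hd h), if_pos h]
  · rw [numExt_eq_slice, if_neg (fun h => hx (Or.inl h)), if_neg (fun h => hx (Or.inr h))]
    norm_num

theorem pres_xor3_of_slice_eq (h : Pres xor3 (slice R false))
    (he : slice R false = slice R true) : Pres xor3 R := by
  have he' : ∀ t, slice R t = slice R false := by
    intro t
    cases t
    · rfl
    · exact he.symm
  rw [pres_xor3] at h ⊢
  intro a ha b hb c hc
  rw [mem_iff_mem_slice, he'] at *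
  exact h _ ha _ hb _ hc

/-- If the slices are disjoint, the last coordinate is a function of the others on the union of the
slices, and this function is affine if the two slices and their union are. -/
theorem pres_xor3_of_disjoint (hs : ∀ t, Pres xor3 (slice R t))
    (hd : Disjoint (slice R false) (slice R true))
    (hu : Pres xor3 (slice R false ∪ slice R true)) : Pres xor3 R := by
  simp only [pres_xor3] at *
  have hd' : ∀ t x, x ∈ slice R t → x ∉ slice R (!t) := by
    intro t x hx hx'
    cases t
    · exact Set.disjoint_left.1 hd hx hx'
    · exact Set.disjoint_left.1 hd hx' hx
  have hu' : ∀ x, x ∈ slice R false ∪ slice R true ↔ ∃ t, x ∈ slice R t := by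
    intro x
    simp [Bool.exists_bool]
  intro a ha b hb c hc
  rw [mem_iff_mem_slice] at ha hb hc ⊢
  obtain ⟨t, ht⟩ := (hu' _).1 (hu _ ((hu' _).2 ⟨_, ha⟩) _ ((hu' _).2 ⟨_, hb⟩) _ ((hu' _).2 ⟨_, hc⟩))
  -- if the sum lies in the wrong slice, three of the four tuples lie in the slice which does not
  -- contain the fourth one
  have h1 := fun (h : b (Fin.natAdd n 0) = a (Fin.natAdd n 0))
      (h' : c (Fin.natAdd n 0) = a (Fin.natAdd n 0)) =>
    hs _ _ ha _ (h ▸ hb) _ (h' ▸ hc)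
  have h2 := fun (h : b (Fin.natAdd n 0) = a (Fin.natAdd n 0)) (h' : t = a (Fin.natAdd n 0)) =>
    hs _ _ ha _ (h ▸ hb) _ (h' ▸ ht)
  have h3 := fun (h : c (Fin.natAdd n 0) = a (Fin.natAdd n 0)) (h' : t = a (Fin.natAdd n 0)) =>
    hs _ _ ha _ (h ▸ hc) _ (h' ▸ ht)
  have h4 := fun (h : c (Fin.natAdd n 0) = b (Fin.natAdd n 0)) (h' : t = b (Fin.natAdd n 0)) =>
    hs _ _ hb _ (h ▸ hc) _ (h' ▸ ht)
  have e1 : ∀ x y z : Bool, (x ^^ (y ^^ (x ^^ (y ^^ z)))) = z := by decide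
  have e2 : ∀ x y z : Bool, (x ^^ (z ^^ (x ^^ (y ^^ z)))) = y := by decide
  have e3 : ∀ x y z : Bool, (y ^^ (z ^^ (x ^^ (y ^^ z)))) = x := by decide
  simp only [e1, e2, e3] at h2 h3 h4
  have k0 := hd' _ _ ht
  have ka := hd' _ _ ha
  have kb := hd' _ _ hb
  have kc := hd' _ _ hc
  revert ha hb hc ht h1 h2 h3 h4 k0 ka kb kc
  generalize a (Fin.natAdd n 0) = x
  generalize b (Fin.natAdd n 0) = y
  generalize c (Fin.natAdd n 0) = z
  cases x <;> cases y <;> cases z <;> cases t <;> simp +contextual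

end Slices

end BoolRel

namespace BoolRel

section AffineCases

variable {Γ : Set BoolRel}

theorem has_slice_or_empty (hΓ : IsMaxCoclone Γ) {n : ℕ} (hn : 0 < n)
    {R : Set (Fin (n + 1) → Bool)} (hR : Has Γ R) {t : Bool} (ht : const t ∈ Γ) :
    Has Γ (slice R t) ∨ slice R t = ∅ := by
  rcases (slice R t).eq_empty_or_nonempty with h | ⟨a, ha⟩
  · exact Or.inr h
  left
  let σ : Fin (n + 1) → Fin n ⊕ Bool := Fin.append (fun i : Fin n => Sum.inl i)
    (fun _ : Fin 1 => Sum.inr t)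
  have hσ : ∀ x : Fin n → Bool, (fun i => Sum.elim x id (σ i)) = Fin.append x fun _ => t := by
    intro x
    funext i
    refine Fin.addCases (fun j => ?_) (fun j => ?_) i <;> simp [σ]
  have := hΓ.has_section hn hR σ (fun i c => by
    refine Fin.addCases (fun j => ?_) (fun j => ?_) i
    · simp [σ]
    · simp only [σ, Fin.append_right]
      rintro ⟨⟩
      exact ht) ⟨a, by simp only [hσ]; exact ha⟩
  simp only [hσ] at this
  exact this

theorem pres_xor3_empty {n : ℕ} : Pres xor3 (∅ : Set (Fin n → Bool)) := by
  rw [pres_xor3]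
  simp

theorem pres_xor3_fin_one (R : Set (Fin 1 → Bool)) : Pres xor3 R := by
  rw [pres_xor3]
  intro a ha b hb c hc
  have : ∀ a b c : Fin 1 → Bool, (fun j => a j ^^ (b j ^^ c j)) = a ∨
    (fun j => a j ^^ (b j ^^ c j)) = b ∨ (fun j => a j ^^ (b j ^^ c j)) = c := by decide
  rcases this a b c with h | h | h <;> rw [h] <;> assumption

/-- A binary relation with exactly three tuples is one of `IMP`, `OR` and `NAND`. -/
theorem false_of_three (hΓ : IsMaxCoclone Γ) (hI : IMP ∉ Γ) (hO : OR 2 Nat.two_pos ∉ Γ)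
    (hN : NAND 2 Nat.two_pos ∉ Γ) {q : Bool → Bool → Bool} (hq : Has Γ (rel2 q))
    (h3 : cnt (q false) + cnt (q true) = 3) : False := by
  rw [IMP_mem_iff] at hI
  rw [OR_two_mem_iff] at hO
  rw [NAND_two_mem_iff] at hN
  have hq' := hΓ.isConjClosed.has_rel2_swap hq
  have key : ∀ q : Bool → Bool → Bool, cnt (q false) + cnt (q true) = 3 →
      (q = fun x y => !x || y) ∨ ((fun x y => q y x) = fun x y => !x || y) ∨
      (q = fun x y => x || y) ∨ q = fun x y => !x || !y := by decide
  rcases key q h3 with h | h | h | h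
  · exact hI (h ▸ hq)
  · exact hI (h ▸ hq')
  · exact hO (h ▸ hq)
  · exact hN (h ▸ hq)

/-- The sections of `p` by a constant, and the relation implemented by eliminating its last
coordinate, are binary relations of `Γ`; in each of the possible cases one of them has exactly
three tuples. -/
theorem false_of_ternary (hΓ : IsMaxCoclone Γ) (hc : ∀ c, const c ∈ Γ) (hI : IMP ∉ Γ)
    (hO : OR 2 Nat.two_pos ∉ Γ) (hN : NAND 2 Nat.two_pos ∉ Γ) {p : Bool → Bool → Bool → Bool}
    (hp : Has Γ (rel3 p)) (h1 : ∀ x, p x false true = true) {s : Bool}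
    (h2 : p s true false = true) (h3 : p (!s) true false = false) : False := by
  have hsec : ∀ (q : Bool → Bool → Bool) (σ : Fin 3 → Fin 2 ⊕ Bool) (x₀ y₀ : Bool),
      (∀ x y, p (Sum.elim ![x, y] id (σ 0)) (Sum.elim ![x, y] id (σ 1))
        (Sum.elim ![x, y] id (σ 2)) = q x y) → q x₀ y₀ = true → Has Γ (rel2 q) := by
    intro q σ x₀ y₀ hq hne
    obtain ⟨q', hq', hq''⟩ := hΓ.has_rel2_section hp σ (fun _ c _ => hc c) x₀ y₀ (by
      simpa [rel3, hq] using hne)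
    convert hq' using 2
    funext x y
    rw [Bool.eq_iff_iff, hq'']
    simp [rel3, hq]
  have h3' := fun {q} => false_of_three hΓ hI hO hN (q := q)
  have k1 := fun h => h3' (hsec (fun x z => p x false z) ![Sum.inl 0, Sum.inr false, Sum.inl 1]
    true true (fun _ _ => rfl) (h1 _)) h
  have k2 := fun h => h3' (hsec (fun x y => p x y true) ![Sum.inl 0, Sum.inl 1, Sum.inr true]
    true false (fun _ _ => rfl) (h1 _)) h
  have k3 := fun h => h3' (hsec (fun x y => p x y false) ![Sum.inl 0, Sum.inl 1, Sum.inr false]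
    s true (fun _ _ => rfl) h2) h
  have k4 := fun h => h3' (hsec (fun x z => p x true z) ![Sum.inl 0, Sum.inr true, Sum.inl 1]
    s false (fun _ _ => rfl) h2) h
  have k5 := fun h => h3' (hΓ.has_rel2_max hp) h
  have h1f := h1 false
  have h1t := h1 true
  clear hsec h3' hp h1
  cases s <;> simp only [Bool.not_false, Bool.not_true] at h3 <;>
    simp only [cnt, Bool.forall_bool, h1f, h1t, h2, h3] at k1 k2 k3 k4 k5 <;>
    revert k1 k2 k3 k4 k5 <;>
    generalize p false false false = a <;> generalize p true false false = b <;>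
    generalize p false true true = c <;> generalize p true true true = d <;>
    revert a b c d <;> decide

/-- If both constants are available, but no binary relation with three tuples, all relations
are affine. -/
theorem pres_xor3_of_const (hΓ : IsMaxCoclone Γ) (hc : ∀ c, const c ∈ Γ) (hI : IMP ∉ Γ)
    (hO : OR 2 Nat.two_pos ∉ Γ) (hN : NAND 2 Nat.two_pos ∉ Γ) {n : ℕ} {R : Set (Fin n → Bool)}
    (hR : Has Γ R) : Pres xor3 R := by
  induction n with
  | zero => exact absurd hR.1 (by norm_num)
  | succ n ih =>
    rcases Nat.eq_zero_or_pos n with rfl | hn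
    · exact pres_xor3_fin_one R
    rcases R.eq_empty_or_nonempty with rfl | hne
    · exact pres_xor3_empty
    have hs : ∀ t, Pres xor3 (slice R t) := by
      intro t
      rcases has_slice_or_empty hΓ hn hR (hc t) with h | h
      · exact ih h
      · rw [h]
        exact pres_xor3_empty
    by_cases hd : Disjoint (slice R false) (slice R true)
    · refine pres_xor3_of_disjoint hs hd (ih ?_)
      rw [← maxImpl_eq_union hd hne]
      exact hΓ.has_maxImpl hn hR
    · obtain ⟨z, hzf, hzt⟩ := Set.not_disjoint_iff.1 hd
      refine pres_xor3_of_slice_eq (hs _) ?_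
      have key : ∀ s, slice R s ⊆ slice R (!s) := by
        intro s w hw
        by_contra hw'
        -- the pattern of the tuples `z` and `w`, with the last coordinate as first variable
        let σ : Fin (n + 1) → Fin 3 ⊕ Bool := Fin.append
          (fun i : Fin n => if z i = w i then Sum.inr (z i) else
            if w i = true then Sum.inl 1 else Sum.inl 2) (fun _ : Fin 1 => Sum.inl 0)
        have hσz : ∀ x, (fun i => Sum.elim ![x, false, true] id (σ i)) =
            Fin.append z fun _ => x := by
          intro x
          funext i
          refine Fin.addCases (fun j => ?_) (fun j => ?_) i
          · simp only [σ, Fin.append_left]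
            cases z j <;> cases w j <;> rfl
          · simp [σ]
        have hσw : ∀ x, (fun i => Sum.elim ![x, true, false] id (σ i)) =
            Fin.append w fun _ => x := by
          intro x
          funext i
          refine Fin.addCases (fun j => ?_) (fun j => ?_) i
          · simp only [σ, Fin.append_left]
            cases z j <;> cases w j <;> rfl
          · simp [σ]
        obtain ⟨p, hp, hpR⟩ := hΓ.has_rel3_section hR σ (fun _ c _ => hc c) true false true
          (by rw [hσz]; exact hzt)
        refine false_of_ternary hΓ hc hI hO hN hp (fun x => ?_) (s := s) ?_ ?_
        · rw [hpR, hσz]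
          cases x
          · exact hzf
          · exact hzt
        · rw [hpR, hσw]
          exact hw
        · rw [← Bool.not_eq_true, hpR, hσw]
          exact hw'
      exact Set.Subset.antisymm (key false) (key true)

/-- If the constant `1`, but neither the constant `0` nor the disjunction is available, all
relations are affine. -/
theorem pres_xor3_of_const_true (hΓ : IsMaxCoclone Γ) (h1 : const true ∈ Γ)
    (h0 : const false ∉ Γ) (hO : OR 2 Nat.two_pos ∉ Γ) {n : ℕ} {R : Set (Fin n → Bool)}
    (hR : Has Γ R) : Pres xor3 R := by
  have hI : IMP ∉ Γ := fun h => h0 (const_mem_of_IMP hΓ h _)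
  rw [IMP_mem_iff] at hI
  rw [OR_two_mem_iff] at hO
  induction n with
  | zero => exact absurd hR.1 (by norm_num)
  | succ n ih =>
    rcases Nat.eq_zero_or_pos n with rfl | hn
    · exact pres_xor3_fin_one R
    rcases R.eq_empty_or_nonempty with rfl | hne
    · exact pres_xor3_empty
    have h1R : (fun _ => true) ∈ slice R true := by
      have := true_mem_of_const hΓ h1 h0 hR hne
      rwa [mem_iff_mem_slice] at this
    have hst : Pres xor3 (slice R true) := by
      rcases has_slice_or_empty hΓ hn hR h1 with h | h
      · exact ih h
      · rw [h]
        exact pres_xor3_empty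
    by_cases hd : Disjoint (slice R false) (slice R true)
    · have hu : Pres xor3 (slice R false ∪ slice R true) := by
        refine ih ?_
        rw [← maxImpl_eq_union hd hne]
        exact hΓ.has_maxImpl hn hR
      -- the slice containing the tuple of ones is the larger one
      have hle : (slice R false).ncard ≤ (slice R true).ncard := by
        have hR' := hΓ.isConjClosed.has_manip hR
          (Fin.append (fun i : Fin n => Fin.natAdd 1 i) fun j : Fin 1 => Fin.castAdd n j)
        have hnum : ∀ x : Fin 1 → Bool, numExt {a : Fin (1 + n) → Bool | (fun i => a
            (Fin.append (fun i : Fin n => Fin.natAdd 1 i) (fun j : Fin 1 => Fin.castAdd n j) i))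
            ∈ R} x = (slice R (x 0)).ncard := by
          intro x
          rw [numExt]
          congr 1
          ext b
          simp only [Set.mem_ofPred_eq, slice]
          have : (fun i => Fin.append x b (Fin.append (fun i : Fin n => Fin.natAdd 1 i)
              (fun j : Fin 1 => Fin.castAdd n j) i)) = Fin.append b fun _ => x 0 := by
            funext i
            refine Fin.addCases (fun j => ?_) (fun j => ?_) i
            · simp
            · simp [Subsingleton.elim j 0]
          rw [this]
        have := true_mem_of_const hΓ h1 h0 (hΓ.has_maxImpl Nat.one_pos hR') (maxImpl_nonempty _)
          (fun _ => false)
        rwa [hnum, hnum] at this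
      refine pres_xor3_of_disjoint (fun t => ?_) hd hu
      cases t
      swap
      · exact hst
      rw [pres_xor3] at hst hu ⊢
      intro a ha b hb c hc
      by_contra hs
      have hs' : (fun j => a j ^^ (b j ^^ c j)) ∈ slice R true :=
        (hu a (Or.inl ha) b (Or.inl hb) c (Or.inl hc)).resolve_left hs
      -- two disjoint copies of the larger slice would fit into the smaller one
      have hmap : ∀ d ∈ slice R false, ∀ y ∈ slice R true,
          (fun j => y j ^^ ((a j ^^ (b j ^^ c j)) ^^ d j)) ∈ slice R false := by
        intro d hd' y hy
        refine (hu y (Or.inr hy) _ (Or.inr hs') d (Or.inl hd')).resolve_right fun h => ?_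
        refine Set.disjoint_left.1 hd hd' ?_
        convert hst y hy _ hs' _ h using 1
        funext j
        cases y j <;> cases a j <;> cases b j <;> cases c j <;> cases d j <;> rfl
      have hinj : ∀ d : Fin n → Bool, Function.Injective
          fun (y : Fin n → Bool) j => y j ^^ ((a j ^^ (b j ^^ c j)) ^^ d j) := by
        intro d y y' h
        funext j
        simpa using congrFun h j
      have hdisj : Disjoint ((fun (y : Fin n → Bool) j => y j ^^ ((a j ^^ (b j ^^ c j)) ^^ a j)) ''
          slice R true) ((fun (y : Fin n → Bool) j => y j ^^ ((a j ^^ (b j ^^ c j)) ^^ b j)) ''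
          slice R true) := by
        rw [Set.disjoint_left]
        rintro _ ⟨y, hy, rfl⟩ ⟨y', hy', h⟩
        refine Set.disjoint_left.1 hd hc ?_
        convert hst _ hs' y hy y' hy' using 1
        funext j
        have := congrFun h j
        dsimp only at this
        revert this
        cases y j <;> cases y' j <;> cases a j <;> cases b j <;> cases c j <;> simp
      have hcard := Set.ncard_union_eq hdisj (Set.toFinite _) (Set.toFinite _)
      rw [Set.ncard_image_of_injective _ (hinj a), Set.ncard_image_of_injective _ (hinj b)] at hcard
      have hsub : _ ∪ _ ⊆ slice R false := Set.union_subset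
        (Set.image_subset_iff.2 fun y hy => hmap a ha y hy)
        (Set.image_subset_iff.2 fun y hy => hmap b hb y hy)
      have hsub := Set.ncard_le_ncard hsub (Set.toFinite _)
      have hpos := (Set.ncard_pos (Set.toFinite (slice R true))).2 ⟨_, h1R⟩
      omega
    · have h1f : (fun _ => true) ∈ slice R false := by
        obtain ⟨z, hzf, hzt⟩ := Set.not_disjoint_iff.1 hd
        have h2 := hΓ.has_maxImpl hn hR
        rw [maxImpl_eq_inter hzf hzt] at h2
        exact (true_mem_of_const hΓ h1 h0 h2 ⟨z, hzf, hzt⟩).1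
      -- if the slices differ in `w`, the pattern of `w` and the tuple of ones is `IMP` or `OR`
      have hσ : ∀ w : Fin n → Bool, ∃ q, Has Γ (rel2 q) ∧
          (∀ x, q x true = true) ∧ ∀ x, q x false = true ↔ w ∈ slice R x := by
        intro w
        let σ : Fin (n + 1) → Fin 2 ⊕ Bool := Fin.append
          (fun i : Fin n => if w i = true then Sum.inr true else Sum.inl 1)
          (fun _ : Fin 1 => Sum.inl 0)
        have hσt : ∀ x, (fun i => Sum.elim ![x, true] id (σ i)) = Fin.append (fun _ => true)
            fun _ => x := by
          intro x
          funext i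
          refine Fin.addCases (fun j => ?_) (fun j => ?_) i
          · simp only [σ, Fin.append_left]
            cases w j <;> rfl
          · simp [σ]
        have hσf : ∀ x, (fun i => Sum.elim ![x, false] id (σ i)) = Fin.append w
            fun _ => x := by
          intro x
          funext i
          refine Fin.addCases (fun j => ?_) (fun j => ?_) i
          · simp only [σ, Fin.append_left]
            cases w j <;> rfl
          · simp [σ]
        obtain ⟨q, hq, hqR⟩ := hΓ.has_rel2_section hR σ (fun i c => by
          refine Fin.addCases (fun j => ?_) (fun j => ?_) i
          · simp only [σ, Fin.append_left]
            split_ifs <;> rintro ⟨⟩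
            exact h1
          · simp [σ]) true true (by rw [hσt]; exact h1R)
        refine ⟨q, hq, fun x => ?_, fun x => ?_⟩
        · rw [hqR, hσt]
          cases x
          · exact h1f
          · exact h1R
        · rw [hqR, hσf]
          rfl
      have heq : slice R false = slice R true := by
        apply Set.Subset.antisymm
        · intro w hw
          by_contra hw'
          obtain ⟨q, hq, hqt, hqf⟩ := hσ w
          apply hI
          convert hq using 2
          apply fun_eq_of_values
          · simp [(hqf false).2 hw]
          · simp [hqt]
          · have : ¬ q true false = true := fun h => hw' ((hqf true).1 h)
            simpa using this
          · simp [hqt]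
        · intro w hw
          by_contra hw'
          obtain ⟨q, hq, hqt, hqf⟩ := hσ w
          apply hO
          convert hq using 2
          apply fun_eq_of_values
          · have : ¬ q false false = true := fun h => hw' ((hqf false).1 h)
            simpa using this
          · simp [hqt]
          · simp [(hqf true).2 hw]
          · simp [hqt]
      exact pres_xor3_of_slice_eq (heq ▸ hst) heq

end AffineCases

end BoolRel

namespace BoolRel

/-! ### Fixing a coordinate to one -/

/-- The relations which arise from relations of `Γ` by setting the last coordinate to one. -/
def topSlice (Γ : Set BoolRel) : Set BoolRel :=
  {S | ∃ R : Set (Fin (S.arity + 1) → Bool), Has Γ R ∧ slice R true = S.tuples}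

theorem has_topSlice {Γ : Set BoolRel} {n : ℕ} (hn : 0 < n) {S : Set (Fin n → Bool)} :
    Has (topSlice Γ) S ↔ ∃ R : Set (Fin (n + 1) → Bool), Has Γ R ∧ slice R true = S :=
  has_iff hn

theorem IsConjClosed.subset_topSlice {Γ : Set BoolRel} (hΓ : IsConjClosed Γ) :
    Γ ⊆ topSlice Γ := by
  rintro ⟨n, hn, R⟩ hR
  refine ⟨_, hΓ.has_manip (m := n + 1) ((has_iff hn).2 hR) (Fin.castAdd 1), ?_⟩
  ext a
  simp [slice]

theorem IsConjClosed.const_true_mem_topSlice {Γ : Set BoolRel} (hΓ : IsConjClosed Γ) :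
    const true ∈ topSlice Γ := by
  refine ⟨_, hΓ.has_eq (0 : Fin (1 + 1)) 1, ?_⟩
  change slice (n := 1) _ _ = {a : Fin 1 → Bool | a 0 = true}
  ext a
  simp only [slice, Set.mem_ofPred_eq]
  exact Iff.rfl

/-- Setting a coordinate to one yields a max-co-clone, even if the constant is not available,
as long as no nonempty relation forces a coordinate to be zero. -/
theorem _root_.IsMaxCoclone.topSlice {Γ : Set BoolRel} (hΓ : IsMaxCoclone Γ)
    (H : ∀ {n : ℕ} {R : Set (Fin (n + 1) → Bool)}, Has Γ R → R.Nonempty →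
      (slice R true).Nonempty) : IsMaxCoclone (topSlice Γ) where
  eq := hΓ.isConjClosed.subset_topSlice hΓ.eq
  manip n m hn hm S π h := by
    obtain ⟨R, hR, rfl⟩ := (has_topSlice hn).1 ⟨hn, h⟩
    refine ⟨_, hΓ.isConjClosed.has_manip hR
      (Fin.append (fun i => Fin.castAdd 1 (π i)) fun _ : Fin 1 => Fin.natAdd m 0), ?_⟩
    change slice (n := m) _ _ = BoolRel.manip (slice R true) π
    ext a
    simp only [slice, BoolRel.manip, Set.mem_ofPred_eq]
    apply iff_of_eq
    congr 1
    funext i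
    refine Fin.addCases (fun j => ?_) (fun j => ?_) i <;> simp
  conj n hn S S' h h' := by
    obtain ⟨R, hR, rfl⟩ := (has_topSlice hn).1 ⟨hn, h⟩
    obtain ⟨R', hR', rfl⟩ := (has_topSlice hn).1 ⟨hn, h'⟩
    exact ⟨_, hΓ.isConjClosed.has_inter hR hR', rfl⟩
  maxImpl n m hn hnm S h := by
    obtain ⟨R, hR, rfl⟩ := (has_topSlice hnm).1 ⟨hnm, h⟩
    have hR' := hΓ.isConjClosed.has_manip (m := (n + 1) + m) hR
      (Fin.append (Fin.append (fun i => Fin.castAdd m (Fin.castAdd 1 i)) (Fin.natAdd (n + 1)))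
        fun _ : Fin 1 => Fin.castAdd m (Fin.natAdd n 0))
    have hnum : ∀ (a : Fin n → Bool) (t : Bool), numExt (n := n + 1) (m := m)
        {a | (fun i => a (Fin.append (Fin.append (fun i => Fin.castAdd m (Fin.castAdd 1 i))
          (Fin.natAdd (n + 1))) (fun _ : Fin 1 => Fin.castAdd m (Fin.natAdd n 0)) i)) ∈ R}
        (Fin.append a fun _ : Fin 1 => t) = numExt (slice R t) a := by
      intro a t
      unfold numExt
      congr 1
      ext b
      simp only [Set.mem_ofPred_eq, slice]
      apply iff_of_eq
      congr 1
      funext i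
      refine Fin.addCases (fun j => ?_) (fun j => ?_) i
      · refine Fin.addCases (fun k => ?_) (fun k => ?_) j <;> simp
      · simp
    have hT := hΓ.has_maxImpl (Nat.succ_pos n) hR'
    -- some tuple with last coordinate one has the maximal number of extensions
    obtain ⟨u, hu⟩ := H hT (maxImpl_nonempty _)
    refine ⟨_, hT, ?_⟩
    change slice (n := n) _ true = BoolRel.maxImpl (slice R true)
    ext a
    constructor
    · intro ha c
      have := ha (Fin.append c fun _ : Fin 1 => true)
      rwa [hnum, hnum] at this
    · intro ha c
      refine (hu c).trans ?_
      rw [hnum, hnum]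
      exact ha u

section NoConstants

variable {Γ : Set BoolRel}

/-- Without `IMP`, a binary relation which contains both constant tuples is symmetric. -/
theorem eq_of_IMP_notMem (hΓ : IsConjClosed Γ) (hI : IMP ∉ Γ) {q : Bool → Bool → Bool}
    (hq : Has Γ (rel2 q)) (h00 : q false false = true) (h11 : q true true = true) :
    q false true = q true false := by
  rw [IMP_mem_iff] at hI
  by_contra hne
  cases h01 : q false true
  · refine hI (cast ?_ (hΓ.has_rel2_swap hq))
    congr 2
    apply fun_eq_of_values <;> simp_all
  · refine hI (cast ?_ hq)
    congr 2
    apply fun_eq_of_values <;> simp_all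

theorem rel2_max_nonempty (p : Bool → Bool → Bool → Bool) :
    (rel2 fun x y => decide (∀ x' y', cnt (p x' y') ≤ cnt (p x y))).Nonempty := by
  obtain ⟨a, ha⟩ := Finite.exists_max fun a : Bool × Bool => cnt (p a.1 a.2)
  exact ⟨![a.1, a.2], by simpa [rel2] using ha⟩

/-- In the absence of constants and of `NEQ`, all relations are affine. -/
theorem pres_xor3_of_no_const (hΓ : IsMaxCoclone Γ) (h0 : const false ∉ Γ) (h1 : const true ∉ Γ)
    (hN : NEQ ∉ Γ) {n : ℕ} {R : Set (Fin n → Bool)} (hR : Has Γ R) : Pres xor3 R := by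
  have hC := hΓ.isConjClosed
  have hones : ∀ {n : ℕ} {R : Set (Fin n → Bool)}, Has Γ R → R.Nonempty →
      (fun _ => true) ∈ R := by
    intro n R hR hne
    by_contra hc
    rcases const_false_or_NEQ hΓ hR hne hc with h | h
    · exact h0 h
    · exact hN h
  have hzeros : ∀ {n : ℕ} {R : Set (Fin n → Bool)}, Has Γ R → R.Nonempty →
      (fun _ => false) ∈ R := by
    intro n R hR hne
    by_contra hc
    rcases const_true_or_NEQ hΓ hR hne hc with h | h
    · exact h1 h
    · exact hN h
  have hones' : ∀ {n : ℕ} {R : Set (Fin (n + 1) → Bool)}, Has Γ R → R.Nonempty →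
      (fun _ => true) ∈ slice R true := by
    intro n R hR hne
    have := hones hR hne
    rwa [mem_iff_mem_slice] at this
  have hΔ := hΓ.topSlice fun hR hne => ⟨_, hones' hR hne⟩
  refine pres_xor3_of_const_true hΔ hC.const_true_mem_topSlice ?_ ?_
    (hR.mono hC.subset_topSlice)
  · rw [const_mem_iff, has_topSlice Nat.one_pos]
    rintro ⟨R, hR, h⟩
    have h2 : (fun _ => false) ∈ slice R true := by rw [h]; rfl
    have h3 := hones' hR ⟨_, h2⟩
    rw [h] at h3
    simp [rel1] at h3
  · rw [OR_two_mem_iff, has_topSlice Nat.two_pos]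
    rintro ⟨R, hR, h⟩
    have hI : IMP ∉ Γ := fun h => h0 (const_mem_of_IMP hΓ h _)
    classical
    obtain ⟨p, hp, hz⟩ : ∃ p : Bool → Bool → Bool → Bool, rel3 p = R ∧
        ∀ x y, p x y true = (x || y) := by
      refine ⟨fun x y z => decide (![x, y, z] ∈ R), ?_, fun x y => ?_⟩
      · ext a
        have : ![a 0, a 1, a 2] = a := by
          funext i
          fin_cases i <;> rfl
        simp [rel3, this]
      · have h2 : ![x, y] ∈ slice R true ↔ (x || y) = true := by rw [h]; rfl
        have h3 : Fin.append ![x, y] (fun _ : Fin 1 => true) = ![x, y, true] := by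
          funext i
          fin_cases i <;> rfl
        rw [Bool.eq_iff_iff, ← h2]
        simp only [slice, Set.mem_ofPred_eq, h3, decide_eq_true_eq]
    subst hp
    -- without `IMP`, the values of `p` are determined by its slice
    have p001 := hz false false
    have p101 := hz true false
    have p011 := hz false true
    have p111 := hz true true
    have p000 : p false false false = true := hzeros hR ⟨_, hones hR ⟨![true, true, true], p111⟩⟩
    simp only [Bool.or_false, Bool.or_true] at p001 p101 p011 p111
    have hC2 := hC.has_rel3_comp hR (n := 2)
    have p010 : p false true false = true := by
      rw [eq_of_IMP_notMem (q := fun x y => p x y x) hC hI (hC2 0 1 0) p000 p111, p101]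
    have p100 : p true false false = true := by
      rw [← eq_of_IMP_notMem (q := fun x y => p x y y) hC hI (hC2 0 1 1) p000 p111, p011]
    have p110 : p true true false = false := by
      rw [← eq_of_IMP_notMem (q := fun x y => p x x y) hC hI (hC2 0 0 1) p000 p111, p001]
    -- `(0,0)` has to belong to the relation implemented by eliminating the last coordinate, but it
    -- has one extension, whereas `(0,1)` has two
    have hmax := hΓ.has_rel2_max hR
    have h00 := hzeros hmax (rel2_max_nonempty p)
    simp only [rel2, Set.mem_ofPred_eq, decide_eq_true_eq] at h00
    have := h00 false true
    simp [cnt, p000, p001, p010, p011] at this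

/-- If `NEQ`, but no constant is available, and not all relations are affine, then all relations
closed under complementation are available. -/
theorem mem_of_pres_neg (hΓ : IsMaxCoclone Γ) (hN : NEQ ∈ Γ) (h0 : const false ∉ Γ)
    (hx : ∃ R ∈ Γ, ¬ Pres xor3 R.tuples) {S : BoolRel} (hS : Pres neg S.tuples) : S ∈ Γ := by
  have hC := hΓ.isConjClosed
  have hΔ : IsMaxCoclone (topSlice Γ) := by
    refine hΓ.topSlice fun {n R} hR ⟨a, ha⟩ => ?_
    cases hl : a (Fin.natAdd n 0)
    · have h2 := pres_neg.1 (neg_mem_of_NEQ hΓ hN h0 hR) a ha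
      rw [mem_iff_mem_slice, hl] at h2
      exact ⟨_, h2⟩
    · rw [mem_iff_mem_slice, hl] at ha
      exact ⟨_, ha⟩
  have hNΔ := hC.subset_topSlice hN
  have huniv : topSlice Γ = Set.univ := by
    refine eq_univ_of_NEQ hΔ hNΔ ?_
    by_contra! hc
    obtain ⟨R, hR, hR'⟩ := hx
    exact hR' (pres_xor3_of_const hΔ (const_mem_of_NEQ hΔ hNΔ hC.const_true_mem_topSlice)
      hc.1 hc.2.1 hc.2.2 (has_tuples.2 (hC.subset_topSlice hR)))
  obtain ⟨n, hn, S⟩ := S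
  obtain ⟨R, hR, hRS⟩ : (⟨n, hn, S⟩ : BoolRel) ∈ topSlice Γ := by
    rw [huniv]
    trivial
  change slice (n := n) R true = S at hRS
  change Pres neg S at hS
  have hneg := pres_neg.1 (neg_mem_of_NEQ hΓ hN h0 hR)
  refine (has_iff hn).1 ?_
  -- the last coordinate is identified with the first one
  convert hC.has_manip hR (Fin.append id fun _ : Fin 1 => (⟨0, hn⟩ : Fin n)) using 1
  have key : ∀ a : Fin n → Bool, (fun i => a (Fin.append id (fun _ : Fin 1 => (⟨0, hn⟩ : Fin n)) i))
      = Fin.append a fun _ => a ⟨0, hn⟩ := by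
    intro a
    funext i
    refine Fin.addCases (fun j => ?_) (fun j => ?_) i <;> simp
  ext a
  simp only [key, Set.mem_ofPred_eq]
  cases ha : a ⟨0, hn⟩
  · have h2 : (fun i => !a i) ∈ S ↔ a ∈ S :=
      ⟨fun h => by simpa using pres_neg.1 hS _ h, fun h => pres_neg.1 hS _ h⟩
    have h3 : (fun i => !(Fin.append a (fun _ : Fin 1 => false)) i) =
        Fin.append (fun i => !a i) fun _ => true := by
      funext i
      refine Fin.addCases (fun j => ?_) (fun j => ?_) i <;> simp
    have h4 : Fin.append (fun i => !a i) (fun _ : Fin 1 => true) ∈ R ↔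
        Fin.append a (fun _ => false) ∈ R := by
      rw [← h3]
      exact ⟨fun h => by simpa using hneg _ h, fun h => hneg _ h⟩
    rw [← h2, ← h4, ← hRS]
    rfl
  · rw [← hRS]
    rfl

end NoConstants

/-! ### Max-co-clones with disjunction -/

section Disjunction

variable {Γ : Set BoolRel}

/-- It is enough to check two patterns on ternary relations, as the tuples in question fall into
a ternary section of `R` by variables and the constant one. The pattern `hor` gives preservation by
`x ∨ y`, and `himp` leads from `a`, `a ∨ c` and `a ∨ b ∨ c` to `a ∨ (b ∧ ¬ c)`. -/
theorem pres_orDiff_of_ternary (hΓ : IsMaxCoclone Γ) (h1 : const true ∈ Γ)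
    (hor : ∀ p, Has Γ (rel3 p) → p false true false = true → p true false false = true →
      p true true false = true)
    (himp : ∀ p, Has Γ (rel3 p) → p false false false = true → p false true false = true →
      p true true false = true → p true false false = true)
    {n : ℕ} {R : Set (Fin n → Bool)} (hR : Has Γ R) : Pres orDiff R := by
  have hor' : ∀ a ∈ R, ∀ b ∈ R, (fun j => a j || b j) ∈ R := by
    intro a ha b hb
    let σ : Fin n → Fin 3 ⊕ Bool := fun i => if a i = true then
      (if b i = true then Sum.inr true else Sum.inl 0) else
      (if b i = true then Sum.inl 1 else Sum.inl 2)
    have h100 : (fun i => Sum.elim ![true, false, false] id (σ i)) = a := by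
      funext i
      simp only [σ]
      cases a i <;> cases b i <;> rfl
    have h010 : (fun i => Sum.elim ![false, true, false] id (σ i)) = b := by
      funext i
      simp only [σ]
      cases a i <;> cases b i <;> rfl
    have h110 : (fun i => Sum.elim ![true, true, false] id (σ i)) = fun i => a i || b i := by
      funext i
      simp only [σ]
      cases a i <;> cases b i <;> rfl
    obtain ⟨p, hp, hpR⟩ := hΓ.has_rel3_section hR σ (fun i c => by
      simp only [σ]
      split_ifs <;> rintro ⟨⟩
      exact h1) true false false (by rwa [h100])
    rw [← h110, ← hpR]
    exact hor p hp (by rwa [hpR, h010]) (by rwa [hpR, h100])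
  rw [pres_orDiff]
  intro a ha b hb c hc
  let σ : Fin n → Fin 3 ⊕ Bool := fun i => if a i = true then Sum.inr true else
    if c i = true then Sum.inl 1 else if b i = true then Sum.inl 0 else Sum.inl 2
  have h000 : (fun i => Sum.elim ![false, false, false] id (σ i)) = a := by
    funext i
    simp only [σ]
    cases a i <;> cases b i <;> cases c i <;> rfl
  have h010 : (fun i => Sum.elim ![false, true, false] id (σ i)) = fun i => a i || c i := by
    funext i
    simp only [σ]
    cases a i <;> cases b i <;> cases c i <;> rfl
  have h110 : (fun i => Sum.elim ![true, true, false] id (σ i)) =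
      fun i => (a i || c i) || b i := by
    funext i
    simp only [σ]
    cases a i <;> cases b i <;> cases c i <;> rfl
  have h100 : (fun i => Sum.elim ![true, false, false] id (σ i)) =
      fun i => a i || (b i && !c i) := by
    funext i
    simp only [σ]
    cases a i <;> cases b i <;> cases c i <;> rfl
  obtain ⟨p, hp, hpR⟩ := hΓ.has_rel3_section hR σ (fun i c => by
    simp only [σ]
    split_ifs <;> rintro ⟨⟩
    exact h1) false false false (by rwa [h000])
  rw [← h100, ← hpR]
  refine himp p hp (by rwa [hpR, h000]) ?_ ?_
  · rw [hpR, h010]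
    exact hor' a ha c hc
  · rw [hpR, h110]
    exact hor' _ (hor' a ha c hc) b hb

/-- With both constants available, the third argument of the ternary patterns is set to zero, and
a violated pattern is `NEQ`, `NAND` or `IMP`. -/
theorem pres_orDiff_of_const (hΓ : IsMaxCoclone Γ) (hc : ∀ c, const c ∈ Γ) (hI : IMP ∉ Γ)
    (hA : NAND 2 Nat.two_pos ∉ Γ) (hN : NEQ ∉ Γ) {n : ℕ} {R : Set (Fin n → Bool)}
    (hR : Has Γ R) : Pres orDiff R := by
  rw [IMP_mem_iff] at hI
  rw [NAND_two_mem_iff] at hA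
  rw [NEQ_mem_iff] at hN
  have hsec : ∀ p, Has Γ (rel3 p) → p false true false = true →
      Has Γ (rel2 fun x y => p x y false) := by
    intro p hp h
    obtain ⟨q, hq, hqp⟩ := hΓ.has_rel2_section hp ![Sum.inl 0, Sum.inl 1, Sum.inr false]
      (fun _ c _ => hc c) false true h
    convert hq using 2
    funext x y
    rw [Bool.eq_iff_iff, hqp]
    rfl
  refine pres_orDiff_of_ternary hΓ (hc _) (fun p hp h01 h10 => ?_)
    (fun p hp h00 h01 h11 => ?_) hR
  · by_contra h11
    have hq := hsec p hp h01
    cases h00 : p false false false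
    · refine hN (cast ?_ hq)
      congr 2
      apply fun_eq_of_values <;> simp_all
    · refine hA (cast ?_ hq)
      congr 2
      apply fun_eq_of_values <;> simp_all
  · by_contra h10
    refine hI (cast ?_ (hsec p hp h01))
    congr 2
    apply fun_eq_of_values <;> simp_all

/-- The constant zero is not available, but all nonempty relations contain the tuple of ones.
Counting with respect to this tuple turns a violation of one of the ternary patterns into an
implementation of `IMP`. -/
theorem pres_orDiff_of_const_true (hΓ : IsMaxCoclone Γ) (h1 : const true ∈ Γ)
    (h0 : const false ∉ Γ) (hO : OR 2 Nat.two_pos ∈ Γ) {n : ℕ} {R : Set (Fin n → Bool)}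
    (hR : Has Γ R) : Pres orDiff R := by
  have hC := hΓ.isConjClosed
  have hI : IMP ∉ Γ := fun h => h0 (const_mem_of_IMP hΓ h _)
  rw [OR_two_mem_iff] at hO
  have hI' := fun {q} => eq_of_IMP_notMem (q := q) hC hI
  rw [IMP_mem_iff] at hI
  have h111 : ∀ p, Has Γ (rel3 p) → p false true false = true → p true true true = true :=
    fun p hp h => true_mem_of_const hΓ h1 h0 hp ⟨![false, true, false], h⟩
  refine pres_orDiff_of_ternary hΓ h1 (fun p hp p010 p100 => ?_)
    (fun p hp p000 p010 p110 => ?_) hR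
  · by_contra p110
    have p111 := h111 p hp p010
    -- `(1,1)` belongs to the relation implemented by eliminating the last coordinate, hence no
    -- tuple has more extensions than the single one of `(1,1)`
    have hmax : ∀ x y, cnt (p x y) ≤ cnt (p true true) := by
      have h2 := true_mem_of_const hΓ h1 h0 (hΓ.has_rel2_max hp) (rel2_max_nonempty p)
      simpa [rel2] using h2
    have p011 : p false true true = false := by
      by_contra hc
      have := hmax false true
      simp_all [cnt]
    have p101 : p true false true = false := by
      by_contra hc
      have := hmax true false
      simp_all [cnt]
    -- eliminating `y` from `p x y z ∧ (x ∨ y)` leaves the implication `z → x`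
    have h3 : Has Γ (rel3 fun x z y => p x y z && (x || y)) := by
      simpa [rel3] using hC.has_and (hC.has_rel3_comp hp (0 : Fin 3) 2 1)
        (hC.has_rel2_comp hO (0 : Fin 3) 2)
    refine hI (cast ?_ (hC.has_rel2_swap (hΓ.has_rel2_max h3)))
    congr 2
    apply fun_eq_of_values <;> simp_all [cnt]
  · by_contra p100
    have p111 := h111 p hp p010
    have p101 : p true false true = true := by
      rw [← hI' (q := fun x y => p x y x) (hC.has_rel3_comp hp 0 1 0) p000 p111, p010]
    have p001 : p false false true = true := by
      rw [hI' (q := fun x y => p x x y) (hC.has_rel3_comp hp 0 0 1) p000 p111, p110]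
    have p011 : p false true true = true := by
      obtain ⟨q, hq, hqp⟩ := hΓ.has_rel2_section hp ![Sum.inl 0, Sum.inl 1, Sum.inr true]
        (fun i c => by fin_cases i <;> rintro ⟨⟩; exact h1) true true p111
      have h2 := hI' hq ((hqp _ _).2 p001) ((hqp _ _).2 p111)
      rw [(hqp true false).2 p101] at h2
      exact (hqp _ _).1 h2
    -- eliminating the last coordinate leaves the implication `x → y`
    refine hI (cast ?_ (hΓ.has_rel2_max hp))
    congr 2
    apply fun_eq_of_values <;> simp_all [cnt]

end Disjunction

end BoolRel

namespace BoolRel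

/-! ### The listed classes as classes of invariant relations -/

theorem dual_xor3 : xor3.dual = xor3 := by
  simp only [Op.dual, xor3]
  congr 1
  funext x
  cases x 0 <;> cases x 1 <;> cases x 2 <;> rfl

theorem dual_maj : maj.dual = maj := by
  simp only [Op.dual, maj]
  congr 1
  funext x
  cases x 0 <;> cases x 1 <;> cases x 2 <;> rfl

theorem dual_and2 : and2.dual = or2 := by
  simp [Op.dual, and2, or2]

theorem dual_or2 : or2.dual = and2 := by
  simp [Op.dual, and2, or2]

theorem dual_neg : neg.dual = neg := by
  simp [Op.dual, neg]

theorem dual_cst (c : Bool) : (cst c).dual = cst (!c) := by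
  simp [Op.dual, cst]

@[simp] theorem Op.dual_dual (f : Op) : f.dual.dual = f := by
  simp [Op.dual]

end BoolRel

namespace PostNode

/-- Operations whose common invariant relations form the co-clone of the given name. -/
def ops : PostNode → Set Op
  | IBF => {xor3, maj, cst false, cst true}
  | IR0 => {xor3, maj, cst false}
  | IR1 => {xor3, maj, cst true}
  | IR2 => {xor3, maj, and2, or2}
  | IM2 => {and2, or2}
  | IS0k r => {orDiff, twoOf (r + 2), cst true}
  | IS0 => {orDiff, cst true}
  | IS1k r => Op.dual '' {orDiff, twoOf (r + 2), cst true}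
  | IS1 => Op.dual '' {orDiff, cst true}
  | IS02k r => {orDiff, twoOf (r + 2)}
  | IS02 => {orDiff}
  | IS12k r => Op.dual '' {orDiff, twoOf (r + 2)}
  | IS12 => Op.dual '' {orDiff}
  | ID => {xor3, maj, neg}
  | ID1 => {xor3, maj}
  | IL => {xor3, cst false, cst true}
  | IL0 => {xor3, cst false}
  | IL1 => {xor3, cst true}
  | IL2 => {xor3}
  | IL3 => {xor3, neg}
  | IN2 => {neg}
  | II2 => ∅

/-- The relations preserved by the operations of the node. -/
def sem (ν : PostNode) : Set BoolRel := Inv ν.ops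

/-- The reflection of the diagram which exchanges the constants. -/
def dual : PostNode → PostNode
  | IR0 => IR1
  | IR1 => IR0
  | IS0k r => IS1k r
  | IS0 => IS1
  | IS1k r => IS0k r
  | IS1 => IS0
  | IS02k r => IS12k r
  | IS02 => IS12
  | IS12k r => IS02k r
  | IS12 => IS02
  | IL0 => IL1
  | IL1 => IL0
  | ν => ν

@[simp] theorem dual_dual (ν : PostNode) : ν.dual.dual = ν := by
  cases ν <;> rfl

theorem ops_dual (ν : PostNode) : ν.dual.ops = Op.dual '' ν.ops := by
  cases ν <;> simp only [dual, ops, Set.image_insert_eq, Set.image_singleton, dual_xor3, dual_maj,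
    dual_and2, dual_or2, dual_neg, dual_cst, Op.dual_dual, Bool.not_true, Bool.not_false,
    Set.image_empty]
  · rw [Set.pair_comm (cst true)]
  · rw [Set.pair_comm or2]
  · rw [Set.pair_comm or2]
  · rw [Set.pair_comm (cst true)]

theorem sem_dual (ν : PostNode) : ν.dual.sem = dualClass ν.sem := by
  rw [sem, ops_dual, Inv_image_dual]
  rfl

theorem isCoclone_sem (ν : PostNode) : IsCoclone ν.sem := isCoclone_Inv _

/-- The node stands for a class of affine relations. -/
def Affine (ν : PostNode) : Prop := xor3 ∈ ν.ops

theorem pres_xor3_of_mem_sem {ν : PostNode} (hν : ν.Affine) {R : BoolRel} (hR : R ∈ ν.sem) :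
    Pres xor3 R.tuples := hR _ hν

theorem isMaxCoclone_sem_of_affine {ν : PostNode} (hν : ν.Affine) : IsMaxCoclone ν.sem :=
  (isMaxCoclone_iff_isCoclone_of_affine fun _ => pres_xor3_of_mem_sem hν).2 ν.isCoclone_sem

theorem isMaxCoclone_sem_of_orDiff {ν : PostNode} (hν : orDiff ∈ ν.ops)
    (h : ∀ f ∈ ν.ops, f = orDiff ∨ (∃ k, f = twoOf (k + 2)) ∨ f = cst true) :
    IsMaxCoclone ν.sem := by
  refine isMaxCoclone_Inv_of_orDiff hν fun f hf => ?_
  rcases h f hf with rfl | ⟨k, rfl⟩ | rfl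
  · right
    decide
  · right
    intro c
    cases c
    · simp [twoOf]
    · simp only [twoOf, decide_eq_true_eq]
      exact ⟨(0 : Fin (k + 2 + 1)), (1 : Fin (k + 2 + 1)), by simp, trivial, trivial⟩
  · exact Or.inl rfl

theorem isMaxCoclone_sem_dual {ν : PostNode} (h : IsMaxCoclone ν.sem) :
    IsMaxCoclone ν.dual.sem := by
  rw [sem_dual]
  exact h.dualClass

theorem isMaxCoclone_sem_IM2 : IsMaxCoclone IM2.sem := by
  have hC := IM2.isCoclone_sem
  refine ⟨hC.eq, hC.manip, hC.conj, fun n m hn hnm R hR => ?_⟩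
  have := pres_maxImpl_of_lattice (R := R) (hR _ (by simp [ops])) (hR _ (by simp [ops]))
  intro f hf
  simp only [ops, Set.mem_insert_iff, Set.mem_singleton_iff] at hf
  rcases hf with rfl | rfl
  · exact this.1
  · exact this.2

theorem mem_sem_IN2 {R : BoolRel} : R ∈ IN2.sem ↔ Pres neg R.tuples := by
  simp [sem, BoolRel.Inv, ops]

/-- Complementation of all variables is a symmetry of the number of extensions. -/
theorem isMaxCoclone_sem_IN2 : IsMaxCoclone IN2.sem := by
  have hC := IN2.isCoclone_sem
  have key : ∀ {n : ℕ} {R : Set (Fin n → Bool)}, Pres neg R ↔ dualSet R = R := by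
    intro n R
    rw [pres_neg]
    constructor
    · intro h
      ext a
      exact ⟨fun ha => by simpa using h _ ha, fun ha => h a ha⟩
    · intro h a ha
      rw [← h] at ha
      exact ha
  refine ⟨hC.eq, hC.manip, hC.conj, fun n m hn hnm R hR => ?_⟩
  rw [mem_sem_IN2] at hR ⊢
  change Pres neg R at hR
  change Pres neg (maxImpl R)
  rw [key] at hR ⊢
  rw [dualSet_maxImpl, hR]

theorem sem_II2 : II2.sem = Set.univ := by
  simp [sem, BoolRel.Inv, ops]

/-- Each listed class is closed under max-implementation. -/
theorem isMaxCoclone_sem (ν : PostNode) : IsMaxCoclone ν.sem := by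
  have h02k : ∀ r, IsMaxCoclone (IS02k r).sem := fun r =>
    isMaxCoclone_sem_of_orDiff (by simp [ops]) fun f hf => by
      rcases hf with rfl | rfl
      exacts [Or.inl rfl, Or.inr (Or.inl ⟨r, rfl⟩)]
  have h02 : IsMaxCoclone IS02.sem := isMaxCoclone_sem_of_orDiff (by simp [ops]) (by simp [ops])
  have h0k : ∀ r, IsMaxCoclone (IS0k r).sem := fun r =>
    isMaxCoclone_sem_of_orDiff (by simp [ops]) fun f hf => by
      rcases hf with rfl | rfl | rfl
      exacts [Or.inl rfl, Or.inr (Or.inl ⟨r, rfl⟩), Or.inr (Or.inr rfl)]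
  have h0 : IsMaxCoclone IS0.sem := isMaxCoclone_sem_of_orDiff (by simp [ops]) (by simp [ops])
  cases ν
  case IM2 => exact isMaxCoclone_sem_IM2
  case IN2 => exact isMaxCoclone_sem_IN2
  case II2 =>
    rw [sem_II2]
    constructor <;> intros <;> trivial
  case IS0k r => exact h0k r
  case IS0 => exact h0
  case IS02k r => exact h02k r
  case IS02 => exact h02
  case IS1k r => exact isMaxCoclone_sem_dual (h0k r)
  case IS1 => exact isMaxCoclone_sem_dual h0
  case IS12k r => exact isMaxCoclone_sem_dual (h02k r)
  case IS12 => exact isMaxCoclone_sem_dual h02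
  all_goals exact isMaxCoclone_sem_of_affine (by simp [Affine, ops])

/-! ### Probes: relations which tell the listed classes apart -/

/-- Names for some nonempty relations; the parameter `r` stands for the arity `r + 2`. -/
inductive Probe where
  | zero | one | neq | imp | xor4 | nae | disj (r : ℕ) | nand (r : ℕ)

namespace Probe

/-- The relation with the given name. -/
def rel : Probe → BoolRel
  | zero => const false
  | one => const true
  | neq => NEQ
  | imp => IMP
  | xor4 => XOR 4 (by norm_num) 0
  | nae => Compl 3 0 (by norm_num)
  | disj r => OR (r + 2) (Nat.succ_pos _)
  | nand r => NAND (r + 2) (Nat.succ_pos _)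

/-- Exchange of the two constants. -/
def dual : Probe → Probe
  | zero => one
  | one => zero
  | disj r => nand r
  | nand r => disj r
  | p => p

@[simp] theorem dual_dual (p : Probe) : p.dual.dual = p := by
  cases p <;> rfl

theorem rel_nae : rel nae =
    ⟨3, by norm_num, rel3 fun x y z => (x || y || z) && (!x || !y || !z)⟩ := by
  have h : {a : Fin (3 + 0) → Bool |
      a ≠ Fin.append (fun _ : Fin 3 => false) (fun _ : Fin 0 => true) ∧
      a ≠ Fin.append (fun _ : Fin 3 => true) (fun _ : Fin 0 => false)} =
      rel3 fun x y z => (x || y || z) && (!x || !y || !z) := by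
    ext a
    simp only [rel3, Set.mem_ofPred_eq]
    revert a
    decide
  exact congrArg (BoolRel.mk 3 _) h

theorem nae_mem_iff {Γ : Set BoolRel} : nae.rel ∈ Γ ↔
    Has Γ (rel3 fun x y z => (x || y || z) && (!x || !y || !z)) := by
  rw [rel_nae, has_iff]

theorem xor4_mem_iff {Γ : Set BoolRel} : xor4.rel ∈ Γ ↔ Has Γ (lin 4 0) :=
  (has_iff (by norm_num)).symm

theorem rel_nonempty (p : Probe) : p.rel.tuples.Nonempty := by
  cases p with
  | zero => exact ⟨fun _ => false, rfl⟩
  | one => exact ⟨fun _ => true, rfl⟩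
  | neq => exact ⟨![false, true], Bool.false_ne_true⟩
  | imp => exact ⟨fun _ => false, Or.inl rfl⟩
  | xor4 => exact ⟨fun _ => false, by change ∑ _ : Fin 4, toGF false = 0; simp [toGF]⟩
  | nae =>
    rw [rel_nae]
    exact ⟨![false, true, true], rfl⟩
  | disj r => exact ⟨fun _ => true, fun h => by simpa using congrFun h (0 : Fin (r + 2))⟩
  | nand r => exact ⟨fun _ => false, fun h => by simpa using congrFun h (0 : Fin (r + 2))⟩

theorem rel_mem_dualClass {Γ : Set BoolRel} (hΓ : IsConjClosed Γ) (p : Probe) :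
    p.rel ∈ dualClass Γ ↔ p.dual.rel ∈ Γ := by
  have h2 : ∀ {q : Bool → Bool → Bool},
      dualSet (rel2 q) = rel2 fun x y => q (!x) (!y) := fun {q} => rfl
  cases p with
  | zero => exact const_mem_dualClass
  | one => exact const_mem_dualClass
  | neq => exact NEQ_mem_dualClass
  | imp =>
    change IMP ∈ _ ↔ IMP ∈ _
    rw [IMP_mem_iff, IMP_mem_iff, has_dualClass, h2]
    have : ∀ q : Bool → Bool → Bool, Has Γ (rel2 q) ↔ Has Γ (rel2 fun x y => q y x) :=
      fun q => ⟨fun h => hΓ.has_rel2_swap h, fun h => hΓ.has_rel2_swap h⟩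
    rw [this]
    simp [Bool.or_comm]
  | xor4 =>
    change xor4.rel ∈ _ ↔ xor4.rel ∈ _
    rw [xor4_mem_iff, xor4_mem_iff, has_dualClass]
    have : dualSet (lin 4 0) = lin 4 0 := by
      have h4 : (4 : ZMod 2) = 0 := rfl
      ext a
      simp [dualSet, lin, toGF_not, Finset.sum_add_distrib, h4]
    rw [this]
  | nae =>
    change nae.rel ∈ _ ↔ nae.rel ∈ _
    rw [nae_mem_iff, nae_mem_iff, has_dualClass]
    have : dualSet (rel3 fun x y z => (x || y || z) && (!x || !y || !z)) =
        rel3 fun x y z => (x || y || z) && (!x || !y || !z) := by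
      ext a
      simp [dualSet, rel3, and_comm]
    rw [this]
  | disj r =>
    change BoolRel.dual (OR (r + 2) _) ∈ Γ ↔ NAND (r + 2) _ ∈ Γ
    rw [dual_OR]
  | nand r =>
    change BoolRel.dual (NAND (r + 2) _) ∈ Γ ↔ OR (r + 2) _ ∈ Γ
    rw [dual_NAND]

end Probe

open Probe

/-- The probes in the class of a node. -/
def probes : PostNode → Set Probe
  | IBF => ∅
  | IR0 => {zero}
  | IR1 => {one}
  | IR2 => {zero, one}
  | IM2 => {zero, one, imp}
  | IS0k r => {one} ∪ disj '' Set.Iic r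
  | IS0 => {one} ∪ Set.range disj
  | IS1k r => {zero} ∪ nand '' Set.Iic r
  | IS1 => {zero} ∪ Set.range nand
  | IS02k r => {zero, one} ∪ disj '' Set.Iic r
  | IS02 => {zero, one} ∪ Set.range disj
  | IS12k r => {zero, one} ∪ nand '' Set.Iic r
  | IS12 => {zero, one} ∪ Set.range nand
  | ID => {neq}
  | ID1 => {zero, one, neq}
  | IL => {xor4}
  | IL0 => {zero, xor4}
  | IL1 => {one, xor4}
  | IL2 => {zero, one, neq, xor4}
  | IL3 => {neq, xor4}
  | IN2 => {neq, xor4, nae}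
  | II2 => Set.univ

theorem dual_mem_probes {ν : PostNode} {p : Probe} : p.dual ∈ ν.dual.probes ↔ p ∈ ν.probes := by
  cases ν <;> cases p <;> simp [dual, probes, Probe.dual]

end PostNode

namespace PostNode

open Probe

/-! ### The probes in the listed classes -/

theorem pres_probe_iff {f : Op} {p : Probe} : Pres f p.rel.tuples ↔ p.rel ∈ BoolRel.Inv {f} := by
  simp [BoolRel.Inv]

theorem pres_dual_probe {f : Op} {p : Probe} :
    Pres f.dual p.rel.tuples ↔ Pres f p.dual.rel.tuples := by
  rw [pres_probe_iff, pres_probe_iff,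
    ← rel_mem_dualClass (isCoclone_Inv _).isConjClosed, ← Inv_image_dual, Set.image_singleton]

theorem pres_zero_iff {f : Op} : Pres f (rel zero).tuples ↔ f.fn (fun _ => false) = false :=
  pres_const_iff

theorem pres_one_iff {f : Op} : Pres f (rel one).tuples ↔ f.fn (fun _ => true) = true :=
  pres_const_iff

theorem pres_neq_iff {f : Op} : Pres f (rel neq).tuples ↔ ∀ x, f.fn (fun i => !x i) = !f.fn x :=
  pres_NEQ_iff

theorem pres_imp_iff {f : Op} : Pres f (rel imp).tuples ↔ Pres f (rel2 fun x y => !x || y) := by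
  rw [pres_probe_iff, show rel imp = IMP from rfl, IMP_mem_iff, has_Inv Nat.two_pos]
  simp

theorem pres_xor4_iff {f : Op} : Pres f (rel xor4).tuples ↔ Pres f (lin 4 0) := Iff.rfl

theorem pres_nae_iff {f : Op} : Pres f (rel nae).tuples ↔
    Pres f (rel3 fun x y z => (x || y || z) && (!x || !y || !z)) := by
  rw [rel_nae]

theorem pres_or_two {f : Op} {r : ℕ} (h : Pres f (rel (disj r)).tuples) :
    Pres f (rel2 fun x y => x || y) := by
  rw [pres_probe_iff] at h
  have := (isCoclone_Inv {f}).isConjClosed.has_OR_of_le (hl := Nat.two_pos) h (by omega)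
  rw [OR_two_mem_iff, has_Inv Nat.two_pos] at this
  simpa using this

theorem pres_nand_two {f : Op} {r : ℕ} (h : Pres f (rel (nand r)).tuples) :
    Pres f.dual (rel2 fun x y => x || y) :=
  pres_or_two (r := r) (pres_dual_probe.2 h)

instance {q : Bool → Bool → Bool} : DecidablePred (· ∈ rel2 q) :=
  fun a => inferInstanceAs (Decidable (q (a 0) (a 1) = true))

instance {p : Bool → Bool → Bool → Bool} : DecidablePred (· ∈ rel3 p) :=
  fun a => inferInstanceAs (Decidable (p (a 0) (a 1) (a 2) = true))

instance : DecidablePred (· ∈ lin 4 0) :=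
  fun a => inferInstanceAs (Decidable (∑ i : Fin 4, toGF (a i) = 0))

theorem pres_xor3_probe (p : Probe) :
    Pres xor3 p.rel.tuples ↔ p ∈ ({zero, one, neq, xor4} : Set Probe) := by
  cases p with
  | zero => exact iff_of_true (pres_zero_iff.2 rfl) (by simp)
  | one => exact iff_of_true (pres_one_iff.2 rfl) (by simp)
  | neq => exact iff_of_true (pres_neq_iff.2 (by decide)) (by simp)
  | imp =>
    refine iff_of_false ?_ (by simp)
    rw [pres_imp_iff, pres_xor3]
    decide
  | xor4 => exact iff_of_true pres_xor3_XOR (by simp)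
  | nae =>
    refine iff_of_false ?_ (by simp)
    rw [pres_nae_iff, pres_xor3]
    exact fun h => absurd (h ![true, false, false] rfl ![false, true, false] rfl
      ![false, false, true] rfl) (by decide)
  | disj r =>
    refine iff_of_false (fun h => absurd (pres_or_two h) ?_) (by simp)
    rw [pres_xor3]
    decide
  | nand r =>
    refine iff_of_false (fun h => absurd (pres_nand_two h) ?_) (by simp)
    rw [dual_xor3, pres_xor3]
    decide

theorem pres_and2_probe (p : Probe) :
    Pres and2 p.rel.tuples ↔ p ∈ ({zero, one, imp} ∪ Set.range nand : Set Probe) := by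
  cases p with
  | zero => exact iff_of_true (pres_zero_iff.2 rfl) (by simp)
  | one => exact iff_of_true (pres_one_iff.2 rfl) (by simp)
  | neq => exact iff_of_false (fun h => absurd (pres_neq_iff.1 h) (by decide)) (by simp)
  | imp =>
    refine iff_of_true ?_ (by simp)
    rw [pres_imp_iff, pres_and2]
    decide
  | xor4 =>
    refine iff_of_false ?_ (by simp)
    rw [pres_xor4_iff, pres_and2]
    exact fun h => absurd (h ![true, true, false, false] (by decide) ![true, false, true, false]
      (by decide)) (by decide)
  | nae =>
    refine iff_of_false ?_ (by simp)
    rw [pres_nae_iff, pres_and2]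
    exact fun h => absurd (h ![true, false, false] rfl ![false, true, false] rfl) (by decide)
  | disj r =>
    refine iff_of_false (fun h => absurd (pres_or_two h) ?_) (by simp)
    rw [pres_and2]
    decide
  | nand r =>
    refine iff_of_true (pres_and2.2 fun a ha b _ h => ha ?_) (by simp)
    funext i
    have := congrFun h i
    simp only [Bool.and_eq_true] at this
    exact this.1

theorem pres_or2_probe (p : Probe) :
    Pres or2 p.rel.tuples ↔ p ∈ ({zero, one, imp} ∪ Set.range disj : Set Probe) := by
  rw [← dual_and2, pres_dual_probe, pres_and2_probe]
  cases p <;> simp [Probe.dual]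

theorem pres_neg_probe (p : Probe) :
    Pres neg p.rel.tuples ↔ p ∈ ({neq, xor4, nae} : Set Probe) := by
  cases p with
  | zero => exact iff_of_false (fun h => absurd (pres_zero_iff.1 h) (by decide)) (by simp)
  | one => exact iff_of_false (fun h => absurd (pres_one_iff.1 h) (by decide)) (by simp)
  | neq => exact iff_of_true (pres_neq_iff.2 (by decide)) (by simp)
  | imp =>
    refine iff_of_false ?_ (by simp)
    rw [pres_imp_iff, pres_neg]
    decide
  | xor4 => exact iff_of_true (pres_neg_XOR_iff.2 (by decide)) (by simp)
  | nae =>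
    refine iff_of_true ?_ (by simp)
    rw [pres_nae_iff, pres_neg]
    decide
  | disj r =>
    refine iff_of_false (fun h => absurd (pres_or_two h) ?_) (by simp)
    rw [pres_neg]
    decide
  | nand r =>
    refine iff_of_false (fun h => absurd (pres_nand_two h) ?_) (by simp)
    rw [dual_neg, pres_neg]
    decide

theorem pres_one_probe (p : Probe) :
    Pres (cst true) p.rel.tuples ↔ p ∈ ({one, imp, xor4} ∪ Set.range disj : Set Probe) := by
  cases p with
  | zero => exact iff_of_false (fun h => absurd (pres_zero_iff.1 h) (by decide)) (by simp)
  | one => exact iff_of_true (pres_one_iff.2 rfl) (by simp)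
  | neq => exact iff_of_false (fun h => absurd (pres_neq_iff.1 h) (by decide)) (by simp)
  | imp =>
    refine iff_of_true ?_ (by simp)
    rw [pres_imp_iff, pres_cst]
    decide
  | xor4 => exact iff_of_true (pres_one_XOR_iff.2 rfl) (by simp)
  | nae =>
    refine iff_of_false ?_ (by simp)
    rw [pres_nae_iff, pres_cst]
    decide
  | disj r => exact iff_of_true pres_one_OR (by simp)
  | nand r =>
    refine iff_of_false (fun h => absurd (pres_nand_two h) ?_) (by simp)
    rw [dual_cst, pres_cst]
    decide

theorem pres_zero_probe (p : Probe) :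
    Pres (cst false) p.rel.tuples ↔ p ∈ ({zero, imp, xor4} ∪ Set.range nand : Set Probe) := by
  rw [show cst false = (cst true).dual from (dual_cst true).symm, pres_dual_probe, pres_one_probe]
  cases p <;> simp [Probe.dual]

theorem pres_maj_probe {p : Probe} (hp : p ∈ ({zero, one, neq, xor4} : Set Probe)) :
    Pres maj p.rel.tuples ↔ p ≠ xor4 := by
  rcases hp with rfl | rfl | rfl | rfl
  · exact iff_of_true (pres_zero_iff.2 rfl) (by simp)
  · exact iff_of_true (pres_one_iff.2 rfl) (by simp)
  · exact iff_of_true (pres_neq_iff.2 (by decide)) (by simp)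
  · refine iff_of_false ?_ (by simp)
    rw [pres_xor4_iff, pres_maj]
    exact fun h => absurd (h ![true, true, false, false] (by decide) ![true, false, true, false]
      (by decide) ![true, false, false, true] (by decide)) (by decide)

theorem pres_orDiff_probe (p : Probe) :
    Pres orDiff p.rel.tuples ↔ p ∈ ({zero, one} ∪ Set.range disj : Set Probe) := by
  cases p with
  | zero => exact iff_of_true (pres_zero_iff.2 rfl) (by simp)
  | one => exact iff_of_true (pres_one_iff.2 rfl) (by simp)
  | neq => exact iff_of_false (fun h => absurd (pres_neq_iff.1 h) (by decide)) (by simp)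
  | imp =>
    refine iff_of_false ?_ (by simp)
    rw [pres_imp_iff, pres_orDiff]
    decide
  | xor4 =>
    refine iff_of_false ?_ (by simp)
    rw [pres_xor4_iff, pres_orDiff]
    exact fun h => absurd (h ![false, false, false, false] (by decide)
      ![true, true, false, false] (by decide) ![true, false, true, false] (by decide)) (by decide)
  | nae =>
    refine iff_of_false ?_ (by simp)
    rw [pres_nae_iff, pres_orDiff]
    exact fun h => absurd (h ![true, false, false] rfl ![false, true, true] rfl
      ![true, false, false] rfl) (by decide)
  | disj r => exact iff_of_true pres_orDiff_OR (by simp)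
  | nand r =>
    refine iff_of_false (fun h => absurd (pres_nand_two h) ?_) (by simp)
    intro h
    exact absurd (h ![![true, false], ![false, true], ![true, true]]
      (by intro i; fin_cases i <;> rfl)) (by decide)

theorem pres_twoOf_probe {k : ℕ} {p : Probe} (hp : p ∈ ({zero, one} ∪ Set.range disj : Set Probe)) :
    Pres (twoOf (k + 2)) p.rel.tuples ↔ p ∈ ({zero, one} ∪ disj '' Set.Iic k : Set Probe) := by
  rcases hp with (rfl | rfl) | ⟨r, rfl⟩
  · exact iff_of_true (pres_zero_iff.2 (by simp [twoOf])) (by simp)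
  · refine iff_of_true (pres_one_iff.2 ?_) (by simp)
    rw [twoOf, decide_eq_true_eq]
    exact ⟨(0 : Fin (k + 2 + 1)), (1 : Fin (k + 2 + 1)), by simp, rfl, rfl⟩
  · have : disj r ∈ ({zero, one} ∪ disj '' Set.Iic k : Set Probe) ↔ r ≤ k := by simp
    rw [this]
    constructor
    · intro h
      by_contra hc
      exact not_pres_twoOf_OR (by omega) h
    · exact fun h => pres_twoOf_OR (by omega)

theorem rel_mem_sem_dual {ν : PostNode} {p : Probe} : p.rel ∈ ν.dual.sem ↔ p.dual.rel ∈ ν.sem := by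
  rw [sem_dual, rel_mem_dualClass ν.isCoclone_sem.isConjClosed]

/-- The table `probes` is correct: each probe is tested against the operations of the node. -/
theorem rel_mem_sem_iff {ν : PostNode} {p : Probe} : p.rel ∈ ν.sem ↔ p ∈ ν.probes := by
  have hdual : ∀ {μ : PostNode}, (p.dual.rel ∈ μ.sem ↔ p.dual ∈ μ.probes) →
      (p.rel ∈ μ.dual.sem ↔ p ∈ μ.dual.probes) := by
    intro μ h
    rw [rel_mem_sem_dual, h, ← dual_mem_probes, Probe.dual_dual]
  have hmem : ∀ (μ : PostNode) (p : Probe), p.rel ∈ μ.sem ↔ ∀ f ∈ μ.ops, Pres f p.rel.tuples :=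
    fun _ _ => Iff.rfl
  have h0k : ∀ r p, p.rel ∈ (IS0k r).sem ↔ p ∈ (IS0k r).probes := by
    intro r p
    cases p <;> simp [hmem, ops, probes, pres_orDiff_probe, pres_twoOf_probe, pres_one_probe]
  have h0 : ∀ p, p.rel ∈ IS0.sem ↔ p ∈ IS0.probes := by
    intro p
    cases p <;> simp [hmem, ops, probes, pres_orDiff_probe, pres_one_probe]
  have h02k : ∀ r p, p.rel ∈ (IS02k r).sem ↔ p ∈ (IS02k r).probes := by
    intro r p
    cases p <;> simp [hmem, ops, probes, pres_orDiff_probe, pres_twoOf_probe]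
  have h02 : ∀ p, p.rel ∈ IS02.sem ↔ p ∈ IS02.probes := by
    intro p
    cases p <;> simp [hmem, ops, probes, pres_orDiff_probe]
  cases ν
  case IS0k r => exact h0k r p
  case IS0 => exact h0 p
  case IS02k r => exact h02k r p
  case IS02 => exact h02 p
  case IS1k r => exact hdual (h0k r _)
  case IS1 => exact hdual (h0 _)
  case IS12k r => exact hdual (h02k r _)
  case IS12 => exact hdual (h02 _)
  all_goals cases p <;> simp [hmem, ops, probes, pres_xor3_probe, pres_maj_probe, pres_and2_probe,
    pres_or2_probe, pres_neg_probe, pres_one_probe, pres_zero_probe]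

theorem mem_probes_of_rel_mem {ν : PostNode} {p : Probe} (h : p.rel ∈ withEmpty ν.sem) :
    p ∈ ν.probes :=
  rel_mem_sem_iff.1 (h.resolve_right p.rel_nonempty.ne_empty)

/-! ### Recovering a listed class from its probes -/

theorem neq_or_consts_of_not_constValid {ν : PostNode} (h : ¬ ν.ConstValid) :
    neq ∈ ν.probes ∨ zero ∈ ν.probes ∧ one ∈ ν.probes := by
  cases ν <;> simp [ConstValid, probes] at h ⊢

theorem exists_cst_mem_ops {ν : PostNode} (h : ν.ConstValid) : ∃ c, cst c ∈ ν.ops := by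
  cases ν
  case IBF | IR0 | IL | IL0 => exact ⟨false, by simp [ops]⟩
  case IR1 | IL1 | IS0k | IS0 => exact ⟨true, by simp [ops]⟩
  case IS1k => exact ⟨false, cst true, by simp, dual_cst true⟩
  case IS1 => exact ⟨false, cst true, by simp, dual_cst true⟩
  all_goals exact h.elim

theorem nonempty_of_constValid {ν : PostNode} (h : ν.ConstValid) {R : BoolRel} (hR : R ∈ ν.sem) :
    R.tuples.Nonempty := by
  obtain ⟨c, hc⟩ := exists_cst_mem_ops h
  exact ⟨_, pres_cst.1 (hR _ hc)⟩

theorem has_empty_of_probes {Δ : Set BoolRel} (hΔ : IsConjClosed Δ) {ν : PostNode}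
    (hν : ¬ ν.ConstValid) (h : ∀ p ∈ ν.probes, p.rel ∈ Δ) {n : ℕ} (hn : 0 < n) :
    Has Δ (∅ : Set (Fin n → Bool)) := by
  rcases neq_or_consts_of_not_constValid hν with hN | ⟨h0, h1⟩
  · exact hΔ.has_empty_of_neq (h _ hN) hn
  · exact hΔ.has_empty_of_const (h _ h0) (h _ h1) hn

/-- An affine co-clone is determined up to the empty relations by four probes. -/
theorem mem_of_affine_probes {Γ Δ : Set BoolRel} (hΓ : IsCoclone Γ) (hΔ : IsCoclone Δ)
    (haff : ∀ R ∈ Γ, Pres xor3 R.tuples)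
    (h : ∀ p ∈ ({zero, one, neq, xor4} : Set Probe), p.rel ∈ Γ → p.rel ∈ Δ) {R : BoolRel}
    (hR : R ∈ Γ) (hne : R.tuples.Nonempty) : R ∈ Δ := by
  refine mem_of_affine hΓ hΔ.isConjClosed haff (fun k c => ?_) hR hne
  refine has_lin_of_has_lin hΓ hΔ (h zero (by simp)) (h one (by simp)) (h neq (by simp)) ?_
  rw [← xor4_mem_iff, ← xor4_mem_iff]
  exact h xor4 (by simp)

theorem OR_one : OR 1 Nat.one_pos = const true := by
  have : {a : Fin 1 → Bool | a ≠ fun _ => false} = {a | a 0 = true} := by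
    ext a
    revert a
    simp only [Set.mem_ofPred_eq]
    decide
  exact congrArg (BoolRel.mk 1 _) this

theorem mem_of_orDiff_probes {Γ Δ : Set BoolRel} (hΓ : IsMaxCoclone Γ) (hΔ : IsConjClosed Δ)
    (h1 : one.rel ∈ Γ) (hp : ∀ R ∈ Γ, Pres orDiff R.tuples)
    (h : ∀ p : Probe, p.rel ∈ Γ → p.rel ∈ Δ) {R : BoolRel}
    (hR : R ∈ Γ) (hne : R.tuples.Nonempty) : R ∈ Δ := by
  refine mem_of_pres_orDiff hΓ h1 hp hΔ (h zero) (fun w hw hOR => ?_) hR hne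
  match w, hw, hOR with
  | 1, _, hOR =>
    rw [OR_one]
    exact h one h1
  | r + 2, _, hOR => exact h (disj r) hOR

/-- A listed class is determined by its probes. -/
theorem mem_of_probes {Δ : Set BoolRel} (hΔ : IsConjClosed Δ) {ν : PostNode}
    (hx : ν.Affine → IsCoclone Δ) (hN : ν ≠ IN2) (hU : ν ≠ II2) (h : ∀ p ∈ ν.probes, p.rel ∈ Δ)
    {R : BoolRel} (hR : R ∈ ν.sem) (hne : R.tuples.Nonempty) : R ∈ Δ := by
  have hor : ∀ {μ : PostNode} {Δ : Set BoolRel} {R : BoolRel}, IsConjClosed Δ →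
      (∀ p ∈ μ.probes, p.rel ∈ Δ) → R ∈ μ.sem → R.tuples.Nonempty → orDiff ∈ μ.ops →
      one ∈ μ.probes → R ∈ Δ := fun hΔ h hR hne ho h1 =>
    mem_of_orDiff_probes (isMaxCoclone_sem _) hΔ (rel_mem_sem_iff.2 h1) (fun _ hS => hS _ ho)
      (fun p hp => h p (rel_mem_sem_iff.1 hp)) hR hne
  have hdual : ∀ {μ : PostNode}, ν = μ.dual → orDiff ∈ μ.ops → one ∈ μ.probes → R ∈ Δ := by
    rintro μ rfl ho h1
    rw [sem_dual] at hR
    have := hor (μ := μ) (Δ := dualClass Δ) (R := BoolRel.dual R) hΔ.dualClass (fun p hp => ?_) hR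
      ?_ ho h1
    · simpa [dualClass] using this
    · rw [rel_mem_dualClass hΔ]
      exact h _ (dual_mem_probes.2 hp)
    · obtain ⟨a, ha⟩ := hne
      exact ⟨fun i => !a i, by
        change (fun i => !!a i) ∈ R.tuples
        simpa using ha⟩
  have haff : ν.Affine → R ∈ Δ := fun hν =>
    mem_of_affine_probes ν.isCoclone_sem (hx hν) (fun _ => pres_xor3_of_mem_sem hν)
      (fun p _ hp => h p (rel_mem_sem_iff.1 hp)) hR hne
  cases ν
  case IN2 => exact absurd rfl hN
  case II2 => exact absurd rfl hU
  case IM2 =>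
    exact has_tuples.1 (has_of_lattice hΔ (h imp (by simp [probes])) (h zero (by simp [probes]))
      (h one (by simp [probes])) R.pos (hR _ (by simp [ops])) (hR _ (by simp [ops])))
  case IS0k r => exact hor hΔ h hR hne (by simp [ops]) (by simp [probes])
  case IS0 => exact hor hΔ h hR hne (by simp [ops]) (by simp [probes])
  case IS02k r => exact hor hΔ h hR hne (by simp [ops]) (by simp [probes])
  case IS02 => exact hor hΔ h hR hne (by simp [ops]) (by simp [probes])
  case IS1k r => exact hdual (μ := IS0k r) rfl (by simp [ops]) (by simp [probes])
  case IS1 => exact hdual (μ := IS0) rfl (by simp [ops]) (by simp [probes])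
  case IS12k r => exact hdual (μ := IS02k r) rfl (by simp [ops]) (by simp [probes])
  case IS12 => exact hdual (μ := IS02) rfl (by simp [ops]) (by simp [probes])
  all_goals exact haff (by simp [Affine, ops])

theorem sem_subset_of_mem_of_nonempty {Δ : Set BoolRel} (hΔ : IsConjClosed Δ) {ν : PostNode}
    (hp : ∀ p ∈ ν.probes, p.rel ∈ Δ) (h : ∀ R ∈ ν.sem, R.tuples.Nonempty → R ∈ Δ) :
    ν.sem ⊆ Δ := by
  intro R hR
  rcases R.tuples.eq_empty_or_nonempty with he | hne
  · by_cases hν : ν.ConstValid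
    · exact h R hR (nonempty_of_constValid hν hR)
    · have := has_empty_of_probes hΔ hν hp R.pos
      rw [← he] at this
      exact has_tuples.1 this
  · exact h R hR hne

end PostNode

namespace PostNode

open Probe

/-! ### Generating sets -/

theorem NAND_one : NAND 1 Nat.one_pos = const false := by
  have : {a : Fin 1 → Bool | a ≠ fun _ => true} = {a | a 0 = false} := by
    ext a
    revert a
    simp only [Set.mem_ofPred_eq]
    decide
  exact congrArg (BoolRel.mk 1 _) this

theorem XOR_one (b : Bool) : XOR 1 Nat.one_pos (toGF b) = const b := by
  have : {a : Fin 1 → Bool | ∑ i, toGF (a i) = toGF b} = {a | a 0 = b} := by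
    ext a
    simp [toGF_injective.eq_iff]
  exact congrArg (BoolRel.mk 1 _) this

theorem XOR_two : XOR 2 Nat.two_pos 1 = NEQ := by
  have : {a : Fin 2 → Bool | ∑ i, toGF (a i) = 1} = {a | a 0 ≠ a 1} := by
    ext a
    revert a
    simp only [Set.mem_ofPred_eq]
    decide
  exact congrArg (BoolRel.mk 2 _) this

theorem OR_mem_iff {Γ : Set BoolRel} {l : ℕ} {hl : 0 < l} :
    OR l hl ∈ Γ ↔ (l = 1 ∧ one.rel ∈ Γ) ∨ ∃ r, l = r + 2 ∧ (disj r).rel ∈ Γ := by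
  match l, hl with
  | 1, _ => simp [OR_one, rel]
  | r + 2, _ => simp [rel]

theorem NAND_mem_iff {Γ : Set BoolRel} {l : ℕ} {hl : 0 < l} :
    NAND l hl ∈ Γ ↔ (l = 1 ∧ zero.rel ∈ Γ) ∨ ∃ r, l = r + 2 ∧ (nand r).rel ∈ Γ := by
  match l, hl with
  | 1, _ => simp [NAND_one, rel]
  | r + 2, _ => simp [rel]

theorem EQ_mem_sem {ν : PostNode} : EQ ∈ ν.sem := ν.isCoclone_sem.eq

theorem pres_neg_Compl {k l : ℕ} {h : 0 < k + l} : Pres neg (Compl k l h).tuples := by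
  rw [pres_neg]
  have key : ∀ (a : Fin (k + l) → Bool) (c : Bool), (fun i => !a i) =
      Fin.append (fun _ : Fin k => c) (fun _ : Fin l => !c) →
      a = Fin.append (fun _ : Fin k => !c) (fun _ : Fin l => c) := by
    intro a c ha
    funext i
    have := congrFun ha i
    revert this
    refine Fin.addCases (fun j => ?_) (fun j => ?_) i <;> simp [Bool.eq_not]
  exact fun a ha => ⟨fun h => ha.2 (key a false h), fun h => ha.1 (key a true h)⟩

theorem basis_subset_sem (ν : PostNode) : ν.basis ⊆ ν.sem := by
  have h0 : zero ∈ ν.probes → const false ∈ ν.sem := fun h => rel_mem_sem_iff.2 h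
  have h1 : one ∈ ν.probes → const true ∈ ν.sem := fun h => rel_mem_sem_iff.2 h
  have hN : neq ∈ ν.probes → NEQ ∈ ν.sem := fun h => rel_mem_sem_iff.2 h
  have hI : imp ∈ ν.probes → IMP ∈ ν.sem := fun h => rel_mem_sem_iff.2 h
  have hE := EQ_mem_sem (ν := ν)
  have hx : ∀ P : ℕ → ZMod 2 → Prop, (∀ k hk c, P k c → XOR k hk c ∈ ν.sem) → xors P ⊆ ν.sem := by
    rintro P h _ ⟨k, hk, c, hP, rfl⟩
    exact h k hk c hP
  cases ν
  case IN2 =>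
    rintro _ ⟨k, l, h, rfl⟩
    exact mem_sem_IN2.2 pres_neg_Compl
  case II2 =>
    rw [sem_II2]
    exact Set.subset_univ _
  case IL2 =>
    refine hx _ fun k hk c _ f hf => ?_
    rw [Set.mem_singleton_iff.1 hf]
    exact pres_xor3_XOR
  case IL | IL0 | IL1 | IL3 =>
    refine hx _ fun k hk c h => ?_
    simp only [sem, BoolRel.Inv, ops, Set.mem_ofPred_eq, Set.forall_mem_insert,
      Set.mem_singleton_iff, forall_eq, pres_zero_XOR_iff, pres_one_XOR_iff, pres_neg_XOR_iff,
      pres_xor3_XOR, true_and]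
    first | exact h | (rw [ZMod.natCast_eq_zero_iff_even.2 h.1]; exact ⟨h.2, h.2.symm⟩)
  case IS0k | IS0 | IS02k | IS02 =>
    refine Set.union_subset (by
      simp only [Set.insert_subset_iff, Set.singleton_subset_iff, hE, true_and]
      try exact h0 (by simp [probes])) ?_
    rintro _ ⟨l, hl, h⟩
    obtain ⟨hr, rfl⟩ := h
    rw [OR_mem_iff, rel_mem_sem_iff]
    simp only [rel_mem_sem_iff]
    match l, hl with
    | 1, _ => simp [probes]
    | r + 2, _ => simp [probes] <;> omega
  case IS1k | IS1 | IS12k | IS12 =>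
    refine Set.union_subset (by
      simp only [Set.insert_subset_iff, Set.singleton_subset_iff, hE, true_and]
      try exact h1 (by simp [probes])) ?_
    rintro _ ⟨l, hl, h⟩
    obtain ⟨hr, rfl⟩ := h
    rw [NAND_mem_iff, rel_mem_sem_iff]
    simp only [rel_mem_sem_iff]
    match l, hl with
    | 1, _ => simp [probes]
    | r + 2, _ => simp [probes] <;> omega
  all_goals simp_all [basis, probes, Set.insert_subset_iff]

theorem maxBasis_subset_sem (ν : PostNode) : ν.maxBasis ⊆ ν.sem := by
  have hb : ν.maxBasis = ν.basis → ν.maxBasis ⊆ ν.sem := fun h => h ▸ ν.basis_subset_sem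
  cases ν
  case II2 =>
    rw [sem_II2]
    exact Set.subset_univ _
  case IN2 => exact Set.singleton_subset_iff.2 (rel_mem_sem_iff.2 (by simp [probes]) : nae.rel ∈ _)
  case IM2 => exact Set.singleton_subset_iff.2 (rel_mem_sem_iff.2 (by simp [probes]) : imp.rel ∈ _)
  case IS0k r =>
    have h : (disj r).rel ∈ (IS0k r).sem := rel_mem_sem_iff.2 (by simp [probes])
    exact Set.insert_subset EQ_mem_sem (Set.singleton_subset_iff.2 h)
  case IS1k r =>
    have h : (nand r).rel ∈ (IS1k r).sem := rel_mem_sem_iff.2 (by simp [probes])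
    exact Set.insert_subset EQ_mem_sem (Set.singleton_subset_iff.2 h)
  case IS02k r =>
    have h : (disj r).rel ∈ (IS02k r).sem := rel_mem_sem_iff.2 (by simp [probes])
    have h0 : zero.rel ∈ (IS02k r).sem := rel_mem_sem_iff.2 (by simp [probes])
    exact Set.insert_subset EQ_mem_sem (Set.insert_subset h0 (Set.singleton_subset_iff.2 h))
  all_goals exact hb rfl

theorem rel_mem_basis {ν : PostNode} (hN : ν ≠ IN2) (hU : ν ≠ II2) {p : Probe}
    (hp : p ∈ ν.probes) : p.rel ∈ ν.basis := by
  have hor : ∀ {k}, one.rel ∈ orUpTo (k + 2) := fun {k} => ⟨1, Nat.one_pos, by omega, OR_one.symm⟩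
  have hor' : one.rel ∈ orAll := ⟨1, Nat.one_pos, OR_one.symm⟩
  have hd : ∀ {k r}, r ≤ k → (disj r).rel ∈ orUpTo (k + 2) :=
    fun h => ⟨_, _, by omega, rfl⟩
  have hd' : ∀ {r}, (disj r).rel ∈ orAll := ⟨_, _, rfl⟩
  have hand : ∀ {k}, zero.rel ∈ nandUpTo (k + 2) :=
    fun {k} => ⟨1, Nat.one_pos, by omega, NAND_one.symm⟩
  have hand' : zero.rel ∈ nandAll := ⟨1, Nat.one_pos, NAND_one.symm⟩
  have hn : ∀ {k r}, r ≤ k → (nand r).rel ∈ nandUpTo (k + 2) :=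
    fun h => ⟨_, _, by omega, rfl⟩
  have hn' : ∀ {r}, (nand r).rel ∈ nandAll := ⟨_, _, rfl⟩
  have hx0 : ∀ {P : ℕ → ZMod 2 → Prop}, P 1 0 → zero.rel ∈ xors P :=
    fun h => ⟨1, Nat.one_pos, 0, h, (XOR_one false).symm⟩
  have hx1 : ∀ {P : ℕ → ZMod 2 → Prop}, P 1 1 → one.rel ∈ xors P :=
    fun h => ⟨1, Nat.one_pos, 1, h, (XOR_one true).symm⟩
  have hxN : ∀ {P : ℕ → ZMod 2 → Prop}, P 2 1 → neq.rel ∈ xors P :=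
    fun h => ⟨2, Nat.two_pos, 1, h, XOR_two.symm⟩
  have hx4 : ∀ {P : ℕ → ZMod 2 → Prop}, P 4 0 → xor4.rel ∈ xors P :=
    fun h => ⟨4, by norm_num, 0, h, rfl⟩
  have r0 : const false = zero.rel := rfl
  have r1 : const true = one.rel := rfl
  have rN : NEQ = neq.rel := rfl
  have rI : IMP = imp.rel := rfl
  have h4 : (4 : ZMod 2) = 0 := rfl
  have e4 : Even 4 := by decide
  cases ν <;> cases p <;> simp [probes] at hp hN hU <;>
    simp [basis, r0, r1, rN, rI, hor, hor', hd, hd', hand, hand', hn, hn', hp, hx0, hx1, hxN, hx4,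
      h4, e4]

/-- The coordinates of a tuple `d`, first those with entry zero and then those with entry one. -/
theorem exists_sorting {n : ℕ} (hn : 0 < n) (d : Fin n → Bool) : ∃ (k l : ℕ) (_ : 0 < k + l)
    (π : Fin (k + l) → Fin n), ((∃ i, d i = false) → 1 ≤ k) ∧ ((∃ i, d i = true) → 1 ≤ l) ∧
    ∀ (a : Fin n → Bool) (c : Bool), (fun i => a (π i)) =
      Fin.append (fun _ : Fin k => c) (fun _ : Fin l => !c) ↔ a = fun i => d i ^^ c := by
  classical
  let e : ∀ b, {i // d i = b} ≃ Fin (Fintype.card {i // d i = b}) := fun b => Fintype.equivFin _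
  have hpos : ∀ b, (∃ i, d i = b) → 1 ≤ Fintype.card {i // d i = b} :=
    fun b ⟨i, hi⟩ => Fintype.card_pos_iff.2 ⟨⟨i, hi⟩⟩
  refine ⟨_, _, ?_, Fin.append (fun i => ((e false).symm i).1) fun i => ((e true).symm i).1,
    hpos false, hpos true, fun a c => ?_⟩
  · cases h : d ⟨0, hn⟩
    · have := hpos _ ⟨_, h⟩
      omega
    · have := hpos _ ⟨_, h⟩
      omega
  constructor
  · intro h
    funext i
    cases hi : d i
    · have := congrFun h (Fin.castAdd _ (e false ⟨i, hi⟩))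
      simpa using this
    · have := congrFun h (Fin.natAdd _ (e true ⟨i, hi⟩))
      simpa using this
  · rintro rfl
    funext i
    refine Fin.addCases (fun j => ?_) (fun j => ?_) i
    · simp [((e false).symm j).2]
    · simp [((e true).symm j).2]

theorem mem_of_pres_neg_of_Compl {Δ : Set BoolRel} (hΔ : IsConjClosed Δ) (h : IN2.basis ⊆ Δ)
    {R : BoolRel} (hR : Pres neg R.tuples) : R ∈ Δ := by
  rw [pres_neg] at hR
  refine has_tuples.1 (hΔ.has_of_separated R.pos fun d hd => ?_)
  obtain ⟨k, l, hkl, π, -, -, hπ⟩ := exists_sorting R.pos d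
  have hC : Has Δ (Compl k l hkl).tuples := has_tuples.2 (h ⟨k, l, hkl, rfl⟩)
  refine ⟨_, hΔ.has_manip hC π, fun a ha => ?_, fun hd' => ?_⟩
  · have h0 := hπ a false
    have h1 := hπ a true
    refine ⟨fun h => hd ?_, fun h => hd ?_⟩
    · rw [h0.1 h] at ha
      simpa using ha
    · rw [h1.1 h] at ha
      simpa using hR _ ha
  · exact hd'.1 ((hπ d false).2 (by simp))

theorem mem_of_Clause {Δ : Set BoolRel} (hΔ : IsCoclone Δ) (h : II2.basis ⊆ Δ) (R : BoolRel) :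
    R ∈ Δ := by
  have hC := hΔ.isConjClosed
  have h0 : const false ∈ Δ := h (by simp [basis])
  have h1 : const true ∈ Δ := h (by simp [basis])
  obtain ⟨n, hn, R⟩ := R
  -- two further coordinates with entries zero and one, so that clauses of both signs are enough
  have hT : Has Δ {c : Fin (n + 2) → Bool | (fun i => c (Fin.castAdd 2 i)) ∈ R ∧
      c (Fin.natAdd n 0) = false ∧ c (Fin.natAdd n 1) = true} := by
    refine hC.has_of_separated (by omega) fun d hd => ?_
    by_cases hd0 : d (Fin.natAdd n 0) = false
    swap
    · exact ⟨_, hC.has_coord h0 (Fin.natAdd n 0), fun a ha => ha.2.1, hd0⟩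
    by_cases hd1 : d (Fin.natAdd n 1) = true
    swap
    · exact ⟨_, hC.has_coord h1 (Fin.natAdd n 1), fun a ha => ha.2.2, hd1⟩
    obtain ⟨k, l, hkl, π, hk, hl, hπ⟩ := exists_sorting (by omega) d
    have hcl : Has Δ (Clause k l hkl).tuples :=
      has_tuples.2 (h (Or.inl ⟨k, l, hkl, hk ⟨_, hd0⟩, hl ⟨_, hd1⟩, rfl⟩))
    have key : ∀ a : Fin (n + 2) → Bool, (fun i => a (π i)) ∈ (Clause k l hkl).tuples ↔ a ≠ d := by
      intro a
      have h2 := hπ a false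
      simp only [Bool.xor_false, Bool.not_false] at h2
      rw [ne_eq, ← h2]
      change ((∃ i : Fin k, a (π (Fin.castAdd l i)) = true) ∨
        ∃ j : Fin l, a (π (Fin.natAdd k j)) = false) ↔ _
      constructor
      · rintro (⟨i, hi⟩ | ⟨j, hj⟩) hc
        · have := congrFun hc (Fin.castAdd l i)
          simp [hi] at this
        · have := congrFun hc (Fin.natAdd k j)
          simp [hj] at this
      · intro hc
        by_contra! hcon
        refine hc (funext fun i => ?_)
        refine Fin.addCases (fun j => ?_) (fun j => ?_) i
        · simpa using hcon.1 j
        · simpa using hcon.2 j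
    refine ⟨_, hC.has_manip hcl π, fun a ha => (key a).2 ?_, fun hd' => (key d).1 hd' rfl⟩
    rintro rfl
    exact hd ha
  have hE := hΔ.has_exist hn hT
  convert hE.2
  ext a
  simp only [exist, Set.mem_ofPred_eq, Fin.append_left, Fin.append_right]
  exact ⟨fun ha => ⟨![false, true], ha, rfl, rfl⟩, fun ⟨_, ha, _⟩ => ha⟩

/-- The basis of a node generates all relations preserved by its operations. -/
theorem sem_subset_of_basis_subset {Δ : Set BoolRel} (hΔ : IsCoclone Δ) {ν : PostNode}
    (h : ν.basis ⊆ Δ) : ν.sem ⊆ Δ := by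
  by_cases hN : ν = IN2
  · subst hN
    exact fun R hR => mem_of_pres_neg_of_Compl hΔ.isConjClosed h (mem_sem_IN2.1 hR)
  by_cases hU : ν = II2
  · subst hU
    exact fun R _ => mem_of_Clause hΔ h R
  have hp : ∀ p ∈ ν.probes, p.rel ∈ Δ := fun p hp => h (rel_mem_basis hN hU hp)
  exact sem_subset_of_mem_of_nonempty hΔ.isConjClosed hp fun R hR hne =>
    mem_of_probes hΔ.isConjClosed (fun _ => hΔ) hN hU hp hR hne

/-- The listed co-clones are classes of invariant relations. -/
theorem coclone_eq_sem (ν : PostNode) : ν.coclone = ν.sem :=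
  Set.Subset.antisymm (cocloneGen_subset ν.isCoclone_sem ν.basis_subset_sem)
    (sem_subset_of_basis_subset (isCoclone_cocloneGen _) (subset_cocloneGen _))

theorem _root_.IsMaxCoclone.inter {Γ Δ : Set BoolRel} (hΓ : IsMaxCoclone Γ)
    (hΔ : IsMaxCoclone Δ) : IsMaxCoclone (Γ ∩ Δ) where
  eq := ⟨hΓ.eq, hΔ.eq⟩
  manip n m hn hm R π h := ⟨hΓ.manip n m hn hm R π h.1, hΔ.manip n m hn hm R π h.2⟩
  conj n hn R S h h' := ⟨hΓ.conj n hn R S h.1 h'.1, hΔ.conj n hn R S h.2 h'.2⟩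
  maxImpl n m hn hnm R h := ⟨hΓ.maxImpl n m hn hnm R h.1, hΔ.maxImpl n m hn hnm R h.2⟩

/-- Identifying two variables of `nae` gives `NEQ`, so that within `IN2.sem` the max-co-clone
generated by `nae` contains `NEQ`, no constant and a relation which is not affine. -/
theorem sem_IN2_subset {Δ : Set BoolRel} (hΔ : IsMaxCoclone Δ) (h : nae.rel ∈ Δ) :
    IN2.sem ⊆ Δ := by
  have hΔ' := hΔ.inter (isMaxCoclone_sem IN2)
  have h' : nae.rel ∈ Δ ∩ IN2.sem := ⟨h, rel_mem_sem_iff.2 (by simp [probes])⟩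
  intro R hR
  refine (mem_of_pres_neg hΔ' ?_ (fun h0 => ?_) ⟨_, h', ?_⟩ (mem_sem_IN2.1 hR)).1
  · rw [NEQ_mem_iff]
    rw [nae_mem_iff] at h'
    convert hΔ'.isConjClosed.has_rel3_comp h' (0 : Fin 2) 0 1 using 1
    ext a
    simp only [rel2, Set.mem_ofPred_eq]
    cases a 0 <;> cases a 1 <;> simp
  · have : zero ∈ IN2.probes := rel_mem_sem_iff.1 h0.2
    simp [probes] at this
  · rw [pres_xor3_probe]
    simp

/-- A listed class is contained in each max-co-clone which contains its probes. -/
theorem sem_subset_of_probes {Δ : Set BoolRel} (hΔ : IsMaxCoclone Δ) {ν : PostNode}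
    (h : ∀ p ∈ ν.probes, p.rel ∈ Δ) : ν.sem ⊆ Δ := by
  by_cases hN : ν = IN2
  · subst hN
    exact sem_IN2_subset hΔ (h _ (by simp [probes]))
  by_cases hU : ν = II2
  · subst hU
    rw [eq_univ_of_OR_of_IMP hΔ (h (disj 0) trivial) (h imp trivial)]
    exact Set.subset_univ _
  have hΔ' := hΔ.inter ν.isMaxCoclone_sem
  have h' : ∀ p ∈ ν.probes, p.rel ∈ Δ ∩ ν.sem := fun p hp => ⟨h p hp, rel_mem_sem_iff.2 hp⟩
  refine (sem_subset_of_mem_of_nonempty hΔ'.isConjClosed h' fun R hR hne =>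
    mem_of_probes hΔ'.isConjClosed (fun hν => ?_) hN hU h' hR hne).trans Set.inter_subset_left
  exact (isMaxCoclone_iff_isCoclone_of_affine fun R hR => pres_xor3_of_mem_sem hν hR.2).1 hΔ'

/-- Smaller clauses arise from larger ones by identification of variables, and implication
implements both constants. -/
theorem rel_mem_of_maxBasis_subset {Δ : Set BoolRel} (hΔ : IsMaxCoclone Δ) {ν : PostNode}
    (h : ν.maxBasis ⊆ Δ) (hN : ν ≠ IN2) (hU : ν ≠ II2) {p : Probe} (hp : p ∈ ν.probes) :
    p.rel ∈ Δ := by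
  have hC := hΔ.isConjClosed
  have hor : ∀ {Δ : Set BoolRel} {r p}, IsConjClosed Δ → (disj r).rel ∈ Δ →
      p ∈ ({one} ∪ disj '' Set.Iic r : Set Probe) → p.rel ∈ Δ := by
    rintro Δ r _ hC hr (rfl | ⟨s, hs, rfl⟩)
    · have := hC.has_OR_of_le (hl := Nat.one_pos) hr (by omega)
      rwa [OR_one] at this
    · exact hC.has_OR_of_le hr (Nat.add_le_add_right hs 2)
  have hb : ν.maxBasis = ν.basis → p.rel ∈ Δ := fun hb => h (hb ▸ rel_mem_basis hN hU hp)
  cases ν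
  case IN2 => exact absurd rfl hN
  case II2 => exact absurd rfl hU
  case IM2 =>
    have hI : IMP ∈ Δ := h rfl
    rcases hp with rfl | rfl | rfl
    · exact const_mem_of_IMP hΔ hI _
    · exact const_mem_of_IMP hΔ hI _
    · exact hI
  case IS0k r => exact hor hC (h (by simp [maxBasis, rel])) hp
  case IS02k r =>
    rcases hp with (rfl | rfl) | hp
    · exact h (by simp [maxBasis, rel])
    · exact hor (r := r) hC (h (by simp [maxBasis, rel])) (Or.inl rfl)
    · exact hor (r := r) hC (h (by simp [maxBasis, rel])) (Or.inr hp)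
  case IS1k r =>
    have hr : (nand r).rel ∈ Δ := h (by simp [maxBasis, rel])
    rw [← Probe.dual_dual p, ← rel_mem_dualClass hC]
    refine hor (r := r) hC.dualClass ?_ (dual_mem_probes.2 hp)
    rwa [rel_mem_dualClass hC]
  all_goals exact hb rfl

theorem maxCocloneGen_maxBasis (ν : PostNode) : maxCocloneGen ν.maxBasis = ν.sem := by
  refine Set.Subset.antisymm (maxCocloneGen_subset ν.isMaxCoclone_sem ν.maxBasis_subset_sem) ?_
  have hΔ := isMaxCoclone_maxCocloneGen ν.maxBasis
  have h := subset_maxCocloneGen ν.maxBasis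
  by_cases hN : ν = IN2
  · subst hN
    exact sem_IN2_subset hΔ (h rfl)
  by_cases hU : ν = II2
  · subst hU
    rw [eq_univ_of_OR_of_IMP hΔ (h (by simp [maxBasis])) (h (by simp [maxBasis]))]
    exact Set.subset_univ _
  exact sem_subset_of_probes hΔ fun p hp => rel_mem_of_maxBasis_subset hΔ h hN hU hp

end PostNode

namespace PostNode

open Probe

/-! ### Classification -/

section Classification

variable {Γ : Set BoolRel}

/-- A max-co-clone is settled by a node whose probes it contains, provided that its nonempty
relations are preserved by the operations of the node. -/
theorem eq_sem_or_withEmpty (hΓ : IsMaxCoclone Γ) {ν : PostNode} (hp : ∀ p ∈ ν.probes, p.rel ∈ Γ)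
    (h : ∀ R ∈ Γ, R.tuples.Nonempty → R ∈ ν.sem) :
    ∃ ν : PostNode, Γ = ν.sem ∨ Γ = withEmpty ν.sem :=
  ⟨ν, eq_or_eq_withEmpty hΓ.isConjClosed h (sem_subset_of_probes hΓ hp)⟩

/-- The list is symmetric with respect to the exchange of the constants. -/
theorem exists_node_of_dualClass
    (h : ∃ ν : PostNode, dualClass Γ = ν.sem ∨ dualClass Γ = withEmpty ν.sem) :
    ∃ ν : PostNode, Γ = ν.sem ∨ Γ = withEmpty ν.sem := by
  obtain ⟨ν, h | h⟩ := h
  · exact ⟨ν.dual, Or.inl (by rw [sem_dual, ← h, dualClass_dualClass])⟩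
  · exact ⟨ν.dual, Or.inr (by rw [sem_dual, ← dualClass_withEmpty, ← h, dualClass_dualClass])⟩

theorem exists_node_of_univ (hU : Γ = Set.univ) :
    ∃ ν : PostNode, Γ = ν.sem ∨ Γ = withEmpty ν.sem :=
  ⟨II2, Or.inl (by rw [hU, sem_II2])⟩

theorem neq_mem_of_xor4 (hΓ : IsMaxCoclone Γ) (h0 : zero.rel ∈ Γ) (h1 : one.rel ∈ Γ)
    (h4 : xor4.rel ∈ Γ) : neq.rel ∈ Γ := by
  have h := hΓ.has_section Nat.two_pos (xor4_mem_iff.1 h4)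
    ![Sum.inl 0, Sum.inl 1, Sum.inr false, Sum.inr true] (fun _ c _ => by
      cases c
      · exact h0
      · exact h1) ⟨![false, true], by decide⟩
  change NEQ ∈ Γ
  rw [NEQ_mem_iff]
  convert h using 1
  ext a
  revert a
  simp only [rel2, lin, Set.mem_ofPred_eq]
  decide

/-- Which of the constants, of `NEQ` and of the equation `x₁ ⊕ x₂ ⊕ x₃ ⊕ x₄ = 0` belong to `Γ`
decides the node; the combinations without a node do not occur, since `NEQ` yields either both
constants or none, and since both constants and the equation yield `NEQ`. -/
theorem exists_node_of_affine (hΓ : IsMaxCoclone Γ) (haff : ∀ R ∈ Γ, Pres xor3 R.tuples) :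
    ∃ ν : PostNode, Γ = ν.sem ∨ Γ = withEmpty ν.sem := by
  have fit : ∀ ν : PostNode, ν.Affine →
      (∀ p ∈ ({zero, one, neq, xor4} : Set Probe), p.rel ∈ Γ ↔ p ∈ ν.probes) →
      ∃ ν : PostNode, Γ = ν.sem ∨ Γ = withEmpty ν.sem := by
    intro ν hν h
    refine eq_sem_or_withEmpty hΓ (ν := ν) (fun p hp => ?_) fun R hR hne => ?_
    · exact (h p ((pres_xor3_probe p).1 (pres_xor3_of_mem_sem hν (rel_mem_sem_iff.2 hp)))).2 hp
    · exact mem_of_affine_probes ((isMaxCoclone_iff_isCoclone_of_affine haff).1 hΓ)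
        ν.isCoclone_sem haff (fun p hp hpΓ => rel_mem_sem_iff.2 ((h p hp).1 hpΓ)) hR hne
  have h01 : neq.rel ∈ Γ → zero.rel ∈ Γ → one.rel ∈ Γ :=
    fun hN h0 => const_mem_of_NEQ hΓ hN h0 _
  have h10 : neq.rel ∈ Γ → one.rel ∈ Γ → zero.rel ∈ Γ :=
    fun hN h1 => const_mem_of_NEQ hΓ hN h1 _
  have h014 := neq_mem_of_xor4 hΓ
  by_cases h0 : zero.rel ∈ Γ <;> by_cases h1 : one.rel ∈ Γ <;> by_cases hN : neq.rel ∈ Γ <;>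
    by_cases h4 : xor4.rel ∈ Γ
  · exact fit IL2 (by simp [Affine, ops]) (by simp [probes, h0, h1, hN, h4])
  · exact fit ID1 (by simp [Affine, ops]) (by simp [probes, h0, h1, hN, h4])
  · exact absurd (h014 h0 h1 h4) hN
  · exact fit IR2 (by simp [Affine, ops]) (by simp [probes, h0, h1, hN, h4])
  · exact absurd (h01 hN h0) h1
  · exact absurd (h01 hN h0) h1
  · exact fit IL0 (by simp [Affine, ops]) (by simp [probes, h0, h1, hN, h4])
  · exact fit IR0 (by simp [Affine, ops]) (by simp [probes, h0, h1, hN, h4])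
  · exact absurd (h10 hN h1) h0
  · exact absurd (h10 hN h1) h0
  · exact fit IL1 (by simp [Affine, ops]) (by simp [probes, h0, h1, hN, h4])
  · exact fit IR1 (by simp [Affine, ops]) (by simp [probes, h0, h1, hN, h4])
  · exact fit IL3 (by simp [Affine, ops]) (by simp [probes, h0, h1, hN, h4])
  · exact fit ID (by simp [Affine, ops]) (by simp [probes, h0, h1, hN, h4])
  · exact fit IL (by simp [Affine, ops]) (by simp [probes, h0, h1, hN, h4])
  · exact fit IBF (by simp [Affine, ops]) (by simp [probes, h0, h1, hN, h4])

/-- The node is decided by the constant zero and by the arities `w` for which `OR w` belongs to `Γ`;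
these arities form an initial segment, which is either everything or has a largest element. -/
theorem exists_node_of_orDiff (hΓ : IsMaxCoclone Γ) (h1 : one.rel ∈ Γ)
    (hO : (disj 0).rel ∈ Γ) (hp : ∀ R ∈ Γ, Pres orDiff R.tuples) :
    ∃ ν : PostNode, Γ = ν.sem ∨ Γ = withEmpty ν.sem := by
  have fit : ∀ ν : PostNode, (∀ p ∈ ({zero, one} ∪ Set.range disj : Set Probe),
      p.rel ∈ Γ ↔ p ∈ ν.probes) → ν.probes ⊆ {zero, one} ∪ Set.range disj →
      ∃ ν : PostNode, Γ = ν.sem ∨ Γ = withEmpty ν.sem := by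
    intro ν h hν
    refine eq_sem_or_withEmpty hΓ (ν := ν) (fun p hp => (h p (hν hp)).2 hp) fun R hR hne => ?_
    exact mem_of_orDiff_probes hΓ ν.isCoclone_sem.isConjClosed h1 hp (fun p hpΓ =>
      rel_mem_sem_iff.2 ((h p ((pres_orDiff_probe p).1 (hp _ hpΓ))).1 hpΓ)) hR hne
  by_cases hall : ∀ r, (disj r).rel ∈ Γ
  · by_cases h0 : zero.rel ∈ Γ
    · exact fit IS02 (by simp [probes, h0, h1, hall, or_imp, forall_and])
        (by simp [probes])
    · exact fit IS0 (by simp [probes, h0, h1, hall, or_imp, forall_and])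
        (by simp [probes, Set.insert_subset_iff])
  · -- the largest `r` with `OR^{r+2}` in the class
    obtain ⟨r, hr, hr'⟩ : ∃ r, (disj r).rel ∈ Γ ∧ (disj (r + 1)).rel ∉ Γ := by
      by_contra! hc
      exact hall fun r => Nat.rec hO hc r
    have hall : ∀ s, (disj s).rel ∈ Γ ↔ s ≤ r := by
      refine fun s => ⟨fun hs => ?_, fun hs => ?_⟩
      · by_contra! hc
        exact hr' (hΓ.isConjClosed.has_OR_of_le hs (by omega))
      · exact hΓ.isConjClosed.has_OR_of_le hr (by omega)
    by_cases h0 : zero.rel ∈ Γ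
    · exact fit (IS02k r) (by simp [probes, h0, h1, hall, or_imp, forall_and])
        (by simp [probes])
    · exact fit (IS0k r) (by simp [probes, h0, h1, hall, or_imp, forall_and])
        (by simp [probes, Set.insert_subset_iff])

/-- The tuples `a`, `b`, `a ∧ b` and `a ∨ b` form the section of `R` by two variables and constants.
If `a` and `b`, but not both of the others belong to `R`, that section is `NEQ`, `OR` or `NAND`,
each of which together with implication generates all relations. -/
theorem pres_lattice_of_IMP (hΓ : IsMaxCoclone Γ) (hU : Γ ≠ Set.univ) (hI : IMP ∈ Γ) {n : ℕ}
    {R : Set (Fin n → Bool)} (hR : Has Γ R) : Pres and2 R ∧ Pres or2 R := by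
  have hc := const_mem_of_IMP hΓ hI
  have hN : NEQ ∉ Γ := fun h => hU (eq_univ_of_NEQ hΓ h (Or.inl hI))
  have hO : OR 2 Nat.two_pos ∉ Γ := fun h => hU (eq_univ_of_OR_of_IMP hΓ h hI)
  have hA : NAND 2 Nat.two_pos ∉ Γ := fun h => hU (eq_univ_of_IMP_of_NAND hΓ hI h)
  rw [NEQ_mem_iff] at hN
  rw [OR_two_mem_iff] at hO
  rw [NAND_two_mem_iff] at hA
  have key : ∀ a ∈ R, ∀ b ∈ R, (fun j => a j && b j) ∈ R ∧ (fun j => a j || b j) ∈ R := by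
    intro a ha b hb
    let σ : Fin n → Fin 2 ⊕ Bool := fun i => if a i = b i then Sum.inr (a i) else
      if a i = true then Sum.inl 0 else Sum.inl 1
    have h10 : (fun i => Sum.elim ![true, false] id (σ i)) = a := by
      funext i
      simp only [σ]
      cases a i <;> cases b i <;> rfl
    have h01 : (fun i => Sum.elim ![false, true] id (σ i)) = b := by
      funext i
      simp only [σ]
      cases a i <;> cases b i <;> rfl
    have h00 : (fun i => Sum.elim ![false, false] id (σ i)) = fun i => a i && b i := by
      funext i
      simp only [σ]
      cases a i <;> cases b i <;> rfl
    have h11 : (fun i => Sum.elim ![true, true] id (σ i)) = fun i => a i || b i := by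
      funext i
      simp only [σ]
      cases a i <;> cases b i <;> rfl
    obtain ⟨q, hq, hqR⟩ := hΓ.has_rel2_section hR σ (fun _ c _ => hc c) true false (by rwa [h10])
    have q10 := hqR true false
    have q01 := hqR false true
    rw [← h00, ← h11, ← hqR, ← hqR]
    rw [h10, iff_true_right ha] at q10
    rw [h01, iff_true_right hb] at q01
    have h3 : ∀ q' : Bool → Bool → Bool, q false false = q' false false →
        q false true = q' false true → q true false = q' true false →
        q true true = q' true true → Has Γ (rel2 q') :=
      fun q' k1 k2 k3 k4 => fun_eq_of_values k1 k2 k3 k4 ▸ hq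
    by_contra hcon
    cases q00 : q false false <;> cases q11 : q true true
    · exact hN (h3 _ q00 q01 q10 q11)
    · exact hO (h3 _ q00 q01 q10 q11)
    · exact hA (h3 _ q00 q01 q10 q11)
    · exact hcon ⟨q00, q11⟩
  exact ⟨pres_and2.2 fun a ha b hb => (key a ha b hb).1,
    pres_or2.2 fun a ha b hb => (key a ha b hb).2⟩

theorem exists_node_of_IMP (hΓ : IsMaxCoclone Γ) (hI : IMP ∈ Γ) :
    ∃ ν : PostNode, Γ = ν.sem ∨ Γ = withEmpty ν.sem := by
  by_cases hU : Γ = Set.univ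
  · exact exists_node_of_univ hU
  refine eq_sem_or_withEmpty hΓ (ν := IM2) ?_ fun R hR _ => ?_
  · rintro p (rfl | rfl | rfl)
    · exact const_mem_of_IMP hΓ hI _
    · exact const_mem_of_IMP hΓ hI _
    · exact hI
  · have h := pres_lattice_of_IMP hΓ hU hI (has_tuples.2 hR)
    rintro f (rfl | rfl)
    · exact h.1
    · exact h.2

theorem exists_node_of_OR_of_consts (hΓ : IsMaxCoclone Γ) (hc : ∀ c, const c ∈ Γ) (hI : IMP ∉ Γ)
    (hO : OR 2 Nat.two_pos ∈ Γ) : ∃ ν : PostNode, Γ = ν.sem ∨ Γ = withEmpty ν.sem := by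
  by_cases hU : Γ = Set.univ
  · exact exists_node_of_univ hU
  exact exists_node_of_orDiff hΓ (hc true) hO fun R hR => pres_orDiff_of_const hΓ hc hI
    (fun h => hU (eq_univ_of_OR_of_NAND hΓ hO h))
    (fun h => hU (eq_univ_of_NEQ hΓ h (Or.inr (Or.inl hO)))) (has_tuples.2 hR)

theorem exists_node_of_const_true (hΓ : IsMaxCoclone Γ) (h1 : const true ∈ Γ) :
    ∃ ν : PostNode, Γ = ν.sem ∨ Γ = withEmpty ν.sem := by
  by_cases hI : IMP ∈ Γ
  · exact exists_node_of_IMP hΓ hI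
  by_cases hO : OR 2 Nat.two_pos ∈ Γ
  · by_cases h0 : const false ∈ Γ
    · exact exists_node_of_OR_of_consts hΓ (Bool.forall_bool.2 ⟨h0, h1⟩) hI hO
    · exact exists_node_of_orDiff hΓ h1 hO fun R hR =>
        pres_orDiff_of_const_true hΓ h1 h0 hO (has_tuples.2 hR)
  by_cases h0 : const false ∈ Γ
  · have hc : ∀ c, const c ∈ Γ := Bool.forall_bool.2 ⟨h0, h1⟩
    by_cases hA : NAND 2 Nat.two_pos ∈ Γ
    · refine exists_node_of_dualClass (exists_node_of_OR_of_consts hΓ.dualClass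
        (fun c => const_mem_dualClass.2 (hc _)) (fun h => hI ?_) ?_)
      · exact (rel_mem_dualClass hΓ.isConjClosed imp).1 h
      · exact (rel_mem_dualClass hΓ.isConjClosed (disj 0)).2 hA
    · exact exists_node_of_affine hΓ fun R hR =>
        pres_xor3_of_const hΓ hc hI hO hA (has_tuples.2 hR)
  · exact exists_node_of_affine hΓ fun R hR =>
      pres_xor3_of_const_true hΓ h1 h0 hO (has_tuples.2 hR)

/-- Every max-co-clone is on the list, up to the empty relations. -/
theorem exists_node (hΓ : IsMaxCoclone Γ) :
    ∃ ν : PostNode, Γ = ν.sem ∨ Γ = withEmpty ν.sem := by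
  by_cases h1 : const true ∈ Γ
  · exact exists_node_of_const_true hΓ h1
  by_cases h0 : const false ∈ Γ
  · exact exists_node_of_dualClass (exists_node_of_const_true hΓ.dualClass
      (const_mem_dualClass.2 h0))
  -- from here on, no constant is available
  by_cases hN : NEQ ∈ Γ
  · by_cases hx : ∀ R ∈ Γ, Pres xor3 R.tuples
    · exact exists_node_of_affine hΓ hx
    · push Not at hx
      refine ⟨IN2, Or.inl (Set.Subset.antisymm (fun R hR => ?_) fun R hR => ?_)⟩
      · exact mem_sem_IN2.2 (neg_mem_of_NEQ hΓ hN h0 (has_tuples.2 hR))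
      · exact mem_of_pres_neg hΓ hN h0 hx (mem_sem_IN2.1 hR)
  · exact exists_node_of_affine hΓ fun R hR =>
      pres_xor3_of_no_const hΓ h0 h1 hN (has_tuples.2 hR)

end Classification

/-! ### The order of the lattice -/

theorem Edge.probes_subset {ν μ : PostNode} (h : Edge ν μ) : ν.probes ⊆ μ.probes := by
  intro p hp
  cases h <;> cases p <;> simp_all [probes] <;> omega

/-- Every edge is strict. -/
theorem Edge.exists_probe {ν μ : PostNode} (h : Edge ν μ) : ∃ p ∈ μ.probes, p ∉ ν.probes := by
  cases h
  case IS0k_succ r | IS0k_IS0 r | IS02k_succ r | IS02k_IS02 r =>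
    exact ⟨disj (r + 1), by simp [probes]⟩
  case IS1k_succ r | IS1k_IS1 r | IS12k_succ r | IS12k_IS12 r =>
    exact ⟨nand (r + 1), by simp [probes]⟩
  all_goals first
    | (refine ⟨zero, ?_⟩; simp [probes]; done)
    | (refine ⟨one, ?_⟩; simp [probes]; done)
    | (refine ⟨neq, ?_⟩; simp [probes]; done)
    | (refine ⟨xor4, ?_⟩; simp [probes]; done)
    | (refine ⟨imp, ?_⟩; simp [probes]; done)
    | (refine ⟨nae, ?_⟩; simp [probes]; done)
    | (refine ⟨disj 0, ?_⟩; simp [probes]; done)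
    | (refine ⟨nand 0, ?_⟩; simp [probes])

theorem Below.probes_subset {ν μ : PostNode} (h : Below ν μ) : ν.probes ⊆ μ.probes := by
  induction h with
  | refl => exact subset_rfl
  | tail _ h ih => exact ih.trans h.probes_subset

theorem eq_of_probes_eq_of_below {ν μ : PostNode} (h : Below ν μ) (he : ν.probes = μ.probes) :
    ν = μ := by
  rcases Relation.ReflTransGen.cases_head h with rfl | ⟨κ, hνκ, hκμ⟩
  · rfl
  · obtain ⟨p, hp, hp'⟩ := hνκ.exists_probe
    exact absurd (he ▸ Below.probes_subset hκμ hp) hp'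

theorem Edge.dual {ν μ : PostNode} (h : Edge ν μ) : Edge ν.dual μ.dual := by
  cases h <;> constructor

theorem Below.dual {ν μ : PostNode} (h : Below ν μ) : Below ν.dual μ.dual := by
  induction h with
  | refl => exact .refl
  | tail _ h ih => exact ih.tail h.dual

theorem below_of_below_dual {ν μ : PostNode} (h : Below ν.dual μ.dual) : Below ν μ := by
  simpa using h.dual

/-- This and the following lemmas climb down the diagram: a node lies below each node whose probes
include a few given ones, as each such node is reached by way of an upper neighbour for which the
same is known. -/
theorem below_II2 {μ : PostNode} (hI : imp ∈ μ.probes) (hO : disj 0 ∈ μ.probes) :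
    Below II2 μ := by
  cases μ <;> first
    | exact .refl
    | (refine absurd hI ?_; simp [probes]; done)
    | (refine absurd hO ?_; simp [probes])

theorem below_IM2 {μ : PostNode} (hI : imp ∈ μ.probes) :
    Below IM2 μ := by
  cases μ <;> first
    | exact .refl
    | (refine absurd hI ?_; simp [probes]; done)
    | (refine .head .IM2_II2 (below_II2 ?_ ?_) <;> simp [probes])

theorem below_IL2 {μ : PostNode} (h0 : zero ∈ μ.probes) (hN : neq ∈ μ.probes)
    (h4 : xor4 ∈ μ.probes) : Below IL2 μ := by
  cases μ <;> first
    | exact .refl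
    | (refine absurd h0 ?_; simp [probes]; done)
    | (refine absurd hN ?_; simp [probes]; done)
    | (refine absurd h4 ?_; simp [probes]; done)
    | (refine .head .IL2_II2 (below_II2 ?_ ?_) <;> simp [probes])

theorem below_IN2 {μ : PostNode} (h : nae ∈ μ.probes) :
    Below IN2 μ := by
  cases μ <;> first
    | exact .refl
    | (refine absurd h ?_; simp [probes]; done)
    | (refine .head .IN2_II2 (below_II2 ?_ ?_) <;> simp [probes])

theorem below_IS02 {μ : PostNode} (h0 : zero ∈ μ.probes) (h : ∀ r, disj r ∈ μ.probes) :
    Below IS02 μ := by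
  cases μ <;> first
    | exact .refl
    | (refine absurd h0 ?_; simp [probes]; done)
    | (refine absurd (h 0) ?_; simp [probes]; done)
    | (refine .head .IS02_II2 (below_II2 ?_ ?_) <;> simp [probes]; done)
    | (rename_i s; refine absurd (h (s + 1)) ?_; simp [probes])

theorem below_IS0 {μ : PostNode} (h : ∀ r, disj r ∈ μ.probes) : Below IS0 μ := by
  cases μ <;> first
    | exact .refl
    | (refine absurd (h 0) ?_; simp [probes]; done)
    | (refine .head .IS0_IS02 (below_IS02 ?_ ?_) <;> simp [probes]; done)
    | (rename_i s; refine absurd (h (s + 1)) ?_; simp [probes])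

theorem below_IS02k_of_le {r s : ℕ} (h : r ≤ s) : Below (IS02k r) (IS02k s) := by
  induction h with
  | refl => exact .refl
  | step _ ih => exact ih.tail (.IS02k_succ _)

theorem below_IS0k_of_le {r s : ℕ} (h : r ≤ s) : Below (IS0k r) (IS0k s) := by
  induction h with
  | refl => exact .refl
  | step _ ih => exact ih.tail (.IS0k_succ _)

theorem below_IS02k {r : ℕ} {μ : PostNode} (h0 : zero ∈ μ.probes) (h : disj r ∈ μ.probes) :
    Below (IS02k r) μ := by
  cases μ <;> first
    | (refine absurd h0 ?_; simp [probes]; done)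
    | (refine absurd h ?_; simp [probes]; done)
    | (refine below_IS02k_of_le ?_; simpa [probes] using h)
    | (refine .head (.IS02k_IS02 r) (below_IS02 ?_ ?_) <;> simp [probes])

theorem below_IS0k {r : ℕ} {μ : PostNode} (h : disj r ∈ μ.probes) : Below (IS0k r) μ := by
  cases μ <;> first
    | (refine absurd h ?_; simp [probes]; done)
    | (refine below_IS0k_of_le ?_; simpa [probes] using h)
    | (refine .head (.IS0k_IS0 r) (below_IS0 ?_); simp [probes]; done)
    | (refine .head (.IS0k_IS02k r) (below_IS02k ?_ h); simp [probes])

theorem forall_nand_iff {ν : PostNode} :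
    (∀ r, disj r ∈ ν.dual.probes) ↔ ∀ r, nand r ∈ ν.probes :=
  forall_congr' fun r => dual_mem_probes (p := nand r)

theorem below_IS12 {μ : PostNode} (h1 : one ∈ μ.probes) (h : ∀ r, nand r ∈ μ.probes) :
    Below IS12 μ :=
  below_of_below_dual (below_IS02 (dual_mem_probes.2 h1) (forall_nand_iff.2 h))

theorem below_IS1 {μ : PostNode} (h : ∀ r, nand r ∈ μ.probes) : Below IS1 μ :=
  below_of_below_dual (below_IS0 (forall_nand_iff.2 h))

theorem below_IS12k {r : ℕ} {μ : PostNode} (h1 : one ∈ μ.probes) (h : nand r ∈ μ.probes) :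
    Below (IS12k r) μ :=
  below_of_below_dual (below_IS02k (dual_mem_probes.2 h1) (dual_mem_probes.2 h))

theorem below_IS1k {r : ℕ} {μ : PostNode} (h : nand r ∈ μ.probes) : Below (IS1k r) μ :=
  below_of_below_dual (below_IS0k (dual_mem_probes.2 h))

theorem below_ID1 {μ : PostNode} (h0 : zero ∈ μ.probes) (hN : neq ∈ μ.probes) :
    Below ID1 μ := by
  cases μ <;> first
    | exact .refl
    | (refine absurd h0 ?_; simp [probes]; done)
    | (refine absurd hN ?_; simp [probes]; done)
    | (refine .head .ID1_IL2 (below_IL2 ?_ ?_ ?_) <;> simp [probes])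

theorem below_IL0 {μ : PostNode} (h0 : zero ∈ μ.probes) (h4 : xor4 ∈ μ.probes) :
    Below IL0 μ := by
  cases μ <;> first
    | exact .refl
    | (refine absurd h0 ?_; simp [probes]; done)
    | (refine absurd h4 ?_; simp [probes]; done)
    | (refine .head .IL0_IL2 (below_IL2 ?_ ?_ ?_) <;> simp [probes])

theorem below_IL1 {μ : PostNode} (h1 : one ∈ μ.probes) (h4 : xor4 ∈ μ.probes) : Below IL1 μ :=
  below_of_below_dual (below_IL0 (dual_mem_probes.2 h1) (dual_mem_probes.2 h4))

theorem below_IL3 {μ : PostNode} (hN : neq ∈ μ.probes) (h4 : xor4 ∈ μ.probes) :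
    Below IL3 μ := by
  cases μ <;> first
    | exact .refl
    | (refine absurd hN ?_; simp [probes]; done)
    | (refine absurd h4 ?_; simp [probes]; done)
    | (refine .head .IL3_IL2 (below_IL2 ?_ ?_ ?_) <;> simp [probes]; done)
    | (refine .head .IL3_IN2 (below_IN2 ?_); simp [probes])

theorem below_IR2 {μ : PostNode} (h0 : zero ∈ μ.probes) (h1 : one ∈ μ.probes) :
    Below IR2 μ := by
  cases μ <;> first
    | exact .refl
    | (refine absurd h0 ?_; simp [probes]; done)
    | (refine absurd h1 ?_; simp [probes]; done)
    | (refine .head .IR2_ID1 (below_ID1 ?_ ?_) <;> simp [probes]; done)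
    | (refine .head .IR2_IM2 (below_IM2 ?_); simp [probes]; done)
    | (refine .head .IR2_IS02k (below_IS02k ?_ ?_) <;> simp [probes]; done)
    | (refine .head .IR2_IS12k (below_IS12k ?_ ?_) <;> simp [probes])

theorem below_IR0 {μ : PostNode} (h0 : zero ∈ μ.probes) :
    Below IR0 μ := by
  cases μ <;> first
    | exact .refl
    | (refine absurd h0 ?_; simp [probes]; done)
    | (refine .head .IR0_IR2 (below_IR2 ?_ ?_) <;> simp [probes]; done)
    | (refine .head .IR0_IL0 (below_IL0 ?_ ?_) <;> simp [probes]; done)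
    | (refine .head .IR0_IS1k (below_IS1k ?_); simp [probes])

theorem below_IR1 {μ : PostNode} (h1 : one ∈ μ.probes) : Below IR1 μ :=
  below_of_below_dual (below_IR0 (dual_mem_probes.2 h1))

theorem below_ID {μ : PostNode} (hN : neq ∈ μ.probes) :
    Below ID μ := by
  cases μ <;> first
    | exact .refl
    | (refine absurd hN ?_; simp [probes]; done)
    | (refine .head .ID_ID1 (below_ID1 ?_ ?_) <;> simp [probes]; done)
    | (refine .head .ID_IL3 (below_IL3 ?_ ?_) <;> simp [probes])

theorem below_IL {μ : PostNode} (h4 : xor4 ∈ μ.probes) :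
    Below IL μ := by
  cases μ <;> first
    | exact .refl
    | (refine absurd h4 ?_; simp [probes]; done)
    | (refine .head .IL_IL0 (below_IL0 ?_ ?_) <;> simp [probes]; done)
    | (refine .head .IL_IL1 (below_IL1 ?_ ?_) <;> simp [probes]; done)
    | (refine .head .IL_IL3 (below_IL3 ?_ ?_) <;> simp [probes])

theorem below_IBF {μ : PostNode} :
    Below IBF μ := by
  cases μ <;> first
    | exact .refl
    | (refine .head .IBF_IR0 (below_IR0 ?_); simp [probes]; done)
    | (refine .head .IBF_IR1 (below_IR1 ?_); simp [probes]; done)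
    | (refine .head .IBF_ID (below_ID ?_); simp [probes]; done)
    | (refine .head .IBF_IL (below_IL ?_); simp [probes])

theorem below_of_probes_subset {ν μ : PostNode} (h : ν.probes ⊆ μ.probes) : Below ν μ := by
  cases ν
  case IBF => exact below_IBF
  case IR0 => exact below_IR0 (h (by simp [probes]))
  case IR1 => exact below_IR1 (h (by simp [probes]))
  case IR2 => exact below_IR2 (h (by simp [probes])) (h (by simp [probes]))
  case IM2 => exact below_IM2 (h (by simp [probes]))
  case IS0k r => exact below_IS0k (h (by simp [probes]))
  case IS0 => exact below_IS0 fun r => h (by simp [probes])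
  case IS1k r => exact below_IS1k (h (by simp [probes]))
  case IS1 => exact below_IS1 fun r => h (by simp [probes])
  case IS02k r => exact below_IS02k (h (by simp [probes])) (h (by simp [probes]))
  case IS02 => exact below_IS02 (h (by simp [probes])) fun r => h (by simp [probes])
  case IS12k r => exact below_IS12k (h (by simp [probes])) (h (by simp [probes]))
  case IS12 => exact below_IS12 (h (by simp [probes])) fun r => h (by simp [probes])
  case ID => exact below_ID (h (by simp [probes]))
  case ID1 => exact below_ID1 (h (by simp [probes])) (h (by simp [probes]))
  case IL => exact below_IL (h (by simp [probes]))
  case IL0 => exact below_IL0 (h (by simp [probes])) (h (by simp [probes]))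
  case IL1 => exact below_IL1 (h (by simp [probes])) (h (by simp [probes]))
  case IL2 =>
    exact below_IL2 (h (by simp [probes])) (h (by simp [probes])) (h (by simp [probes]))
  case IL3 => exact below_IL3 (h (by simp [probes])) (h (by simp [probes]))
  case IN2 => exact below_IN2 (h (by simp [probes]))
  case II2 => exact below_II2 (h (by simp [probes])) (h (by simp [probes]))

theorem sem_subset_withEmpty_iff {ν μ : PostNode} :
    withEmpty ν.sem ⊆ withEmpty μ.sem ↔ Below ν μ := by
  refine ⟨fun h => below_of_probes_subset fun p hp => mem_probes_of_rel_mem ?_, fun h => ?_⟩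
  · exact h (Or.inl (rel_mem_sem_iff.2 hp))
  · exact Set.union_subset_union_left _ (sem_subset_of_probes μ.isMaxCoclone_sem fun p hp =>
      rel_mem_sem_iff.2 (h.probes_subset hp))

theorem sem_subset_iff {ν μ : PostNode} : ν.sem ⊆ μ.sem ↔ Below ν μ := by
  refine ⟨fun h => below_of_probes_subset fun p hp => ?_, fun h => ?_⟩
  · exact rel_mem_sem_iff.1 (h (rel_mem_sem_iff.2 hp))
  · exact sem_subset_of_probes μ.isMaxCoclone_sem fun p hp =>
      rel_mem_sem_iff.2 (h.probes_subset hp)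

theorem sem_injective {ν μ : PostNode} (h : ν.sem = μ.sem) : ν = μ := by
  refine eq_of_probes_eq_of_below (sem_subset_iff.1 h.subset) (Set.ext fun p => ?_)
  rw [← rel_mem_sem_iff, ← rel_mem_sem_iff, h]

theorem exists_empty_mem_sem_iff {ν : PostNode} :
    (∃ R ∈ ν.sem, R.tuples = ∅) ↔ ¬ ν.ConstValid := by
  constructor
  · rintro ⟨R, hR, he⟩ hν
    exact (nonempty_of_constValid hν hR).ne_empty he
  · intro hν
    have := has_empty_of_probes ν.isCoclone_sem.isConjClosed hν
      (fun p hp => rel_mem_sem_iff.2 hp) Nat.one_pos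
    exact ⟨_, this.2, rfl⟩

theorem affine_or_inChain (ν : PostNode) :
    ν.Affine ∨ ν.InChain ∨ ν = IM2 ∨ ν = IN2 ∨ ν = II2 := by
  cases ν <;> simp [Affine, ops, InChain]

end PostNode

theorem mainTheorem4 :
    -- the Boolean max-co-clones are exactly the listed ones, up to the empty relation
    (∀ Γ : Set BoolRel, IsMaxCoclone Γ ↔
      ∃ ν : PostNode, Γ = ν.coclone ∨ Γ = withEmpty ν.coclone) ∧
    -- they are pairwise distinct and ordered by inclusion as in the diagram,
    -- with or without the empty relation
    (∀ ν μ : PostNode, ν.coclone = μ.coclone → ν = μ) ∧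
    (∀ ν μ : PostNode, ν.coclone ⊆ μ.coclone ↔ PostNode.Below ν μ) ∧
    (∀ ν μ : PostNode, withEmpty ν.coclone ⊆ withEmpty μ.coclone ↔ PostNode.Below ν μ) ∧
    (∀ ν : PostNode, (∃ R ∈ ν.coclone, R.tuples = ∅) ↔ ¬ ν.ConstValid) ∧
    -- the table of generating sets
    (∀ ν : PostNode, maxCocloneGen ν.maxBasis = ν.coclone) ∧
    -- affine max-co-clones are exactly the affine co-clones
    (∀ Γ : Set BoolRel, (∀ R ∈ Γ, R.IsAffine) → (IsMaxCoclone Γ ↔ IsCoclone Γ)) ∧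
    -- every proper max-co-clone is affine, or one of `IN_2`, `IM_2`, or in one of the chains
    (∀ Γ : Set BoolRel, IsMaxCoclone Γ → Γ ≠ Set.univ →
      (∀ R ∈ Γ, R.IsAffine) ∨ Γ = PostNode.IN2.coclone ∨ Γ = PostNode.IM2.coclone ∨
        ∃ ν : PostNode, ν.InChain ∧ (Γ = ν.coclone ∨ Γ = withEmpty ν.coclone)) ∧
    -- every max-co-clone is a co-clone
    (∀ Γ : Set BoolRel, IsMaxCoclone Γ → IsCoclone Γ) := by
  simp only [PostNode.coclone_eq_sem]
  refine ⟨fun Γ => ⟨PostNode.exists_node, ?_⟩, fun ν μ => PostNode.sem_injective,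
    fun ν μ => PostNode.sem_subset_iff, fun ν μ => PostNode.sem_subset_withEmpty_iff,
    fun ν => PostNode.exists_empty_mem_sem_iff, PostNode.maxCocloneGen_maxBasis,
    fun Γ h => isMaxCoclone_iff_isCoclone_of_affine fun R hR => isAffine_iff.1 (h R hR),
    fun Γ hΓ hU => ?_, fun Γ hΓ => ?_⟩
  · rintro ⟨ν, rfl | rfl⟩
    · exact ν.isMaxCoclone_sem
    · exact ν.isMaxCoclone_sem.withEmpty
  · obtain ⟨ν, h⟩ := PostNode.exists_node hΓ
    have hE : ¬ ν.ConstValid → Γ = ν.sem := by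
      intro hν
      obtain ⟨R, hR, he⟩ := PostNode.exists_empty_mem_sem_iff.2 hν
      have h2 : Has ν.sem (∅ : Set (Fin R.arity → Bool)) := he ▸ has_tuples.2 hR
      rcases h with h | h
      · exact h
      · rw [h, withEmpty_eq_self ν.isCoclone_sem.isConjClosed h2]
    rcases ν.affine_or_inChain with hν | hν | rfl | rfl | rfl
    · left
      intro R hR
      rw [isAffine_iff]
      rcases h with rfl | rfl
      · exact PostNode.pres_xor3_of_mem_sem hν hR
      · rcases hR with hR | hR
        · exact PostNode.pres_xor3_of_mem_sem hν hR
        · rw [show R.tuples = ∅ from hR]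
          exact pres_xor3_empty
    · exact Or.inr (Or.inr (Or.inr ⟨ν, hν, h⟩))
    · exact Or.inr (Or.inr (Or.inl (hE id)))
    · exact Or.inr (Or.inl (hE id))
    · exact absurd ((hE id).trans PostNode.sem_II2) hU
  · obtain ⟨ν, rfl | rfl⟩ := PostNode.exists_node hΓ
    · exact ν.isCoclone_sem
    · exact ν.isCoclone_sem.withEmpty
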